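/- Let $\Omega\subset V=\mathbb R^n$ ($n\ge 1$) be an irreducible symmetric cone, that is, a nonempty open convex cone which is self-dual for the scalar product $\langle\cdot,\cdot\rangle$ of $V$, homogeneous under the linear automorphisms preserving it, and not the sum of two cones lying in the two summands of a decomposition of $V$ as a direct sum of two nonzero subspaces. Let $V$ carry a Euclidean Jordan algebra structure, with unit $e$, for which $\langle\cdot,\cdot\rangle$ is associative and $\Omega$ is the interior of the set of squares. Let $r$ be its rank and $\Delta$ its determinant, let $T_\Omega=V+i\Omega\subset\mathbb C^n$, let $\Box=\Delta\big(\tfrac1i\tfrac{\partial}{\partial x}\big)$ be the constant-coefficient differential operator with $\Box\, e^{i\langle x,\xi\rangle}=\Delta(\xi)e^{i\langle x,\xi\rangle}$, and let $$\Gamma_\Omega(\nu)=\int_\Omega e^{-\langle e,y\rangle}\Delta(y)^{\nu-\frac nr}\,dy .$$ Let $H^2(T_\Omega)$ be the space of holomorphic $F$ on $T_\Omega$ with $\|F\|^2_{H^2}=\sup_{y\in\Omega}\int_V|F(x+iy)|^2dx<\infty$, and let $A^2_\nu(T_\Omega)$ be the space of holomorphic $G$ on $T_\Omega$ with $\|G\|^2_{A^2_\nu}=\int_{V\times\Omega}|G(x+iy)|^2\Delta(y)^{\nu-\frac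 nr}dx\,dy<\infty$. If $m$ is an integer with $2m>\frac nr-1$, then $\Box^m$ is a bounded linear isomorphism, with bounded inverse, from $H^2(T_\Omega)$ onto $A^2_{2m}(T_\Omega)$, and for every $F\in H^2(T_\Omega)$ $$\|\Box^mF\|^2_{A^2_{2m}}=2^{-2mr}\,\Gamma_\Omega(2m)\,\|F\|^2_{H^2}.$$ -/

import Mathlib

open MeasureTheory
open scoped ENNReal

/-- The real Euclidean space `V = ℝⁿ`; its inner product is the scalar product `⟨·,·⟩` and
`volume` on it is Lebesgue measure. -/
abbrev RSpace (n : ℕ) := EuclideanSpace ℝ (Fin n)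

/-- The complexification `ℂⁿ = V + iV`. -/
abbrev CSpace (n : ℕ) := EuclideanSpace ℂ (Fin n)

/-! ### Symmetric cones -/

/-- Symmetric cones: nonempty open convex cones that are self-dual for the scalar product
and homogeneous. -/
structure IsSymmetricCone {n : ℕ} (Ω : Set (RSpace n)) : Prop where
  nonempty : Ω.Nonempty
  isOpen : IsOpen Ω
  convex : Convex ℝ Ω
  smul_mem : ∀ t : ℝ, 0 < t → ∀ x ∈ Ω, t • x ∈ Ω
  selfDual : Ω = {y | ∀ x ∈ closure Ω, x ≠ 0 → 0 < inner ℝ x y}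
  homogeneous : ∀ x ∈ Ω, ∀ y ∈ Ω, ∃ g : RSpace n ≃ₗ[ℝ] RSpace n, g '' Ω = Ω ∧ g x = y

/-- A cone in `ℝⁿ`, `n ≥ 1`, is irreducible when it is not a sum `Ω₁ + Ω₂` with
`Ω₁ ⊆ V₁`, `Ω₂ ⊆ V₂` for a decomposition `V = V₁ ⊕ V₂` into two nonzero subspaces. -/
def IsIrreducibleCone {n : ℕ} (Ω : Set (RSpace n)) : Prop :=
  0 < n ∧ ∀ V₁ V₂ : Submodule ℝ (RSpace n), IsCompl V₁ V₂ →
    (∃ Ω₁ Ω₂ : Set (RSpace n), Ω₁ ⊆ V₁ ∧ Ω₂ ⊆ V₂ ∧ Ω = Set.image2 (fun x y => x + y) Ω₁ Ω₂) →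
    V₁ = ⊥ ∨ V₂ = ⊥

/-! ### Euclidean Jordan algebras, rank and determinant -/

/-- A Euclidean Jordan algebra structure on `V`: a commutative bilinear product with unit that
satisfies the Jordan identity and for which the scalar product is associative. -/
structure EuclideanJordanAlgebra (n : ℕ) where
  mul : RSpace n →ₗ[ℝ] RSpace n →ₗ[ℝ] RSpace n
  one : RSpace n
  mul_comm : ∀ x y, mul x y = mul y x
  one_mul : ∀ x, mul one x = x
  jordan : ∀ x y, mul x (mul (mul x x) y) = mul (mul x x) (mul x y)
  inner_mul : ∀ x y z, inner ℝ (mul x y) z = inner ℝ y (mul x z)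

namespace EuclideanJordanAlgebra

variable {n : ℕ} (J : EuclideanJordanAlgebra n)

/-- The cone of the Jordan algebra: the interior of the set of squares. -/
def cone : Set (RSpace n) := interior (Set.range fun x => J.mul x x)

/-- Powers: `x⁰ = e`, `xᵏ⁺¹ = x xᵏ`. -/
def pow (x : RSpace n) : ℕ → RSpace n
  | 0 => J.one
  | k + 1 => J.mul x (pow x k)

/-- The value `q(x) = ∑ qₖ xᵏ` of a real polynomial. -/
noncomputable def polyEval (q : Polynomial ℝ) (x : RSpace n) : RSpace n :=
  q.sum fun k a => a • J.pow x k

/-- The degree of the minimal polynomial of `x`: the least `k` for which `e, x, …, xᵏ` are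
linearly dependent. -/
noncomputable def degree (x : RSpace n) : ℕ :=
  sInf {k : ℕ | ¬ LinearIndependent ℝ fun i : Fin (k + 1) => J.pow x i}

/-- The rank: the largest degree of a minimal polynomial (all of them are at most `n`). -/
noncomputable def rank : ℕ := ⨆ x : RSpace n, J.degree x

/-- `p` is the determinant polynomial: at every regular `x` (an `x` of degree `r`) the minimal
polynomial `q` of `x` has constant term `(-1)ʳ p(x)`. -/
def IsDetPoly (p : MvPolynomial (Fin n) ℝ) : Prop :=
  ∀ x : RSpace n, J.degree x = J.rank →
    ∀ q : Polynomial ℝ, q.Monic → q.natDegree = J.rank → J.polyEval q x = 0 →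
      MvPolynomial.eval (fun j => x j) p = (-1) ^ J.rank * q.coeff 0

/-- The determinant, as a polynomial in the coordinates. It is the unique polynomial with the
defining property, because the regular elements are dense. -/
noncomputable def detPoly : MvPolynomial (Fin n) ℝ := Classical.epsilon J.IsDetPoly

/-- The determinant function `Δ`. -/
noncomputable def det (x : RSpace n) : ℝ := MvPolynomial.eval (fun j => x j) J.detPoly

/-- The gamma function `Γ_Ω(ν) = ∫_Ω e^{-⟨e, y⟩} Δ(y)^{ν - n/r} dy`. -/
noncomputable def gammaCone (ν : ℝ) : ℝ :=
  ∫ y in J.cone, Real.exp (-inner ℝ J.one y) * J.det y ^ (ν - (n : ℝ) / J.rank)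

end EuclideanJordanAlgebra

/-! ### Tube domains and differential operators -/

section Tube

variable {n : ℕ}

/-- The tube `T_Ω = V + iΩ`. -/
def tube (Ω : Set (RSpace n)) : Set (CSpace n) :=
  {z | WithLp.toLp 2 (fun j => (z j).im) ∈ Ω}

/-- The point `x + iy` of the tube. -/
def tubePoint {Ω : Set (RSpace n)} (x : RSpace n) (y : Ω) : tube Ω :=
  ⟨WithLp.toLp 2 fun j => (⟨x j, (y : RSpace n) j⟩ : ℂ), y.2⟩

/-- Extension by zero of a function on the tube to `ℂⁿ`. -/
noncomputable def zeroExtend {Ω : Set (RSpace n)} (F : tube Ω → ℂ) : CSpace n → ℂ :=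
  Function.extend Subtype.val F 0

/-- Holomorphy on the tube. -/
def IsHolomorphic {Ω : Set (RSpace n)} (F : tube Ω → ℂ) : Prop :=
  DifferentiableOn ℂ (zeroExtend F) (tube Ω)

/-- The partial derivative `∂/∂x_j`. -/
noncomputable def partialX (j : Fin n) (F : CSpace n → ℂ) : CSpace n → ℂ :=
  fun z => lineDeriv ℝ F z (EuclideanSpace.single j (1 : ℂ))

/-- The iterated partial derivative `∂^α = ∂₁^{α₁} ⋯ ∂ₙ^{αₙ}`. -/
noncomputable def partialPow (α : Fin n →₀ ℕ) (F : CSpace n → ℂ) : CSpace n → ℂ :=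
  (List.finRange n).foldr (fun j G => (partialX j)^[α j] G) F

/-- The operator `p((1/i) ∂/∂x) = ∑_α p_α (1/i)^{|α|} ∂^α`. -/
noncomputable def diffOp (p : MvPolynomial (Fin n) ℝ) (F : CSpace n → ℂ) : CSpace n → ℂ :=
  fun z => ∑ α ∈ p.support,
    ((p.coeff α : ℝ) : ℂ) * (1 / Complex.I) ^ (∑ j, α j) * partialPow α F z

/-- The box operator `□ = Δ((1/i) ∂/∂x)` on functions on the tube. -/
noncomputable def EuclideanJordanAlgebra.box (J : EuclideanJordanAlgebra n) {Ω : Set (RSpace n)}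
    (F : tube Ω → ℂ) : tube Ω → ℂ :=
  fun z => diffOp J.detPoly (zeroExtend F) z

/-! ### Hardy and Bergman spaces -/

/-- `sup_{y ∈ Ω} (∫_V |F(x + iy)|² dx)^{1/2}`, possibly infinite. -/
noncomputable def hardyENorm {Ω : Set (RSpace n)} (F : tube Ω → ℂ) : ℝ≥0∞ :=
  ⨆ y : Ω, eLpNorm (fun x : RSpace n => F (tubePoint x y)) 2 volume

/-- The measure `dV_ν(x + iy) = Δ(y)^{ν - n/r} dx dy` in the coordinates
`(x, y) ∈ V × Ω` of the tube. -/
noncomputable def EuclideanJordanAlgebra.bergmanMeasure (J : EuclideanJordanAlgebra n)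
    (Ω : Set (RSpace n)) (ν : ℝ) : Measure (RSpace n × Ω) :=
  ((volume : Measure (RSpace n)).prod (Measure.comap Subtype.val (volume : Measure (RSpace n)))
    ).withDensity fun p => ENNReal.ofReal (J.det p.2 ^ (ν - (n : ℝ) / J.rank))

/-- `(∫_{T_Ω} |F|² dV_ν)^{1/2}`, possibly infinite. -/
noncomputable def EuclideanJordanAlgebra.bergmanENorm (J : EuclideanJordanAlgebra n)
    {Ω : Set (RSpace n)} (ν : ℝ) (F : tube Ω → ℂ) : ℝ≥0∞ :=
  eLpNorm (fun p : RSpace n × Ω => F (tubePoint p.1 p.2)) 2 (J.bergmanMeasure Ω ν)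

theorem zeroExtend_coe {Ω : Set (RSpace n)} (F : tube Ω → ℂ) (z : tube Ω) :
    zeroExtend F z = F z :=
  Subtype.val_injective.extend_apply F 0 z

theorem zeroExtend_eqOn_add {Ω : Set (RSpace n)} (F G : tube Ω → ℂ) :
    Set.EqOn (zeroExtend (F + G)) (zeroExtend F + zeroExtend G) (tube Ω) := fun z hz => by
  have h := fun F : tube Ω → ℂ => zeroExtend_coe F ⟨z, hz⟩
  simp only [] at h
  simp [h]

theorem zeroExtend_eqOn_smul {Ω : Set (RSpace n)} (c : ℂ) (F : tube Ω → ℂ) :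
    Set.EqOn (zeroExtend (c • F)) (c • zeroExtend F) (tube Ω) := fun z hz => by
  have h := fun F : tube Ω → ℂ => zeroExtend_coe F ⟨z, hz⟩
  simp only [] at h
  simp [h]

theorem IsHolomorphic.zero {Ω : Set (RSpace n)} : IsHolomorphic (0 : tube Ω → ℂ) :=
  (differentiableOn_const (0 : ℂ)).congr fun z hz => zeroExtend_coe 0 ⟨z, hz⟩

theorem IsHolomorphic.add {Ω : Set (RSpace n)} {F G : tube Ω → ℂ} (hF : IsHolomorphic F)
    (hG : IsHolomorphic G) : IsHolomorphic (F + G) :=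
  (DifferentiableOn.add hF hG).congr (zeroExtend_eqOn_add F G)

theorem IsHolomorphic.smul {Ω : Set (RSpace n)} {F : tube Ω → ℂ} (c : ℂ)
    (hF : IsHolomorphic F) : IsHolomorphic (c • F) :=
  (DifferentiableOn.const_smul hF c).congr (zeroExtend_eqOn_smul c F)

theorem IsHolomorphic.continuous {Ω : Set (RSpace n)} {F : tube Ω → ℂ}
    (hF : IsHolomorphic F) : Continuous F := by
  have h := (continuousOn_iff_continuous_domRestrict.1 (DifferentiableOn.continuousOn hF))
  convert h using 1
  funext z
  exact (zeroExtend_coe F z).symm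

theorem continuous_tubePoint {Ω : Set (RSpace n)} :
    Continuous fun p : RSpace n × Ω => tubePoint p.1 p.2 := by
  refine Continuous.subtype_mk ((PiLp.continuous_toLp 2 _).comp (continuous_pi fun j => ?_)) _
  have h : (fun p : RSpace n × Ω => (⟨p.1 j, (p.2 : RSpace n) j⟩ : ℂ)) =
      fun p => ((p.1 j : ℝ) : ℂ) + (((p.2 : RSpace n) j : ℝ) : ℂ) * Complex.I := by
    funext p
    exact Complex.mk_eq_add_mul_I _ _
  rw [h]
  fun_prop

theorem hardyENorm_add_le {Ω : Set (RSpace n)} {F G : tube Ω → ℂ} (hF : IsHolomorphic F)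
    (hG : IsHolomorphic G) : hardyENorm (F + G) ≤ hardyENorm F + hardyENorm G := by
  refine iSup_le fun y => ?_
  have hc : Continuous fun x : RSpace n => tubePoint x y :=
    continuous_tubePoint.comp (by fun_prop : Continuous fun x : RSpace n => (x, y))
  exact (eLpNorm_add_le (hF.continuous.comp hc).aestronglyMeasurable
    (hG.continuous.comp hc).aestronglyMeasurable (by norm_num)).trans
    (add_le_add (le_iSup (fun y : Ω => eLpNorm (fun x => F (tubePoint x y)) 2 volume) y)
      (le_iSup (fun y : Ω => eLpNorm (fun x => G (tubePoint x y)) 2 volume) y))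

theorem hardyENorm_smul {Ω : Set (RSpace n)} (c : ℂ) (F : tube Ω → ℂ) :
    hardyENorm (c • F) = ‖c‖ₑ * hardyENorm F := by
  unfold hardyENorm
  rw [ENNReal.mul_iSup]
  exact iSup_congr fun y => eLpNorm_const_smul c (fun x : RSpace n => F (tubePoint x y)) 2 volume

theorem hardyENorm_zero {Ω : Set (RSpace n)} : hardyENorm (0 : tube Ω → ℂ) = 0 := by
  simp [hardyENorm]

theorem EuclideanJordanAlgebra.bergmanENorm_add_le (J : EuclideanJordanAlgebra n)
    {Ω : Set (RSpace n)} (ν : ℝ) {F G : tube Ω → ℂ} (hF : IsHolomorphic F)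
    (hG : IsHolomorphic G) :
    J.bergmanENorm ν (F + G) ≤ J.bergmanENorm ν F + J.bergmanENorm ν G :=
  eLpNorm_add_le (hF.continuous.comp continuous_tubePoint).aestronglyMeasurable
    (hG.continuous.comp continuous_tubePoint).aestronglyMeasurable (by norm_num)

theorem EuclideanJordanAlgebra.bergmanENorm_smul (J : EuclideanJordanAlgebra n)
    {Ω : Set (RSpace n)} (ν : ℝ) (c : ℂ) (F : tube Ω → ℂ) :
    J.bergmanENorm ν (c • F) = ‖c‖ₑ * J.bergmanENorm ν F :=
  eLpNorm_const_smul c (fun p : RSpace n × Ω => F (tubePoint p.1 p.2)) 2 _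

theorem EuclideanJordanAlgebra.bergmanENorm_zero (J : EuclideanJordanAlgebra n)
    {Ω : Set (RSpace n)} (ν : ℝ) : J.bergmanENorm ν (0 : tube Ω → ℂ) = 0 := by
  simp [EuclideanJordanAlgebra.bergmanENorm]

/-- Holomorphic functions on the tube with finite Hardy norm. -/
noncomputable def hardySubmodule (Ω : Set (RSpace n)) : Submodule ℂ (tube Ω → ℂ) where
  carrier := {F | IsHolomorphic F ∧ hardyENorm F < ∞}
  zero_mem' := ⟨IsHolomorphic.zero, by simp [hardyENorm_zero]⟩
  add_mem' hF hG := ⟨hF.1.add hG.1,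
    (hardyENorm_add_le hF.1 hG.1).trans_lt (ENNReal.add_lt_top.2 ⟨hF.2, hG.2⟩)⟩
  smul_mem' c F hF := ⟨hF.1.smul c, by
    rw [hardyENorm_smul]; exact ENNReal.mul_lt_top enorm_lt_top hF.2⟩

/-- Holomorphic functions on the tube with finite Bergman norm. -/
noncomputable def EuclideanJordanAlgebra.bergmanSubmodule (J : EuclideanJordanAlgebra n)
    (Ω : Set (RSpace n)) (ν : ℝ) : Submodule ℂ (tube Ω → ℂ) where
  carrier := {F | IsHolomorphic F ∧ J.bergmanENorm ν F < ∞}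
  zero_mem' := ⟨IsHolomorphic.zero, by simp [EuclideanJordanAlgebra.bergmanENorm_zero]⟩
  add_mem' hF hG := ⟨hF.1.add hG.1,
    (J.bergmanENorm_add_le ν hF.1 hG.1).trans_lt (ENNReal.add_lt_top.2 ⟨hF.2, hG.2⟩)⟩
  smul_mem' c F hF := ⟨hF.1.smul c, by
    rw [EuclideanJordanAlgebra.bergmanENorm_smul]; exact ENNReal.mul_lt_top enorm_lt_top hF.2⟩

/-- The Hardy space `H²(T_Ω)`, with the topology of its norm (not of pointwise convergence). -/
def HardySpace (Ω : Set (RSpace n)) : Type := ↥(hardySubmodule Ω)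

/-- The weighted Bergman space `A²_ν(T_Ω)`, with the topology of its norm (not of pointwise
convergence). -/
def BergmanSpace (J : EuclideanJordanAlgebra n) (Ω : Set (RSpace n)) (ν : ℝ) : Type :=
  ↥(J.bergmanSubmodule Ω ν)

noncomputable instance (Ω : Set (RSpace n)) : AddCommGroup (HardySpace Ω) :=
  inferInstanceAs (AddCommGroup ↥(hardySubmodule Ω))

noncomputable instance (Ω : Set (RSpace n)) : Module ℂ (HardySpace Ω) :=
  inferInstanceAs (Module ℂ ↥(hardySubmodule Ω))

noncomputable instance (J : EuclideanJordanAlgebra n) (Ω : Set (RSpace n)) (ν : ℝ) :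
    AddCommGroup (BergmanSpace J Ω ν) :=
  inferInstanceAs (AddCommGroup ↥(J.bergmanSubmodule Ω ν))

noncomputable instance (J : EuclideanJordanAlgebra n) (Ω : Set (RSpace n)) (ν : ℝ) :
    Module ℂ (BergmanSpace J Ω ν) :=
  inferInstanceAs (Module ℂ ↥(J.bergmanSubmodule Ω ν))

/-- The function on the tube underlying an element of the Hardy space. -/
def HardySpace.toFun {Ω : Set (RSpace n)} (F : HardySpace Ω) : tube Ω → ℂ := F.1

/-- The function on the tube underlying an element of the Bergman space. -/
def BergmanSpace.toFun {J : EuclideanJordanAlgebra n} {Ω : Set (RSpace n)} {ν : ℝ}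
    (F : BergmanSpace J Ω ν) : tube Ω → ℂ := F.1

/-- The Hardy norm as a group seminorm. -/
noncomputable def HardySpace.groupSeminorm (Ω : Set (RSpace n)) :
    AddGroupSeminorm (HardySpace Ω) where
  toFun F := (hardyENorm F.toFun).toReal
  map_zero' := by
    change (hardyENorm (0 : tube Ω → ℂ)).toReal = 0
    simp [hardyENorm_zero]
  add_le' F G := by
    refine (ENNReal.toReal_mono (ENNReal.add_lt_top.2 ⟨F.2.2, G.2.2⟩).ne
      (hardyENorm_add_le F.2.1 G.2.1)).trans_eq
      (ENNReal.toReal_add F.2.2.ne G.2.2.ne)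
  neg' F := by
    have h : (-F).toFun = (-1 : ℂ) • F.toFun := (neg_one_smul ℂ F.toFun).symm
    rw [h, hardyENorm_smul]
    simp

/-- The Bergman norm as a group seminorm. -/
noncomputable def BergmanSpace.groupSeminorm (J : EuclideanJordanAlgebra n)
    (Ω : Set (RSpace n)) (ν : ℝ) : AddGroupSeminorm (BergmanSpace J Ω ν) where
  toFun F := (J.bergmanENorm ν F.toFun).toReal
  map_zero' := by
    change (J.bergmanENorm ν (0 : tube Ω → ℂ)).toReal = 0
    simp [EuclideanJordanAlgebra.bergmanENorm_zero]
  add_le' F G := by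
    refine (ENNReal.toReal_mono (ENNReal.add_lt_top.2 ⟨F.2.2, G.2.2⟩).ne
      (J.bergmanENorm_add_le ν F.2.1 G.2.1)).trans_eq
      (ENNReal.toReal_add F.2.2.ne G.2.2.ne)
  neg' F := by
    have h : (-F).toFun = (-1 : ℂ) • F.toFun := (neg_one_smul ℂ F.toFun).symm
    rw [h, EuclideanJordanAlgebra.bergmanENorm_smul]
    simp

/-- `‖F‖ = (sup_{y ∈ Ω} ∫_V |F(x + iy)|² dx)^{1/2}`. (It is definite; the statement needs only
the seminorm axioms.) -/
noncomputable instance (Ω : Set (RSpace n)) : SeminormedAddCommGroup (HardySpace Ω) :=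
  (HardySpace.groupSeminorm Ω).toSeminormedAddCommGroup

/-- `‖F‖ = (∫_{T_Ω} |F|² dV_ν)^{1/2}`. (It is definite when `Ω` is the cone of `J`, because `Δ`
is positive there; the statement needs only the seminorm axioms.) -/
noncomputable instance (J : EuclideanJordanAlgebra n) (Ω : Set (RSpace n)) (ν : ℝ) :
    SeminormedAddCommGroup (BergmanSpace J Ω ν) :=
  (BergmanSpace.groupSeminorm J Ω ν).toSeminormedAddCommGroup

noncomputable instance (Ω : Set (RSpace n)) : NormedSpace ℂ (HardySpace Ω) where
  norm_smul_le c F := by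
    have h : ‖c • F‖ = (hardyENorm (c • F.toFun)).toReal := rfl
    rw [h, hardyENorm_smul, ENNReal.toReal_mul, toReal_enorm]
    rfl

noncomputable instance (J : EuclideanJordanAlgebra n) (Ω : Set (RSpace n)) (ν : ℝ) :
    NormedSpace ℂ (BergmanSpace J Ω ν) where
  norm_smul_le c F := by
    have h : ‖c • F‖ = (J.bergmanENorm ν (c • F.toFun)).toReal := rfl
    rw [h, EuclideanJordanAlgebra.bergmanENorm_smul, ENNReal.toReal_mul, toReal_enorm]
    rfl

theorem HardySpace.norm_def {Ω : Set (RSpace n)} (F : HardySpace Ω) :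
    ‖F‖ = (hardyENorm F.toFun).toReal := rfl

theorem BergmanSpace.norm_def {J : EuclideanJordanAlgebra n} {Ω : Set (RSpace n)} {ν : ℝ}
    (F : BergmanSpace J Ω ν) : ‖F‖ = (J.bergmanENorm ν F.toFun).toReal := rfl

end Tube

/-! The Fourier–Laplace transform turns both norms into weighted `L²` norms on the cone and `□` into
a multiplication. If `F(z) = ∫_Ω e^{2πi⟨z,ξ⟩} f(ξ) dξ`, Plancherel on `V + iy` gives `∫ |F(x+iy)|²
dx = ∫_Ω e^{-4π⟨y,ξ⟩} |f(ξ)|² dξ`. The supremum over `y` is `∫_Ω |f|²` (`iSup_sliceEnergy`), while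
integration against `Δ(y)^{ν-n/r}` gives `Γ_Ω(ν) ∫_Ω Δ(4πξ)^{-ν} |f|²` (`bergmanENorm_sq_of_eqOn`).
As `□ᵐ` multiplies `f` by `Δ(2πξ)ᵐ` (`IsLaplaceAdmissible.box_iterate`), for `ν = 2m` the powers of
`Δ` cancel up to `2^{-2mr}`. Surjectivity is division of the spectrum by `Δ(2πξ)ᵐ`.

Two facts have to be proved. The first is the gamma integral `∫_Ω e^{-⟨x,y⟩} Δ(y)^s dy =
Δ(x)^{-(s+n/r)} ∫_Ω e^{-⟨e,y⟩} Δ(y)^s dy` (`lintegral_gammaDensity`), finite for `s > -1`. It is a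
change of variables by a symmetric automorphism `g` of the cone with `g e = x`, `Δ(gy) = Δ(x)Δ(y)`
and `det g = Δ(x)^{n/r}`, namely `g = exp L(log x)`. How `Δ` behaves under `exp L(u)` follows from
`DΔ(y)(uy) = DΔ(e)(u) Δ(y)` (`fderiv_det_mul`): the left side is homogeneous of degree `r` and
vanishes on the boundary of the cone, hence is a multiple of `Δ` (`eq_mul_det_of_vanish`).
Irreducibility enters through `eq_smul_one_of_central`: it makes `u ↦ Tr L(u)` and `u ↦ DΔ(e)(u)`
proportional, in the ratio `n : r`. Finiteness comes from the substitution `y = x²`, which replaces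
`s` by `2s + 1`.

The second is a Paley–Wiener theorem. Shifting the domain of integration inside the tube shows that
the Fourier transforms of all slices come from a single `g`, as `e^{-2π⟨y,ξ⟩} g(ξ)`
(`IsLocallyHardy.exists_spectrum`). Finiteness of either norm then confines `g` to the cone, because
the gamma integral diverges for `x` outside the closed cone (`lintegral_gammaDensity_eq_top`). -/

namespace EuclideanJordanAlgebra

variable {n : ℕ} (J : EuclideanJordanAlgebra n)

open Polynomial

/-! ### Powers and polynomial values -/

theorem mul_one (x : RSpace n) : J.mul x J.one = x := by rw [J.mul_comm, J.one_mul]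

theorem pow_eq (x : RSpace n) (k : ℕ) : J.pow x k = (J.mul x ^ k) J.one := by
  induction k with
  | zero => simp [pow]
  | succ k ih => rw [pow, ih, pow_succ', Module.End.mul_apply]

theorem polyEval_eq (q : ℝ[X]) (x : RSpace n) :
    J.polyEval q x = aeval (J.mul x) q J.one := by
  rw [polyEval, aeval_eq_sum_range, Polynomial.sum_over_range _ (by simp), LinearMap.sum_apply]
  simp [pow_eq]

theorem isSymmetric_mul (x : RSpace n) : (J.mul x).IsSymmetric := fun y z => J.inner_mul x y z

/-- The part of the Jordan identity odd in `y`, obtained from `x + y` and `x - y`; its cubic term is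
the Jordan identity of `y` and is subtracted. -/
theorem jordan_polarized (x y w : RSpace n) :
    J.mul y (J.mul (J.mul x x) w) + (2 : ℝ) • J.mul x (J.mul (J.mul x y) w) =
      (2 : ℝ) • J.mul (J.mul x y) (J.mul x w) + J.mul (J.mul x x) (J.mul y w) := by
  have h1 := J.jordan (x + y) w
  have h2 := J.jordan (x - y) w
  have h3 := J.jordan y w
  simp only [map_add, map_sub, LinearMap.add_apply, LinearMap.sub_apply, J.mul_comm y x]
    at h1 h2 h3
  linear_combination (norm := module) (1 / 2 : ℝ) • h1 - (1 / 2 : ℝ) • h2 - h3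

/-- The polarized identity read as an identity between operators acting on `y`. With `z = xᵏ` it is
a two-step recursion for `L(xᵏ)`. -/
theorem mul_sq_mul (x z : RSpace n) :
    J.mul (J.mul (J.mul x x) z) = J.mul (J.mul x x) * J.mul z +
      (2 : ℝ) • (J.mul (J.mul x z) * J.mul x) - (2 : ℝ) • (J.mul x * J.mul z * J.mul x) := by
  ext1 y
  have h := J.jordan_polarized x y z
  simp only [LinearMap.sub_apply, LinearMap.add_apply, LinearMap.smul_apply,
    Module.End.mul_apply]
  rw [J.mul_comm _ y, J.mul_comm z (J.mul x y), J.mul_comm (J.mul x z), J.mul_comm z y]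
  linear_combination (norm := module) h

theorem commute_mul_sq (x : RSpace n) : Commute (J.mul x) (J.mul (J.mul x x)) := by
  ext1 y
  exact J.jordan x y

/-- The induction carries two consecutive powers, since the recursion for `L(x^{k+2})` involves both
`L(x^k)` and `L(x^{k+1})`. -/
theorem commute_mul_pow (x : RSpace n) (k : ℕ) : Commute (J.mul x) (J.mul (J.pow x k)) := by
  have h1 : J.mul J.one = 1 := by ext1 y; exact J.one_mul y
  suffices h : Commute (J.mul x) (J.mul (J.pow x k)) ∧
      Commute (J.mul x) (J.mul (J.pow x (k + 1))) from h.1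
  induction k with
  | zero => simp [pow, h1, J.mul_one]
  | succ k ih =>
    refine ⟨ih.2, ?_⟩
    have h2 : J.pow x (k + 1 + 1) = J.mul (J.mul x x) (J.pow x k) := by
      have h := LinearMap.congr_fun ih.1.eq x
      simp only [Module.End.mul_apply] at h
      rw [J.mul_comm (J.mul x x), ← h, J.mul_comm _ x]
      rfl
    rw [h2, mul_sq_mul]
    have h3 := J.commute_mul_sq x
    exact ((h3.mul_right ih.1).add_right ((ih.2.mul_right (Commute.refl _)).smul_right _)).sub_right
      ((((Commute.refl _).mul_right ih.1).mul_right (Commute.refl _)).smul_right _)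

theorem commute_mul_polyEval (x : RSpace n) (p : ℝ[X]) :
    Commute (J.mul x) (J.mul (J.polyEval p x)) := by
  rw [polyEval, Polynomial.sum, map_sum]
  refine Commute.sum_right _ _ _ fun k _ => ?_
  rw [map_smul]
  exact (J.commute_mul_pow x k).smul_right _

theorem polyEval_mul (x : RSpace n) (p q : ℝ[X]) :
    J.polyEval (q * p) x = aeval (J.mul x) q (J.polyEval p x) := by
  simp [polyEval_eq]

theorem polyEval_sub (x : RSpace n) (p q : ℝ[X]) :
    J.polyEval (p - q) x = J.polyEval p x - J.polyEval q x := by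
  simp [polyEval_eq]

/-- Power associativity: `L(p(x))` commutes with `L(x)`, hence with `q(L(x))`; evaluate the
commutation at `e`. -/
theorem mul_polyEval_polyEval (x : RSpace n) (p q : ℝ[X]) :
    J.mul (J.polyEval p x) (J.polyEval q x) = J.polyEval (q * p) x := by
  have h : Commute (aeval (J.mul x) q) (J.mul (J.polyEval p x)) := by
    rw [aeval_eq_sum_range]
    exact Commute.sum_left _ _ _ fun k _ =>
      ((J.commute_mul_polyEval x p).pow_left k).smul_left _
  have h' := LinearMap.congr_fun h.eq J.one
  simp only [Module.End.mul_apply, J.mul_one] at h'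
  rw [polyEval_mul, h', ← polyEval_eq]

/-! ### The degree of an element -/

theorem linearIndependent_pow_iff (x : RSpace n) (k : ℕ) :
    (LinearIndependent ℝ fun i : Fin (k + 1) => J.pow x i) ↔
      ∀ q : ℝ[X], q.natDegree ≤ k → J.polyEval q x = 0 → q = 0 := by
  have key : ∀ q : ℝ[X], q.natDegree ≤ k →
      J.polyEval q x = ∑ i : Fin (k + 1), q.coeff i • J.pow x i := by
    intro q hq
    rw [polyEval, Polynomial.sum_over_range' _ (by simp) (k + 1) (by omega),
      Finset.sum_range]
  rw [Fintype.linearIndependent_iff]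
  constructor
  · intro h q hq hq0
    rw [key q hq] at hq0
    ext i
    by_cases hi : i < k + 1
    · simpa using h _ hq0 ⟨i, hi⟩
    · simpa using coeff_eq_zero_of_natDegree_lt (by omega)
  · intro h g hg i
    classical
    set q : ℝ[X] := ∑ i : Fin (k + 1), monomial (i : ℕ) (g i) with hq
    have hc : ∀ i : Fin (k + 1), q.coeff i = g i := by
      intro i
      simp [hq, Polynomial.finsetSum_coeff, coeff_monomial, Fin.val_inj]
    have hd : q.natDegree ≤ k :=
      natDegree_sum_le_of_forall_le _ _ fun i _ =>
        (natDegree_monomial_le _).trans (by omega)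
    rw [← hc i, h q hd (by rw [key q hd]; simpa [hc] using hg), coeff_zero]

theorem degree_le {x : RSpace n} {q : ℝ[X]} (hq : q ≠ 0) (h0 : J.polyEval q x = 0) :
    J.degree x ≤ q.natDegree :=
  Nat.sInf_le fun h => hq ((J.linearIndependent_pow_iff x _).1 h q le_rfl h0)

/-- An annihilating `q` must be supplied because the infimum of the empty set of naturals is `0`. -/
theorem le_degree {x : RSpace n} {d : ℕ} {q : ℝ[X]} (hq : q ≠ 0) (hq0 : J.polyEval q x = 0)
    (h : ∀ q : ℝ[X], q ≠ 0 → J.polyEval q x = 0 → d ≤ q.natDegree) : d ≤ J.degree x := by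
  refine le_csInf ⟨q.natDegree, fun h => hq ((J.linearIndependent_pow_iff x _).1 h q le_rfl hq0)⟩
    fun k hk => ?_
  simp only [Set.mem_ofPred_eq, linearIndependent_pow_iff, not_forall] at hk
  obtain ⟨q, hqk, hq0, hq⟩ := hk
  exact (h q hq hq0).trans hqk

/-! ### Spectral decomposition -/

/-- `x = ∑ λ c_λ` with nonzero orthogonal idempotents `c_λ` of sum `e`. -/
structure IsSpectral (x : RSpace n) (σ : Finset ℝ) (c : ℝ → RSpace n) : Prop where
  ne_zero : ∀ a ∈ σ, c a ≠ 0
  idem : ∀ a ∈ σ, J.mul (c a) (c a) = c a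
  orth : ∀ a ∈ σ, ∀ b ∈ σ, a ≠ b → J.mul (c a) (c b) = 0
  mul_eq : ∀ a ∈ σ, J.mul x (c a) = a • c a
  sum_eq : ∑ a ∈ σ, c a = J.one

/-- `L(x)` is symmetric, so the product `P` of `X - a` over its distinct eigenvalues kills it. The
idempotents are the Lagrange basis polynomials of the eigenvalues, evaluated at `x`; each required
identity holds because it holds modulo `P`, that is, at every eigenvalue. -/
theorem exists_isSpectral (x : RSpace n) : ∃ σ c, J.IsSpectral x σ c := by
  classical
  set T := J.mul x
  have hT : T.IsSymmetric := J.isSymmetric_mul x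
  have hn : Module.finrank ℝ (RSpace n) = n := by simp
  set s : Finset ℝ := Finset.univ.image (hT.eigenvalues hn)
  set P : ℝ[X] := ∏ a ∈ s, (X - C a)
  have hP : aeval T P = 0 := by
    refine (hT.eigenvectorBasis hn).toBasis.ext fun i => ?_
    have hi : hT.eigenvalues hn i ∈ s := Finset.mem_image_of_mem _ (Finset.mem_univ i)
    simp only [P]
    rw [← Finset.prod_erase_mul _ _ hi, map_mul, Module.End.mul_apply]
    simp [hT.apply_eigenvectorBasis, Module.algebraMap_end_apply]
  have hinj : Set.InjOn (id : ℝ → ℝ) s := Function.injective_id.injOn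
  set c : ℝ → RSpace n := fun a => J.polyEval (Lagrange.basis s id a) x with hc
  have hzero : ∀ q : ℝ[X], P ∣ q → J.polyEval q x = 0 := by
    rintro q ⟨w, rfl⟩
    rw [_root_.mul_comm, polyEval_mul, polyEval_eq, hP]
    simp
  have hmod : ∀ q : ℝ[X], (∀ a ∈ s, q.eval a = 0) → P ∣ q := by
    intro q hq
    refine Finset.prod_dvd_of_coprime (fun a _ b _ hab => ?_) fun a ha =>
      dvd_iff_isRoot.2 (hq a ha)
    exact pairwise_coprime_X_sub_C Function.injective_id hab
  have hself : ∀ a ∈ s, (Lagrange.basis s id a).eval a = 1 := fun a ha => by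
    simpa using Lagrange.eval_basis_self hinj ha
  have hne : ∀ a ∈ s, ∀ b ∈ s, a ≠ b → (Lagrange.basis s id a).eval b = 0 := fun a _ b hb hab => by
    simpa using Lagrange.eval_basis_of_ne (v := (id : ℝ → ℝ)) hab hb
  -- An eigenvalue of `L(x)` need not be a spectral value of `x`; its idempotent is then zero and is
  -- dropped.
  refine ⟨s.filter (fun a => c a ≠ 0), c, fun a ha => (Finset.mem_filter.1 ha).2, ?_, ?_, ?_, ?_⟩
  · intro a ha
    have ha := (Finset.mem_filter.1 ha).1
    rw [← sub_eq_zero, hc]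
    simp only []
    rw [mul_polyEval_polyEval, ← polyEval_sub]
    refine hzero _ (hmod _ fun b hb => ?_)
    by_cases h : a = b
    · subst h; simp [hself a ha]
    · simp [hne a ha b hb h]
  · intro a ha b hb hab
    have ha := (Finset.mem_filter.1 ha).1
    have hb := (Finset.mem_filter.1 hb).1
    rw [hc]
    simp only []
    rw [mul_polyEval_polyEval]
    refine hzero _ (hmod _ fun d hd => ?_)
    by_cases h : a = d
    · subst h; simp [hne b hb a ha hab.symm]
    · simp [hne a ha d hd h]
  · intro a ha
    have ha := (Finset.mem_filter.1 ha).1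
    have : J.mul x (c a) - a • c a = J.polyEval ((X - C a) * Lagrange.basis s id a) x := by
      rw [polyEval_mul]
      simp [hc, Module.algebraMap_end_apply]
    rw [← sub_eq_zero, this]
    refine hzero _ (hmod _ fun d hd => ?_)
    by_cases h : a = d
    · subst h; simp
    · simp [hne a ha d hd h]
  · rw [Finset.sum_filter_ne_zero]
    rcases s.eq_empty_or_nonempty with hs | hs
    · have : IsEmpty (Fin n) := by
        by_contra h
        rw [not_isEmpty_iff] at h
        exact (Finset.univ_nonempty.image (hT.eigenvalues hn)).ne_empty hs
      exact Subsingleton.elim _ _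
    have h := Lagrange.sum_basis hinj hs
    have h2 : aeval T (∑ a ∈ s, Lagrange.basis s id a) J.one = J.one := by rw [h]; simp
    simpa [hc, polyEval_eq] using h2

namespace IsSpectral

variable {J} {x : RSpace n} {σ : Finset ℝ} {c : ℝ → RSpace n}

theorem aeval_apply (h : J.IsSpectral x σ c) (q : ℝ[X]) {a : ℝ} (ha : a ∈ σ) :
    aeval (J.mul x) q (c a) = q.eval a • c a := by
  have hp : ∀ k : ℕ, (J.mul x ^ k) (c a) = a ^ k • c a := by
    intro k
    induction k with
    | zero => simp
    | succ k ih => rw [pow_succ', Module.End.mul_apply, ih, map_smul, h.mul_eq a ha, smul_smul,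
        pow_succ]
  rw [aeval_eq_sum_range, eval_eq_sum_range, LinearMap.sum_apply, Finset.sum_smul]
  exact Finset.sum_congr rfl fun k _ => by rw [LinearMap.smul_apply, hp, smul_smul]

theorem polyEval_eq (h : J.IsSpectral x σ c)
    (q : ℝ[X]) : J.polyEval q x = ∑ a ∈ σ, q.eval a • c a := by
  rw [J.polyEval_eq, ← h.sum_eq, map_sum]
  exact Finset.sum_congr rfl fun a ha => h.aeval_apply q ha

theorem eq_sum (h : J.IsSpectral x σ c) : x = ∑ a ∈ σ, a • c a := by
  conv_lhs => rw [← J.mul_one x, ← h.sum_eq, map_sum]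
  exact Finset.sum_congr rfl fun a ha => h.mul_eq a ha

theorem mul_sum (h : J.IsSpectral x σ c) (f : ℝ → ℝ) {a : ℝ} (ha : a ∈ σ) :
    J.mul (∑ b ∈ σ, f b • c b) (c a) = f a • c a := by
  rw [map_sum, LinearMap.sum_apply, Finset.sum_eq_single a]
  · simp [h.idem a ha]
  · intro b hb hba
    simp [h.orth b hb a ha hba]
  · exact fun h => (h ha).elim

theorem inner_eq_zero (h : J.IsSpectral x σ c) {a b : ℝ} (ha : a ∈ σ) (hb : b ∈ σ) (hab : a ≠ b) :
    inner ℝ (c a) (c b) = 0 := by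
  conv_lhs => rw [← J.mul_one (c a), J.inner_mul, h.orth a ha b hb hab, inner_zero_right]

theorem inner_sum (h : J.IsSpectral x σ c) (f : ℝ → ℝ) {a : ℝ} (ha : a ∈ σ) :
    inner ℝ (c a) (∑ b ∈ σ, f b • c b) = f a * ‖c a‖ ^ 2 := by
  rw [_root_.inner_sum, Finset.sum_eq_single a]
  · rw [inner_smul_right, real_inner_self_eq_norm_sq]
  · intro b hb hba
    rw [inner_smul_right, h.inner_eq_zero ha hb hba.symm, mul_zero]
  · exact fun h => (h ha).elim

theorem sum_eq_zero_iff (h : J.IsSpectral x σ c)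
    (f : ℝ → ℝ) : ∑ b ∈ σ, f b • c b = 0 ↔ ∀ a ∈ σ, f a = 0 := by
  constructor
  · intro h0 a ha
    have := h.inner_sum f ha
    rw [h0, inner_zero_right] at this
    have hc := h.ne_zero a ha
    have : f a = 0 ∨ ‖c a‖ ^ 2 = 0 := mul_eq_zero.1 this.symm
    simpa [hc] using this
  · exact fun h0 => Finset.sum_eq_zero fun a ha => by rw [h0 a ha, zero_smul]

theorem polyEval_eq_zero_iff (h : J.IsSpectral x σ c)
    (q : ℝ[X]) : J.polyEval q x = 0 ↔ ∀ a ∈ σ, q.eval a = 0 := by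
  rw [h.polyEval_eq, h.sum_eq_zero_iff]

theorem prod_polyEval (h : J.IsSpectral x σ c) : J.polyEval (∏ a ∈ σ, (X - C a)) x = 0 := by
  rw [h.polyEval_eq_zero_iff]
  intro a ha
  rw [eval_prod]
  exact Finset.prod_eq_zero ha (by simp)

/-- A polynomial annihilates `x` exactly when it vanishes on `σ`, so the minimal one is `∏ (X - a)`.
-/
theorem degree_eq (h : J.IsSpectral x σ c) : J.degree x = σ.card := by
  have hm : (∏ a ∈ σ, (X - C a) : ℝ[X]).Monic := monic_prod_of_monic _ _ fun a _ => monic_X_sub_C a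
  have hd : (∏ a ∈ σ, (X - C a) : ℝ[X]).natDegree = σ.card := by
    rw [natDegree_prod_of_monic _ _ fun a _ => monic_X_sub_C a]; simp
  refine le_antisymm (hd ▸ J.degree_le hm.ne_zero h.prod_polyEval)
    (J.le_degree hm.ne_zero h.prod_polyEval fun q hq hq0 => ?_)
  rw [h.polyEval_eq_zero_iff] at hq0
  calc σ.card ≤ q.roots.toFinset.card := Finset.card_le_card fun a ha => by
        simpa [hq] using hq0 a ha
    _ ≤ q.roots.card := Multiset.toFinset_card_le _
    _ ≤ q.natDegree := card_roots' q

/-- Injectivity keeps the new eigenvalues distinct, so the idempotents stay the same and are only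
relabelled. -/
theorem transform (h : J.IsSpectral x σ c) {f : ℝ → ℝ} (hf : Set.InjOn f σ) :
    ∃ d : ℝ → RSpace n, (∀ a ∈ σ, d (f a) = c a) ∧
      J.IsSpectral (∑ a ∈ σ, f a • c a) (σ.image f) d := by
  classical
  set g := Function.invFunOn f (σ : Set ℝ)
  have hg : ∀ a ∈ σ, g (f a) = a := fun a ha => hf.leftInvOn_invFunOn ha
  refine ⟨fun b => c (g b), fun a ha => by simp [hg a ha], ?_, ?_, ?_, ?_, ?_⟩
  · simp only [Finset.forall_mem_image]
    intro a ha
    rw [hg a ha]; exact h.ne_zero a ha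
  · simp only [Finset.forall_mem_image]
    intro a ha
    rw [hg a ha]; exact h.idem a ha
  · simp only [Finset.forall_mem_image]
    intro a ha b hb hab
    rw [hg a ha, hg b hb]
    exact h.orth a ha b hb fun hab' => hab (by rw [hab'])
  · simp only [Finset.forall_mem_image]
    intro a ha
    rw [hg a ha]; exact h.mul_sum f ha
  · rw [Finset.sum_image hf, ← h.sum_eq]
    exact Finset.sum_congr rfl fun a ha => by rw [hg a ha]

end IsSpectral

/-! ### Idempotents -/

/-- The relation `2T³ - 3T² + T = 0` behind the Peirce eigenvalues `0, 1/2, 1`, from `mul_sq_mul` at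
`x = z = c`. -/
theorem idempotent_cubic {c : RSpace n} (hc : J.mul c c = c) (v : RSpace n) :
    (2 : ℝ) • J.mul c (J.mul c (J.mul c v)) + J.mul c v = (3 : ℝ) • J.mul c (J.mul c v) := by
  have h := LinearMap.congr_fun (J.mul_sq_mul c c) v
  simp only [hc, LinearMap.sub_apply, LinearMap.add_apply, LinearMap.smul_apply,
    Module.End.mul_apply] at h
  linear_combination (norm := module) h

/-- Pairing the cubic relation with `v` and with `Tv` gives `⟨Tv, v⟩ = ‖Tv‖² + 4‖Tv - T²v‖²`,
without diagonalizing `T`. -/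
theorem idempotent_nonneg {c : RSpace n} (hc : J.mul c c = c) (v : RSpace n) :
    0 ≤ inner ℝ (J.mul c v) v := by
  set T := J.mul c
  have hT : ∀ x y, inner ℝ (T x) y = inner ℝ x (T y) := J.isSymmetric_mul c
  have h1 := congrArg (fun w => inner ℝ w v) (J.idempotent_cubic hc v)
  have h2 := congrArg (fun w => inner ℝ w (T v)) (J.idempotent_cubic hc v)
  simp only [inner_add_left, inner_smul_left] at h1 h2
  change 2 * inner ℝ (T (T (T v))) v + inner ℝ (T v) v = 3 * inner ℝ (T (T v)) v at h1
  change 2 * inner ℝ (T (T (T v))) (T v) + inner ℝ (T v) (T v) = 3 * inner ℝ (T (T v)) (T v) at h2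
  rw [hT (T (T v)) v, hT (T v) v] at h1
  rw [hT (T (T v)) (T v)] at h2
  have h4 := real_inner_self_nonneg (x := T v)
  have h5 := real_inner_self_nonneg (x := T v - T (T v))
  rw [inner_sub_left, inner_sub_right, inner_sub_right, real_inner_comm (T (T v)) (T v)] at h5
  linarith

end EuclideanJordanAlgebra

/-! ### Minimal annihilators of a vector over an integrally closed domain -/

section GenericAnnihilator

open Polynomial Matrix

theorem Matrix.mapMatrix_aeval {R S ι : Type*} [CommRing R] [CommRing S] [Fintype ι]
    [DecidableEq ι] (f : R →+* S) (M : Matrix ι ι R) (q : R[X]) :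
    (aeval M q).map f = aeval (M.map f) (q.map f) := by
  have h := Polynomial.map_aeval_eq_aeval_map (φ := f) (ψ := f.mapMatrix (m := ι)) (by
      ext r i j
      by_cases hij : i = j
      · subst hij; simp [Matrix.algebraMap_matrix_apply]
      · simp [Matrix.algebraMap_matrix_apply, hij]) q M
  simpa using h

/-- A vector over an integrally closed domain has, for a given matrix, a monic annihilating
polynomial that divides the characteristic polynomial and has the degree of the minimal polynomial
over the field of fractions. -/
theorem Matrix.exists_monic_annihilator {R ι : Type*} [CommRing R] [IsDomain R]
    [IsIntegrallyClosed R] [Fintype ι] [DecidableEq ι] (M : Matrix ι ι R) (v : ι → R) :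
    ∃ Q : R[X], Q.Monic ∧ Q ∣ M.charpoly ∧ aeval M Q *ᵥ v = 0 ∧
      ∃ (D : R) (N : Matrix (Fin Q.natDegree) ι R), D ≠ 0 ∧
        ∀ k j : Fin Q.natDegree, (N *ᵥ ((M ^ (k : ℕ)) *ᵥ v)) j = if k = j then D else 0 := by
  set K := FractionRing R
  set f : R →+* K := algebraMap R K
  have hf : Function.Injective f := IsFractionRing.injective R K
  set MK := M.map f
  set vK : ι → K := f ∘ v
  -- The annihilator of the vector over the field of fractions. Its generator divides the monic
  -- characteristic polynomial, so after normalization it has coefficients in `R`, as `R` is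
  -- integrally closed.
  let I : Ideal K[X] :=
    { carrier := {q | aeval MK q *ᵥ vK = 0}
      add_mem' := fun {a b} ha hb => by
        simp only [Set.mem_ofPred_eq] at ha hb ⊢
        rw [map_add, add_mulVec, ha, hb, add_zero]
      zero_mem' := by simp
      smul_mem' := fun c q hq => by
        simp only [Set.mem_ofPred_eq] at hq ⊢
        rw [smul_eq_mul, map_mul, ← mulVec_mulVec, hq, mulVec_zero] }
  have hI : ∀ q, q ∈ I ↔ aeval MK q *ᵥ vK = 0 := fun q => Iff.rfl
  set g := Submodule.IsPrincipal.generator I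
  have hg : ∀ q, aeval MK q *ᵥ vK = 0 ↔ g ∣ q := fun q => by
    rw [← hI, Submodule.IsPrincipal.mem_iff_generator_dvd]
  have hgc : g ∣ M.charpoly.map f := by
    rw [← hg, ← Matrix.charpoly_map, Matrix.aeval_self_charpoly, zero_mulVec]
  have hg0 : g ≠ 0 := ne_zero_of_dvd_ne_zero ((M.charpoly_monic.map f).ne_zero) hgc
  obtain ⟨Q, hQ⟩ := IsIntegrallyClosed.eq_map_mul_C_of_dvd K M.charpoly_monic hgc
  have hlc : g.leadingCoeff ≠ 0 := leadingCoeff_ne_zero.2 hg0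
  have hQ' : Q.map f = g * C g.leadingCoeff⁻¹ := by
    have h1 : C g.leadingCoeff * C g.leadingCoeff⁻¹ = (1 : K[X]) := by
      rw [← C_mul, mul_inv_cancel₀ hlc, C_1]
    linear_combination C g.leadingCoeff⁻¹ * hQ - Q.map f * h1
  have hQm : Q.Monic := monic_of_injective hf (by
    rw [hQ']; exact monic_mul_leadingCoeff_inv hg0)
  have hgQ : ∀ q, g ∣ q ↔ Q.map f ∣ q := fun q => by
    rw [← hQ]
    exact (isUnit_C.2 hlc.isUnit).mul_right_dvd
  have hann : aeval M Q *ᵥ v = 0 := by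
    have h := (hg (Q.map f)).2 ((hgQ _).2 dvd_rfl)
    rw [← Matrix.mapMatrix_aeval] at h
    funext i
    apply hf
    rw [RingHom.map_mulVec, h]
    simp
  refine ⟨Q, hQm, M.charpoly_monic.dvd_of_fraction_map_dvd_fraction_map (K := K) hQm
    ((hgQ _).1 hgc), hann, ?_⟩
  -- The vectors `Mᵏv`, `k < d`, are the columns of `B` and are independent over `K`. Clearing
  -- denominators in a left inverse of `B` gives `N` and `D`; at any specialization where `D` does
  -- not vanish the vectors remain independent.
  set d := Q.natDegree
  set B : Matrix ι (Fin d) K := Matrix.of fun i k => (MK ^ (k : ℕ) *ᵥ vK) i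
  have hB : B.toLin'.ker = ⊥ := by
    rw [LinearMap.ker_eq_bot']
    intro w hw
    set q : K[X] := ∑ k : Fin d, monomial (k : ℕ) (w k) with hq
    have hc : ∀ k : Fin d, q.coeff k = w k := fun k => by
      simp [hq, Polynomial.finsetSum_coeff, coeff_monomial, Fin.val_inj]
    have hq0 : aeval MK q *ᵥ vK = 0 := by
      rw [← hw, toLin'_apply, hq, map_sum, Matrix.sum_mulVec]
      funext i
      simp [B, mulVec, dotProduct, aeval_monomial, Algebra.algebraMap_eq_smul_one, mul_comm,
        Matrix.smul_apply, Finset.mul_sum, mul_left_comm]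
    have hqd : q.degree < (Q.map f).degree := by
      rw [hQm.degree_map, degree_eq_natDegree hQm.ne_zero]
      refine (degree_sum_le _ _).trans_lt ?_
      refine (Finset.sup_lt_iff (WithBot.bot_lt_coe d)).2 ?_
      exact fun k _ => (degree_monomial_le _ _).trans_lt (WithBot.coe_lt_coe.2 k.2)
    have : q = 0 := by
      by_contra h
      exact absurd (degree_le_of_dvd ((hgQ q).1 ((hg q).1 hq0)) h) (not_le.2 hqd)
    funext k
    rw [← hc k, this]
    simp
  obtain ⟨A, hA⟩ := LinearMap.exists_leftInverse_of_injective _ hB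
  set A' := LinearMap.toMatrix' A
  have hA' : A' * B = 1 := by
    have := congrArg LinearMap.toMatrix' hA
    rwa [LinearMap.toMatrix'_comp, LinearMap.toMatrix'_toLin', LinearMap.toMatrix'_id] at this
  obtain ⟨b, hb⟩ := IsLocalization.exist_integer_multiples_of_finite (nonZeroDivisors R)
    (fun p : Fin d × ι => A' p.1 p.2)
  choose N hN using hb
  refine ⟨b, Matrix.of fun k i => N (k, i), nonZeroDivisors.ne_zero b.2, fun k j => ?_⟩
  apply hf
  rw [RingHom.map_mulVec]
  have h1 : (Matrix.of fun k i => N (k, i)).map f = f b • A' := by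
    ext k i
    have := hN (k, i)
    simpa [Algebra.smul_def] using this
  have h2 : f ∘ (M ^ (k : ℕ) *ᵥ v) = fun i => B i k := by
    funext i
    simp only [Function.comp, RingHom.map_mulVec, B, MK, vK, Matrix.of_apply]
    rw [← RingHom.mapMatrix_apply, map_pow, RingHom.mapMatrix_apply]
  rw [h1, h2, smul_mulVec]
  have h3 := congrFun (congrFun hA' j) k
  simp only [Matrix.mul_apply] at h3
  simp only [Pi.smul_apply, mulVec, dotProduct, smul_eq_mul]
  rw [h3, Matrix.one_apply]
  by_cases h : k = j
  · simp [h]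
  · simp [h, Ne.symm h]

end GenericAnnihilator

/-- A nonempty open set contains a product of infinite sets, and only the zero polynomial vanishes
on such a product. -/
theorem MvPolynomial.dense_eval_ne_zero {n : ℕ} {D : MvPolynomial (Fin n) ℝ} (hD : D ≠ 0) :
    Dense {x : RSpace n | MvPolynomial.eval (fun j => x j) D ≠ 0} := by
  rw [dense_iff_inter_open]
  intro U hU ⟨x, hx⟩
  by_contra hcon
  rw [Set.not_nonempty_iff_eq_empty] at hcon
  apply hD
  have hU' : IsOpen ((WithLp.toLp 2 : (Fin n → ℝ) → RSpace n) ⁻¹' U) :=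
    hU.preimage (PiLp.continuous_toLp 2 _)
  rw [isOpen_pi_iff'] at hU'
  obtain ⟨u, hu, hsub⟩ := hU' (fun j => x j) hx
  refine MvPolynomial.funext_set u (fun i => infinite_of_mem_nhds (x i) ((hu i).1.mem_nhds
    (hu i).2)) fun y hy => ?_
  have h1 : WithLp.toLp 2 y ∈ U := hsub hy
  by_contra h2
  have : WithLp.toLp 2 y ∈ (∅ : Set (RSpace n)) := by
    rw [← hcon]
    exact ⟨h1, by simpa using h2⟩
  exact this

theorem MvPolynomial.contDiff_eval {n : ℕ} (p : MvPolynomial (Fin n) ℝ) {k : WithTop ℕ∞} :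
    ContDiff ℝ k fun x : RSpace n => MvPolynomial.eval (fun j => x j) p := by
  induction p using MvPolynomial.induction_on with
  | C a => simpa using contDiff_const
  | add p q hp hq => simpa using hp.add hq
  | mul_X p i hp =>
    simp only [map_mul, MvPolynomial.eval_X]
    exact hp.mul (contDiff_piLp_apply (p := 2))

namespace EuclideanJordanAlgebra

variable {n : ℕ} (J : EuclideanJordanAlgebra n)

open Polynomial Matrix

/-! ### The generic minimal polynomial -/

/-- The matrix of multiplication by the generic element. -/
noncomputable def genericMatrix : Matrix (Fin n) (Fin n) (MvPolynomial (Fin n) ℝ) :=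
  Matrix.of fun i j => ∑ k, MvPolynomial.C (J.mul (EuclideanSpace.single k 1)
    (EuclideanSpace.single j 1) i) * MvPolynomial.X k

/-- Evaluation of polynomials in the coordinates at a point. -/
noncomputable abbrev evalAt (x : RSpace n) : MvPolynomial (Fin n) ℝ →+* ℝ :=
  MvPolynomial.eval fun j => x j

theorem genericMatrix_map (x : RSpace n) : J.genericMatrix.map (evalAt x) =
    LinearMap.toMatrixAlgEquiv (EuclideanSpace.basisFun (Fin n) ℝ).toBasis (J.mul x) := by
  ext i j
  have hx : x = ∑ k, x k • EuclideanSpace.single k (1 : ℝ) := by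
    have := (EuclideanSpace.basisFun (Fin n) ℝ).sum_repr x
    simpa using this.symm
  rw [LinearMap.toMatrixAlgEquiv_apply]
  conv_rhs => rw [hx]
  simp [genericMatrix, map_sum, _root_.mul_comm]

theorem aeval_map_mulVec (x : RSpace n) (q : ℝ[X]) (v : RSpace n) :
    aeval (J.genericMatrix.map (evalAt x)) q *ᵥ (fun j => v j) =
      fun j => aeval (J.mul x) q v j := by
  rw [genericMatrix_map, Polynomial.aeval_algHom_apply]
  exact LinearMap.toMatrix_mulVec_repr (EuclideanSpace.basisFun (Fin n) ℝ).toBasis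
    (EuclideanSpace.basisFun (Fin n) ℝ).toBasis _ v

/-- The annihilator of `e` under multiplication by the generic element, specialized at each `x`. It
bounds the degree of `x` above everywhere, and `D` certifies equality off a hypersurface. -/
theorem exists_generic : ∃ Q : (MvPolynomial (Fin n) ℝ)[X], Q.Monic ∧
    Q ∣ J.genericMatrix.charpoly ∧ (∀ x, J.polyEval (Q.map (evalAt x)) x = 0) ∧
    ∃ D : MvPolynomial (Fin n) ℝ, D ≠ 0 ∧
      ∀ x, evalAt x D ≠ 0 → J.degree x = Q.natDegree := by
  obtain ⟨Q, hQ, hQc, hQa, D, N, hD, hN⟩ := Matrix.exists_monic_annihilator J.genericMatrix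
    (fun j => MvPolynomial.C (J.one j))
  have h0 : ∀ x, J.polyEval (Q.map (evalAt x)) x = 0 := by
    intro x
    have h1 := J.aeval_map_mulVec x (Q.map (evalAt x)) J.one
    rw [← Matrix.mapMatrix_aeval] at h1
    rw [polyEval_eq]
    ext j
    rw [← congrFun h1 j]
    have h2 := congrArg (evalAt x) (congrFun hQa j)
    rw [RingHom.map_mulVec] at h2
    simpa [Function.comp_def] using h2
  refine ⟨Q, hQ, hQc, h0, D, hD, fun x hx => le_antisymm ?_ ?_⟩
  · rw [← hQ.natDegree_map (evalAt x)]
    exact J.degree_le (hQ.map _).ne_zero (h0 x)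
  · refine J.le_degree (hQ.map (evalAt x)).ne_zero (h0 x) fun q hq hq0 => ?_
    by_contra hlt
    rw [not_le] at hlt
    apply hq
    have h1 := J.aeval_map_mulVec x q J.one
    rw [← polyEval_eq, hq0, aeval_eq_sum_range' hlt, Matrix.sum_mulVec, Finset.sum_range] at h1
    ext j
    by_cases hj : j < Q.natDegree
    -- Applying `N` isolates `D(x)` times the `j`-th coefficient of `q`, so that coefficient is
    -- zero.
    · have h2 := congrArg (fun w => (N.map (evalAt x) *ᵥ w) ⟨j, hj⟩) h1
      simp only [Matrix.mulVec_sum, smul_mulVec, Matrix.mulVec_smul, Finset.sum_apply,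
        Pi.smul_apply] at h2
      have h3 : ∀ k : Fin Q.natDegree, (N.map (evalAt x) *ᵥ
          ((J.genericMatrix.map (evalAt x)) ^ (k : ℕ) *ᵥ fun j => J.one j)) ⟨j, hj⟩ =
          if k = ⟨j, hj⟩ then evalAt x D else 0 := by
        intro k
        have h4 := congrArg (evalAt x) (hN k ⟨j, hj⟩)
        rw [RingHom.map_mulVec] at h4
        have h5 : (evalAt x) ∘ (J.genericMatrix ^ (k : ℕ) *ᵥ fun j => MvPolynomial.C (J.one j)) =
            (J.genericMatrix.map (evalAt x)) ^ (k : ℕ) *ᵥ fun j => J.one j := by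
          funext i
          simp only [Function.comp, RingHom.map_mulVec]
          rw [← RingHom.mapMatrix_apply, map_pow, RingHom.mapMatrix_apply]
          simp [Function.comp_def]
        rw [h5] at h4
        rw [h4]
        split_ifs <;> simp
      simp only [h3] at h2
      have h6 : (0 : Fin n → ℝ) = fun j => (0 : RSpace n) j := rfl
      simp [mulVec, dotProduct] at h2
      simpa [hx] using h2
    · rw [coeff_eq_zero_of_natDegree_lt (by omega), coeff_zero]

theorem exists_generic_rank : ∃ Q : (MvPolynomial (Fin n) ℝ)[X], Q.Monic ∧
    Q.natDegree = J.rank ∧ Q ∣ J.genericMatrix.charpoly ∧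
    (∀ x, J.polyEval (Q.map (evalAt x)) x = 0) ∧
    ∃ D : MvPolynomial (Fin n) ℝ, D ≠ 0 ∧ ∀ x, evalAt x D ≠ 0 → J.degree x = J.rank := by
  obtain ⟨Q, hQ, hQc, hQa, D, hD, hdeg⟩ := J.exists_generic
  have hle : ∀ x, J.degree x ≤ Q.natDegree := fun x => by
    rw [← hQ.natDegree_map (evalAt x)]
    exact J.degree_le (hQ.map _).ne_zero (hQa x)
  obtain ⟨x, hx⟩ := (MvPolynomial.dense_eval_ne_zero hD).nonempty
  have hr : Q.natDegree = J.rank :=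
    le_antisymm (hdeg x hx ▸ le_ciSup (f := J.degree) ⟨Q.natDegree, by rintro _ ⟨y, rfl⟩; exact hle y⟩ x)
      (ciSup_le hle)
  exact ⟨Q, hQ, hr, hQc, hQa, D, hD, hr ▸ hdeg⟩

theorem eq_of_polyEval_eq_zero {x : RSpace n} {q q' : ℝ[X]} (hq : q.Monic) (hq' : q'.Monic)
    (hd : q.natDegree = J.degree x) (hd' : q'.natDegree = J.degree x)
    (h0 : J.polyEval q x = 0) (h0' : J.polyEval q' x = 0) : q = q' := by
  by_contra hne
  have h1 : q - q' ≠ 0 := sub_ne_zero.2 hne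
  have h2 := J.degree_le h1 (by rw [polyEval_sub, h0, h0', sub_zero])
  have h3 : (q - q').degree < q.degree := degree_sub_lt_left
    (by rw [degree_eq_natDegree hq.ne_zero, degree_eq_natDegree hq'.ne_zero, hd, hd']) hq.ne_zero
    (by rw [hq.leadingCoeff, hq'.leadingCoeff])
  have h4 := natDegree_lt_natDegree h1 h3
  omega

/-- `(-1)^r Q(0)` has the defining property of the determinant, so the chosen polynomial has it too;
the two agree wherever `D` is nonzero, and `D` cancels in the polynomial ring. -/
theorem exists_generic_det : ∃ Q : (MvPolynomial (Fin n) ℝ)[X], Q.Monic ∧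
    Q.natDegree = J.rank ∧ Q ∣ J.genericMatrix.charpoly ∧
    (∀ x, J.polyEval (Q.map (evalAt x)) x = 0) ∧
    Dense {x | J.degree x = J.rank} ∧ J.detPoly = (-1) ^ J.rank * Q.coeff 0 := by
  obtain ⟨Q, hQ, hr, hQc, hQa, D, hD, hdeg⟩ := J.exists_generic_rank
  refine ⟨Q, hQ, hr, hQc, hQa, (MvPolynomial.dense_eval_ne_zero hD).mono hdeg, ?_⟩
  have hmain : ∀ x, J.degree x = J.rank → ∀ q : ℝ[X], q.Monic → q.natDegree = J.rank →
      J.polyEval q x = 0 → q = Q.map (evalAt x) := fun x hx q hq hqr hq0 =>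
    J.eq_of_polyEval_eq_zero hq (hQ.map _) (hqr.trans hx.symm)
      ((hQ.natDegree_map _).trans (hr.trans hx.symm)) hq0 (hQa x)
  have hdet : J.IsDetPoly J.detPoly := Classical.epsilon_spec
    ⟨(-1) ^ J.rank * Q.coeff 0, fun x hx q hq hqr hq0 => by
      rw [hmain x hx q hq hqr hq0]; simp⟩
  have key : J.detPoly * D = ((-1) ^ J.rank * Q.coeff 0) * D := by
    refine MvPolynomial.funext fun x => ?_
    by_cases hx : MvPolynomial.eval x D = 0
    · simp [hx]
    · have hx' := hdeg (WithLp.toLp 2 x) hx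
      have := hdet _ hx' _ (hQ.map (evalAt (WithLp.toLp 2 x)))
        ((hQ.natDegree_map _).trans hr) (hQa _)
      simp only [coeff_map] at this
      rw [map_mul, map_mul, this]
      simp
  exact mul_right_cancel₀ hD key

/-! ### The determinant -/

theorem dense_regular : Dense {x | J.degree x = J.rank} := by
  obtain ⟨Q, -, -, -, -, h, -⟩ := J.exists_generic_det
  exact h

theorem contDiff_det {k : WithTop ℕ∞} : ContDiff ℝ k J.det := MvPolynomial.contDiff_eval _

theorem continuous_det : Continuous J.det := (J.contDiff_det (k := 0)).continuous

theorem det_eq_prod {x : RSpace n} {σ : Finset ℝ} {c : ℝ → RSpace n} (h : J.IsSpectral x σ c)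
    (hx : J.degree x = J.rank) : J.det x = ∏ a ∈ σ, a := by
  obtain ⟨Q, hQ, hr, -, hQa, -, hdet⟩ := J.exists_generic_det
  have hm : (∏ a ∈ σ, (X - C a) : ℝ[X]).Monic := monic_prod_of_monic _ _ fun a _ => monic_X_sub_C a
  have hd : (∏ a ∈ σ, (X - C a) : ℝ[X]).natDegree = σ.card := by
    rw [natDegree_prod_of_monic _ _ fun a _ => monic_X_sub_C a]; simp
  have := J.eq_of_polyEval_eq_zero (hQ.map (evalAt x)) hm
    ((hQ.natDegree_map _).trans (hr.trans hx.symm)) (hd.trans h.degree_eq.symm) (hQa x)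
    h.prod_polyEval
  have h1 : evalAt x (Q.coeff 0) = ∏ a ∈ σ, -a := by
    rw [← coeff_map, this, coeff_zero_eq_eval_zero, eval_prod]
    simp
  rw [det, hdet, map_mul, h1, Finset.prod_neg, ← h.degree_eq, hx, map_pow, ← mul_assoc]
  simp [← mul_pow]

/-- Regularity of `x` is not needed: the specialized generic polynomial annihilates every `x`, so it
vanishes at every spectral value. -/
theorem det_eq_zero {x : RSpace n} {σ : Finset ℝ} {c : ℝ → RSpace n} (h : J.IsSpectral x σ c)
    (h0 : (0 : ℝ) ∈ σ) : J.det x = 0 := by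
  obtain ⟨Q, hQ, hr, -, hQa, -, hdet⟩ := J.exists_generic_det
  have h1 := (h.polyEval_eq_zero_iff _).1 (hQa x) 0 h0
  rw [← coeff_zero_eq_eval_zero, coeff_map] at h1
  rw [det, hdet, map_mul, h1, mul_zero]

/-- Compare constant terms: the generic minimal polynomial divides the characteristic polynomial of
generic multiplication. -/
theorem exists_det_mul_eq : ∃ p : MvPolynomial (Fin n) ℝ, ∀ x,
    LinearMap.det (J.mul x) = J.det x * evalAt x p := by
  obtain ⟨Q, hQ, hr, ⟨Q', hQ'⟩, hQa, -, hdet⟩ := J.exists_generic_det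
  refine ⟨(-1) ^ n * (-1) ^ J.rank * Q'.coeff 0, fun x => ?_⟩
  have h1 : LinearMap.det (J.mul x) = evalAt x J.genericMatrix.det := by
    rw [RingHom.map_det, RingHom.mapMatrix_apply, genericMatrix_map]
    exact (LinearMap.det_toMatrix _ _).symm
  rw [h1, Matrix.det_eq_sign_charpoly_coeff, hQ', mul_coeff_zero, det, hdet]
  simp only [map_mul, map_pow, map_neg, map_one, Fintype.card_fin]
  have : ((-1 : ℝ) ^ J.rank) * (-1) ^ J.rank = 1 := by rw [← mul_pow]; simp
  linear_combination (-(-1 : ℝ) ^ n * evalAt x (Q.coeff 0) * evalAt x (Q'.coeff 0)) * this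

end EuclideanJordanAlgebra

/-! ### Substitution and divisibility by a variable in polynomial rings -/

theorem MvPolynomial.eval_aeval {ι κ : Type*} (x : κ → ℝ) (s : ι → MvPolynomial κ ℝ)
    (q : MvPolynomial ι ℝ) : MvPolynomial.eval x (MvPolynomial.aeval s q) =
      MvPolynomial.eval (fun i => MvPolynomial.eval x (s i)) q := by
  induction q using MvPolynomial.induction_on with
  | C r => simp [MvPolynomial.algebraMap_eq]
  | add p q hp hq => rw [map_add, map_add, hp, hq, map_add]
  | mul_X p i hp => rw [map_mul, map_mul, hp, map_mul, MvPolynomial.aeval_X, MvPolynomial.eval_X]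

/-- Modulo `X a` a polynomial equals its restriction to `X a = 0`, and this restriction is zero
because it vanishes for all positive values of the other variables. -/
theorem MvPolynomial.X_dvd_of_eval_eq_zero {ι : Type*} [DecidableEq ι] [Fintype ι]
    {q : MvPolynomial ι ℝ} {a : ι}
    (h : ∀ x : ι → ℝ, x a = 0 → (∀ b, b ≠ a → 0 < x b) → MvPolynomial.eval x q = 0) :
    MvPolynomial.X a ∣ q := by
  set s : ι → MvPolynomial ι ℝ := Function.update MvPolynomial.X a 0
  have h1 : ∀ p : MvPolynomial ι ℝ, MvPolynomial.X a ∣ p - MvPolynomial.aeval s p := by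
    intro p
    induction p using MvPolynomial.induction_on with
    | C r => simp [MvPolynomial.algebraMap_eq]
    | add p q hp hq => rw [map_add, add_sub_add_comm]; exact dvd_add hp hq
    | mul_X p i hp =>
      rw [map_mul, MvPolynomial.aeval_X]
      by_cases hi : i = a
      · subst hi; simp [s]
      · simp only [s, Function.update_of_ne hi]
        rw [← sub_mul]
        exact hp.mul_right _
  have h2 : MvPolynomial.aeval s q = 0 := by
    refine MvPolynomial.funext_set (fun _ => Set.Ioi (0 : ℝ)) (fun _ => Set.Ioi_infinite 0)
      fun x hx => ?_
    have h3 : MvPolynomial.eval x (MvPolynomial.aeval s q) =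
        MvPolynomial.eval (Function.update x a 0) q := by
      rw [MvPolynomial.eval_aeval]
      congr 1
      congr 1
      funext i
      by_cases hi : i = a
      · subst hi; simp [s]
      · simp [s, Function.update_of_ne hi]
    rw [h3, map_zero]
    refine h _ (by simp) fun b hb => ?_
    rw [Function.update_of_ne hb]
    exact hx b (Set.mem_univ b)
  have h4 := h1 q
  rwa [h2, sub_zero] at h4

/-! ### The cone as the set of elements with positive definite multiplication -/

namespace EuclideanJordanAlgebra

variable {n : ℕ} (J : EuclideanJordanAlgebra n)

/-- The product as a continuous bilinear map. -/
noncomputable def mulL : RSpace n →L[ℝ] RSpace n →L[ℝ] RSpace n :=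
  LinearMap.toContinuousLinearMap
    ((LinearMap.toContinuousLinearMap (𝕜 := ℝ) (E := RSpace n) (F' := RSpace n)).toLinearMap ∘ₗ J.mul)

@[simp] theorem mulL_apply (x y : RSpace n) : J.mulL x y = J.mul x y := rfl

theorem continuous_mul : Continuous fun p : RSpace n × RSpace n => J.mul p.1 p.2 :=
  (J.mulL.continuous.comp continuous_fst).clm_apply continuous_snd

/-- The set of `x` with positive semidefinite `L(x)`. -/
def psd : Set (RSpace n) := {x | ∀ v, 0 ≤ inner ℝ (J.mul x v) v}

/-- The set of `x` with positive definite `L(x)`. -/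
def pd : Set (RSpace n) := {x | ∀ v, v ≠ 0 → 0 < inner ℝ (J.mul x v) v}

theorem pd_subset_psd : J.pd ⊆ J.psd := fun x hx v => by
  by_cases hv : v = 0
  · simp [hv]
  · exact (hx v hv).le

theorem one_mem_pd : J.one ∈ J.pd := fun v hv => by
  rw [J.one_mul]; exact real_inner_self_pos.2 hv

theorem add_mem_pd {x y : RSpace n} (hx : x ∈ J.pd) (hy : y ∈ J.psd) : x + y ∈ J.pd := fun v hv => by
  rw [map_add, LinearMap.add_apply, inner_add_left]
  exact add_pos_of_pos_of_nonneg (hx v hv) (hy v)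

theorem add_mem_psd {x y : RSpace n} (hx : x ∈ J.psd) (hy : y ∈ J.psd) : x + y ∈ J.psd := fun v => by
  rw [map_add, LinearMap.add_apply, inner_add_left]
  exact add_nonneg (hx v) (hy v)

theorem smul_mem_pd {x : RSpace n} (hx : x ∈ J.pd) {t : ℝ} (ht : 0 < t) : t • x ∈ J.pd :=
  fun v hv => by
    rw [map_smul, LinearMap.smul_apply, inner_smul_left]
    exact mul_pos ht (hx v hv)

theorem smul_mem_psd {x : RSpace n} (hx : x ∈ J.psd) {t : ℝ} (ht : 0 ≤ t) : t • x ∈ J.psd :=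
  fun v => by
    rw [map_smul, LinearMap.smul_apply, inner_smul_left]
    exact mul_nonneg ht (hx v)

theorem sum_mem_psd {ι : Type*} {s : Finset ι} {f : ι → RSpace n} (h : ∀ i ∈ s, f i ∈ J.psd) :
    ∑ i ∈ s, f i ∈ J.psd := fun v => by
  rw [map_sum, LinearMap.sum_apply, sum_inner]
  exact Finset.sum_nonneg fun i hi => h i hi v

theorem idempotent_mem_psd {c : RSpace n} (hc : J.mul c c = c) : c ∈ J.psd :=
  J.idempotent_nonneg hc

theorem isClosed_psd : IsClosed J.psd := by
  simp only [psd, Set.ofPred_forall]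
  refine isClosed_iInter fun v => isClosed_le continuous_const ?_
  exact Continuous.inner (J.continuous_mul.comp (continuous_id.prodMk continuous_const)) continuous_const

theorem exists_coercive {x : RSpace n} (hx : x ∈ J.pd) :
    ∃ ε > 0, ∀ v, ε * ‖v‖ ^ 2 ≤ inner ℝ (J.mul x v) v := by
  rcases (Metric.sphere (0 : RSpace n) 1).eq_empty_or_nonempty with h | h
  · refine ⟨1, one_pos, fun v => ?_⟩
    have hv : v = 0 := by
      by_contra hv
      have : ‖v‖⁻¹ • v ∈ Metric.sphere (0 : RSpace n) 1 := by
        simp [norm_smul, hv]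
      rw [h] at this
      exact this
    simp [hv]
  · have hc : Continuous fun v : RSpace n => inner ℝ (J.mul x v) v :=
      Continuous.inner (J.mulL x).continuous continuous_id
    obtain ⟨w, hw, hmin⟩ := (isCompact_sphere (0 : RSpace n) 1).exists_isMinOn h hc.continuousOn
    have hw0 : w ≠ 0 := by
      rintro rfl
      simp at hw
    refine ⟨_, hx w hw0, fun v => ?_⟩
    by_cases hv : v = 0
    · simp [hv]
    · have hv' : ‖v‖ ≠ 0 := norm_ne_zero_iff.2 hv
      have h1 : ‖v‖⁻¹ • v ∈ Metric.sphere (0 : RSpace n) 1 := by simp [norm_smul, hv]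
      have h2 := hmin h1
      simp only [Set.mem_ofPred_eq, map_smul, inner_smul_left, inner_smul_right, conj_trivial] at h2
      have h3 : 0 < ‖v‖ ^ 2 := by positivity
      calc _ ≤ ‖v‖⁻¹ * (‖v‖⁻¹ * inner ℝ (J.mul x v) v) * ‖v‖ ^ 2 := by gcongr
        _ = _ := by field_simp

theorem exists_sub_mem_pd {x : RSpace n} (hx : x ∈ J.pd) : ∃ ε : ℝ, 0 < ε ∧ x - ε • J.one ∈ J.pd := by
  obtain ⟨ε, hε, h⟩ := J.exists_coercive hx
  refine ⟨ε / 2, half_pos hε, fun v hv => ?_⟩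
  have h1 := h v
  have h2 : 0 < ‖v‖ ^ 2 := by positivity
  rw [map_sub, map_smul, LinearMap.sub_apply, LinearMap.smul_apply, J.one_mul, inner_sub_left,
    inner_smul_left, real_inner_self_eq_norm_sq]
  simp only [conj_trivial]
  nlinarith

theorem isOpen_pd : IsOpen J.pd := by
  rw [Metric.isOpen_iff]
  intro x hx
  obtain ⟨ε, hε, h⟩ := J.exists_coercive hx
  set C := ‖J.mulL‖ + 1
  have hC : 0 < C := by positivity
  refine ⟨ε / C, div_pos hε hC, fun y hy v hv => ?_⟩
  rw [mem_ball_iff_norm] at hy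
  have h1 : |inner ℝ (J.mul (y - x) v) v| ≤ ‖J.mulL‖ * ‖y - x‖ * ‖v‖ * ‖v‖ :=
    (abs_real_inner_le_norm _ _).trans
      (mul_le_mul_of_nonneg_right (J.mulL.le_opNorm₂ _ _) (norm_nonneg _))
  have h2 : 0 < ‖v‖ ^ 2 := by positivity
  have h3 : ‖J.mulL‖ * ‖y - x‖ < ε := by
    have := (lt_div_iff₀ hC).1 hy
    nlinarith [norm_nonneg (y - x)]
  have h4 : y = x + (y - x) := by abel
  rw [h4, map_add, LinearMap.add_apply, inner_add_left]
  have h5 := h v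
  have h6 := (abs_le.1 h1).1
  nlinarith

theorem inner_mul_self_comm (x v : RSpace n) : inner ℝ (J.mul x v) v = inner ℝ x (J.mul v v) := by
  rw [J.mul_comm, J.inner_mul]

theorem add_smul_one_mem_pd {x : RSpace n} (hx : x ∈ J.psd) {t : ℝ} (ht : 0 < t) :
    x + t • J.one ∈ J.pd := by
  rw [add_comm]
  exact J.add_mem_pd (J.smul_mem_pd J.one_mem_pd ht) hx

namespace IsSpectral

variable {J} {x : RSpace n} {σ : Finset ℝ} {c : ℝ → RSpace n}

theorem sum_mem_psd (h : J.IsSpectral x σ c)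
    {f : ℝ → ℝ} (hf : ∀ a ∈ σ, 0 ≤ f a) : ∑ a ∈ σ, f a • c a ∈ J.psd :=
  J.sum_mem_psd fun a ha => J.smul_mem_psd (J.idempotent_mem_psd (h.idem a ha)) (hf a ha)

theorem inner_mul_sum (h : J.IsSpectral x σ c) (f : ℝ → ℝ) {a : ℝ} (ha : a ∈ σ) :
    inner ℝ (J.mul (∑ b ∈ σ, f b • c b) (c a)) (c a) = f a * ‖c a‖ ^ 2 := by
  rw [h.mul_sum f ha, inner_smul_left, real_inner_self_eq_norm_sq]; rfl

theorem inner_mul_self (h : J.IsSpectral x σ c) {a : ℝ} (ha : a ∈ σ) :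
    inner ℝ (J.mul x (c a)) (c a) = a * ‖c a‖ ^ 2 := by
  rw [h.mul_eq a ha, inner_smul_left, real_inner_self_eq_norm_sq]; rfl

theorem nonneg (h : J.IsSpectral x σ c) (hx : x ∈ J.psd) {a : ℝ} (ha : a ∈ σ) : 0 ≤ a := by
  have h1 := hx (c a)
  rw [h.inner_mul_self ha] at h1
  have h2 := norm_pos_iff.2 (h.ne_zero a ha)
  exact nonneg_of_mul_nonneg_left h1 (by positivity)

theorem pos (h : J.IsSpectral x σ c) (hx : x ∈ J.pd) {a : ℝ} (ha : a ∈ σ) : 0 < a := by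
  have h1 := hx (c a) (h.ne_zero a ha)
  rw [h.inner_mul_self ha] at h1
  have h2 := norm_pos_iff.2 (h.ne_zero a ha)
  exact pos_of_mul_pos_left h1 (by positivity)

theorem sum_mem_pd (h : J.IsSpectral x σ c)
    {f : ℝ → ℝ} (hf : ∀ a ∈ σ, 0 < f a) : ∑ a ∈ σ, f a • c a ∈ J.pd := by
  rcases σ.eq_empty_or_nonempty with hσ | hσ
  · subst hσ
    have h1 := h.sum_eq
    simp only [Finset.sum_empty] at h1 ⊢
    rw [h1]; exact J.one_mem_pd
  · obtain ⟨a, ha, hmin⟩ := σ.exists_min_image f hσ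
    -- Split off the smallest coefficient times `e`; what is left is a nonnegative combination of
    -- idempotents.
    have : ∑ b ∈ σ, f b • c b = f a • J.one + ∑ b ∈ σ, (f b - f a) • c b := by
      rw [← h.sum_eq, Finset.smul_sum, ← Finset.sum_add_distrib]
      exact Finset.sum_congr rfl fun b _ => by rw [← add_smul]; congr 1; ring
    rw [this]
    exact J.add_mem_pd (J.smul_mem_pd J.one_mem_pd (hf a ha))
      (h.sum_mem_psd fun b hb => sub_nonneg.2 (hmin b hb))

theorem mul_sum_sum (h : J.IsSpectral x σ c)
    (f g : ℝ → ℝ) : J.mul (∑ a ∈ σ, f a • c a) (∑ a ∈ σ, g a • c a) =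
    ∑ a ∈ σ, (f a * g a) • c a := by
  conv_lhs => rw [map_sum]
  refine Finset.sum_congr rfl fun a ha => ?_
  rw [map_smul, h.mul_sum f ha, smul_smul, _root_.mul_comm (g a)]

theorem zero_mem (h : J.IsSpectral x σ c) (hx : x ∈ J.psd) (hx' : x ∉ J.pd) : (0 : ℝ) ∈ σ := by
  by_contra h0
  apply hx'
  rw [h.eq_sum]
  exact h.sum_mem_pd fun a ha => lt_of_le_of_ne (h.nonneg hx ha) fun h1 => h0 (h1 ▸ ha)

end IsSpectral

/-- The spectral decomposition gives both inclusions: a square has nonnegative coefficients on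
idempotents, and an element of `psd` has nonnegative spectral values, of which square roots can be
taken. -/
theorem range_sq : (Set.range fun x => J.mul x x) = J.psd := by
  ext x
  constructor
  · rintro ⟨y, rfl⟩
    obtain ⟨σ, c, h⟩ := J.exists_isSpectral y
    simp only []
    rw [h.eq_sum, h.mul_sum_sum]
    exact h.sum_mem_psd fun a _ => mul_self_nonneg a
  · intro hx
    obtain ⟨σ, c, h⟩ := J.exists_isSpectral x
    refine ⟨∑ a ∈ σ, Real.sqrt a • c a, ?_⟩
    simp only []
    rw [h.mul_sum_sum]
    conv_rhs => rw [h.eq_sum]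
    exact Finset.sum_congr rfl fun a ha => by rw [Real.mul_self_sqrt (h.nonneg hx ha)]

/-- An interior point of `psd` stays in `psd` after subtraction of a small multiple of `e`; adding
it back makes the multiplication positive definite. -/
theorem cone_eq : J.cone = J.pd := by
  rw [cone, range_sq]
  refine subset_antisymm (fun x hx => ?_) (interior_maximal J.pd_subset_psd J.isOpen_pd)
  rw [mem_interior_iff_mem_nhds] at hx
  have hc : ContinuousAt (fun t : ℝ => x - t • J.one) 0 := by fun_prop
  have h1 : ∀ᶠ t in nhds (0 : ℝ), x - t • J.one ∈ J.psd := hc.eventually_mem (by simpa using hx)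
  obtain ⟨ε, hε, h2⟩ := Metric.eventually_nhds_iff.1 h1
  have h3 : x - (ε / 2) • J.one ∈ J.psd := h2 (by simp [abs_of_pos hε, hε])
  have := J.add_smul_one_mem_pd h3 (half_pos hε)
  simpa using this

theorem sq_mem_psd (x : RSpace n) : J.mul x x ∈ J.psd := by
  rw [← range_sq]; exact ⟨x, rfl⟩

theorem closure_pd : closure J.pd = J.psd := by
  refine subset_antisymm (closure_minimal J.pd_subset_psd J.isClosed_psd) fun x hx => ?_
  have hc : Filter.Tendsto (fun t : ℝ => x + t • J.one) (nhdsWithin 0 (Set.Ioi 0)) (nhds x) := by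
    have : ContinuousAt (fun t : ℝ => x + t • J.one) 0 := by fun_prop
    simpa using this.tendsto.mono_left nhdsWithin_le_nhds
  exact mem_closure_of_tendsto hc (by
    filter_upwards [self_mem_nhdsWithin] with t ht using J.add_smul_one_mem_pd hx ht)

theorem convex_pd : Convex ℝ J.pd := by
  intro x hx y hy a b ha hb hab
  rcases ha.eq_or_lt with rfl | ha
  · obtain rfl : b = 1 := by linarith
    simpa using hy
  · exact J.add_mem_pd (J.smul_mem_pd hx ha) (J.smul_mem_psd (J.pd_subset_psd hy) hb)

/-! ### The determinant on the cone -/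

theorem det_eq_zero_of_notMem {y : RSpace n} (h1 : y ∈ J.psd) (h2 : y ∉ J.pd) : J.det y = 0 := by
  obtain ⟨σ, c, h⟩ := J.exists_isSpectral y
  exact J.det_eq_zero h (h.zero_mem h1 h2)

theorem dense_regular_inter : J.pd ⊆ closure (J.pd ∩ {x | J.degree x = J.rank}) :=
  J.dense_regular.open_subset_closure_inter J.isOpen_pd

theorem det_nonneg_of_mem_pd {y : RSpace n} (hy : y ∈ J.pd) : 0 ≤ J.det y := by
  have hcl : IsClosed {y | 0 ≤ J.det y} := isClosed_le continuous_const J.continuous_det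
  refine closure_minimal (fun x hx => ?_) hcl (J.dense_regular_inter hy)
  obtain ⟨σ, c, h⟩ := J.exists_isSpectral x
  change 0 ≤ J.det x
  rw [J.det_eq_prod h hx.2]
  exact Finset.prod_nonneg fun a ha => (h.pos hx.1 ha).le

theorem det_mul_ne_zero {y : RSpace n} (hy : y ∈ J.pd) : LinearMap.det (J.mul y) ≠ 0 := by
  have : LinearMap.ker (J.mul y) = ⊥ := by
    rw [LinearMap.ker_eq_bot']
    intro v hv
    by_contra hv0
    have := hy v hv0
    rw [hv, inner_zero_left] at this
    exact this.false
  intro h0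
  exact (LinearMap.bot_lt_ker_of_det_eq_zero h0).ne' this

/-- The product formula holds only at regular points, and density leaves the weak inequality.
Strictness holds because `Δ(y)` divides the nonzero determinant of `L(y)`. -/
theorem det_pos {y : RSpace n} (hy : y ∈ J.pd) : 0 < J.det y := by
  obtain ⟨p, hp⟩ := J.exists_det_mul_eq
  refine lt_of_le_of_ne (J.det_nonneg_of_mem_pd hy) fun h => J.det_mul_ne_zero hy ?_
  rw [hp, ← h, zero_mul]

theorem det_nonneg {y : RSpace n} (hy : y ∈ J.psd) : 0 ≤ J.det y := by
  by_cases h : y ∈ J.pd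
  · exact J.det_nonneg_of_mem_pd h
  · exact (J.det_eq_zero_of_notMem hy h).ge

theorem IsSpectral.det_transform {J : EuclideanJordanAlgebra n} {x : RSpace n} {σ : Finset ℝ}
    {c : ℝ → RSpace n} (h : J.IsSpectral x σ c) (hx : J.degree x = J.rank) {f : ℝ → ℝ}
    (hf : Set.InjOn f σ) : J.det (∑ a ∈ σ, f a • c a) = ∏ a ∈ σ, f a := by
  classical
  obtain ⟨d, -, hd⟩ := h.transform hf
  rw [J.det_eq_prod hd, Finset.prod_image hf]
  rw [hd.degree_eq, Finset.card_image_of_injOn hf, ← h.degree_eq, hx]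

theorem det_smul {t : ℝ} (ht : t ≠ 0) (x : RSpace n) : J.det (t • x) = t ^ J.rank * J.det x := by
  refine congrFun (Continuous.ext_on J.dense_regular (f := fun x => J.det (t • x))
    (g := fun x => t ^ J.rank * J.det x) ?_ ?_ fun y hy => ?_) x
  · exact J.continuous_det.comp (by fun_prop)
  · exact J.continuous_det.const_mul _
  · obtain ⟨σ, c, h⟩ := J.exists_isSpectral y
    have h1 := h.det_transform hy (f := fun a => t * a)
      fun a _ b _ hab => mul_left_cancel₀ ht hab
    simp only []
    rw [J.det_eq_prod h hy]
    conv_lhs => rw [h.eq_sum, Finset.smul_sum]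
    simp only [smul_smul]
    rw [h1, Finset.prod_mul_distrib, Finset.prod_const, ← h.degree_eq, hy]

/-- A homogeneous polynomial of degree `r` that vanishes on the boundary of the cone is a multiple
of the determinant. -/
theorem eq_mul_det_of_vanish (P : MvPolynomial (Fin n) ℝ)
    (hhom : ∀ (t : ℝ) (x : RSpace n), 0 < t → evalAt (t • x) P = t ^ J.rank * evalAt x P)
    (hvan : ∀ y ∈ J.psd, y ∉ J.pd → evalAt y P = 0) (x : RSpace n) :
    evalAt x P = evalAt J.one P * J.det x := by
  classical
  refine congrFun (Continuous.ext_on J.dense_regular (f := fun x => evalAt x P)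
    (g := fun x => evalAt J.one P * J.det x) (P.contDiff_eval (k := 0)).continuous
    (J.continuous_det.const_mul _) fun u hu => ?_) x
  obtain ⟨σ, c, h⟩ := J.exists_isSpectral u
  -- The restriction of `P` to the span of the spectral idempotents of a regular `u`, as a
  -- polynomial in their coefficients.
  set q : MvPolynomial σ ℝ := MvPolynomial.aeval
    (fun j => ∑ a : σ, MvPolynomial.C (c a j) * MvPolynomial.X a) P
  have hq : ∀ f : ℝ → ℝ, MvPolynomial.eval (fun a : σ => f a) q =
      evalAt (∑ a ∈ σ, f a • c a) P := by
    intro f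
    simp only [q]
    rw [MvPolynomial.eval_aeval]
    congr 1
    congr 1
    funext i
    rw [map_sum, ← Finset.sum_coe_sort σ]
    simp [_root_.mul_comm]
  -- Where one coefficient is zero and the others are positive, the point lies on the boundary of
  -- the cone; so `q` is divisible by each variable, and these are pairwise coprime.
  have hdvd : (∏ a : σ, MvPolynomial.X a) ∣ q := by
    refine Finset.prod_dvd_of_isRelPrime (fun a _ b _ hab => ?_) fun a _ => ?_
    · refine (MvPolynomial.X_prime.irreducible.isRelPrime_iff_not_dvd).2 fun hd => hab ?_
      exact MvPolynomial.X_dvd_X.1 hd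
    · refine MvPolynomial.X_dvd_of_eval_eq_zero fun x hx0 hx => ?_
      set f : ℝ → ℝ := fun b => if hb : b ∈ σ then x ⟨b, hb⟩ else 0
      have hf : (fun b : σ => f b) = x := by
        funext b
        simp [f]
      rw [← hf, hq]
      refine hvan _ (h.sum_mem_psd fun b hb => ?_) fun hpd => ?_
      · have hb' : f b = x ⟨b, hb⟩ := by simp [f, hb]
        rw [hb']
        by_cases hba : (⟨b, hb⟩ : σ) = a
        · rw [hba, hx0]
        · exact (hx _ hba).le
      · have h1 := hpd (c a) (h.ne_zero a a.2)
        rw [h.inner_mul_sum f a.2] at h1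
        have h2 : f a = x a := congrFun hf a
        rw [h2, hx0, zero_mul] at h1
        exact h1.false
  obtain ⟨w, hw⟩ := hdvd
  -- Since `u` is regular, there are `r` variables: homogeneity of degree `r` is used up by their
  -- product, and the cofactor `w` is constant along rays, with its value at `0`.
  have hval : ∀ f : ℝ → ℝ, (∀ a ∈ σ, f a ≠ 0) → evalAt (∑ a ∈ σ, f a • c a) P =
      (∏ a ∈ σ, f a) * MvPolynomial.eval 0 w := by
    intro f hf
    have h1 : ∀ t : ℝ, 0 < t → MvPolynomial.eval (fun a : σ => f a) w =
        MvPolynomial.eval (fun a : σ => t * f a) w := by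
      intro t ht
      have h2 := hhom t (∑ a ∈ σ, f a • c a) ht
      rw [Finset.smul_sum] at h2
      simp only [smul_smul] at h2
      rw [← hq, ← hq f, hw] at h2
      simp only [map_mul, map_prod, MvPolynomial.eval_X, Finset.prod_mul_distrib,
        Finset.prod_const, Finset.card_univ, Fintype.card_coe] at h2
      rw [← h.degree_eq, hu, mul_assoc] at h2
      have h3 := mul_left_cancel₀ (pow_ne_zero _ ht.ne') h2
      have h4 : ∏ a : σ, f a ≠ 0 := Finset.prod_ne_zero_iff.2 fun a _ => hf a a.2
      exact (mul_left_cancel₀ h4 h3).symm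
    have h2 : MvPolynomial.eval (fun a : σ => f a) w = MvPolynomial.eval 0 w := by
      have hc : Continuous fun t : ℝ => MvPolynomial.eval (fun a : σ => t * f a) w :=
        (MvPolynomial.continuous_eval w).comp (by fun_prop)
      have ht : Filter.Tendsto (fun t : ℝ => MvPolynomial.eval (fun a : σ => t * f a) w)
          (nhdsWithin 0 (Set.Ioi 0)) (nhds (MvPolynomial.eval 0 w)) := by
        have := (hc.tendsto 0).mono_left (nhdsWithin_le_nhds (s := Set.Ioi (0 : ℝ)))
        simpa [Pi.zero_def] using this
      refine tendsto_nhds_unique (tendsto_const_nhds.congr' ?_) ht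
      filter_upwards [self_mem_nhdsWithin] with t ht using h1 t ht
    rw [← hq, hw, map_mul, map_prod, h2, ← Finset.prod_coe_sort σ]
    simp
  have hone := hval (fun _ => 1) fun _ _ => one_ne_zero
  simp only [one_smul, h.sum_eq, Finset.prod_const_one] at hone
  simp only []
  rw [J.det_eq_prod h hu, hone]
  by_cases h0 : ∀ a ∈ σ, a ≠ 0
  · have := hval id h0
    simp only [id] at this
    rw [← h.eq_sum] at this
    rw [this, _root_.mul_comm, _root_.one_mul]
  · push Not at h0
    obtain ⟨a, ha, ha0⟩ := h0
    have h1 := hq id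
    simp only [id] at h1
    rw [← h.eq_sum] at h1
    rw [← h1, hw, map_mul, map_prod, Finset.prod_eq_zero ha ha0,
      Finset.prod_eq_zero (Finset.mem_univ (⟨a, ha⟩ : σ)) (by simpa using ha0), zero_mul, mul_zero]

end EuclideanJordanAlgebra

/-! ### Derivatives of polynomial functions and exponentials on eigenvectors -/

theorem MvPolynomial.hasFDerivAt_eval {n : ℕ} (p : MvPolynomial (Fin n) ℝ) (x : RSpace n) :
    HasFDerivAt (fun x : RSpace n => MvPolynomial.eval (fun j => x j) p)
      (∑ j, MvPolynomial.eval (fun j => x j) (MvPolynomial.pderiv j p) •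
        (EuclideanSpace.proj j : RSpace n →L[ℝ] ℝ)) x := by
  induction p using MvPolynomial.induction_on with
  | C a => simpa using hasFDerivAt_const a x
  | add p q hp hq =>
    simp only [map_add, add_smul, Finset.sum_add_distrib]
    exact hp.add hq
  | mul_X p i hp =>
    have h1 := hp.mul (EuclideanSpace.proj i : RSpace n →L[ℝ] ℝ).hasFDerivAt
    simp only [map_mul, MvPolynomial.eval_X, PiLp.proj_apply] at h1 ⊢
    refine h1.congr_fderiv ?_
    ext v
    simp [MvPolynomial.pderiv_X, Pi.single_apply, add_mul, Finset.sum_add_distrib, Finset.mul_sum,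
      mul_assoc, apply_ite, ite_mul]

theorem ContinuousLinearMap.exp_apply_of_eigenvector {E : Type*} [NormedAddCommGroup E]
    [NormedSpace ℝ E] [CompleteSpace E] {A : E →L[ℝ] E} {v : E} {a : ℝ} (h : A v = a • v) :
    NormedSpace.exp A v = Real.exp a • v := by
  have h1 := (NormedSpace.exp_series_hasSum_exp' (𝕂 := ℝ) A).mapL
    (ContinuousLinearMap.apply ℝ E v)
  have h2 := (NormedSpace.exp_series_hasSum_exp' (𝕂 := ℝ) a).smul_const v
  have hp : ∀ k : ℕ, (A ^ k) v = a ^ k • v := by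
    intro k
    induction k with
    | zero => simp
    | succ k ih =>
      rw [pow_succ', mul_apply_eq_comp, ih, map_smul, h, smul_smul, pow_succ]
  rw [Real.exp_eq_exp_ℝ]
  refine HasSum.unique h1 ?_
  simpa [hp, smul_smul] using h2

namespace EuclideanJordanAlgebra

variable {n : ℕ} (J : EuclideanJordanAlgebra n)

/-! ### The gradient of the determinant -/

theorem differentiable_det : Differentiable ℝ J.det :=
  (J.contDiff_det (k := 1)).differentiable one_ne_zero

theorem hasDerivAt_det_line (y v : RSpace n) (t : ℝ) :
    HasDerivAt (fun s : ℝ => J.det (y + s • v)) (fderiv ℝ J.det (y + t • v) v) t := by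
  have h1 : HasDerivAt (fun s : ℝ => y + s • v) v t := by
    simpa using ((hasDerivAt_id t).smul_const v).const_add y
  exact (J.differentiable_det _).hasFDerivAt.comp_hasDerivAt t h1

theorem hasDerivAt_det_line_zero (y v : RSpace n) :
    HasDerivAt (fun s : ℝ => J.det (y + s • v)) (fderiv ℝ J.det y v) 0 := by
  simpa using J.hasDerivAt_det_line y v 0

theorem fderiv_det_smul {t : ℝ} (ht : t ≠ 0) (y v : RSpace n) :
    fderiv ℝ J.det (t • y) (t • v) = t ^ J.rank * fderiv ℝ J.det y v := by
  refine (J.hasDerivAt_det_line_zero (t • y) (t • v)).unique ?_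
  have h := (J.hasDerivAt_det_line_zero y v).const_mul (t ^ J.rank)
  refine h.congr_of_eventuallyEq (Filter.Eventually.of_forall fun s => ?_)
  simp only []
  rw [smul_comm s t v, ← smul_add, J.det_smul ht]

theorem fderiv_det_self (y : RSpace n) : fderiv ℝ J.det y y = J.rank * J.det y := by
  refine (J.hasDerivAt_det_line_zero y y).unique ?_
  have h : HasDerivAt (fun s : ℝ => (1 + s) ^ J.rank * J.det y) (J.rank * J.det y) 0 := by
    have h1 := (((hasDerivAt_id (0 : ℝ)).const_add 1).pow J.rank).mul_const (J.det y)
    simpa using h1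
  refine h.congr_of_eventuallyEq ?_
  have : ∀ᶠ s : ℝ in nhds 0, s ∈ Set.Ioi (-1 : ℝ) := Ioi_mem_nhds (by norm_num)
  filter_upwards [this] with s hs
  have hs' : (-1 : ℝ) < s := hs
  rw [← J.det_smul (by linarith : 1 + s ≠ 0), add_smul, one_smul]

theorem inner_nonneg_of_psd {d : RSpace n} (h : ∀ w ∈ J.psd, 0 ≤ inner ℝ d w) : d ∈ J.psd :=
  fun v => by
    rw [J.inner_mul_self_comm]
    exact h _ (J.sq_mem_psd v)

theorem inner_psd_nonneg {a b : RSpace n} (ha : a ∈ J.psd) (hb : b ∈ J.psd) :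
    0 ≤ inner ℝ a b := by
  rw [← range_sq] at hb
  obtain ⟨v, rfl⟩ := hb
  simp only []
  rw [← J.inner_mul_self_comm]
  exact ha v

theorem mul_eq_zero_of_inner_self {a c : RSpace n} (ha : a ∈ J.psd)
    (h : inner ℝ (J.mul a c) c = 0) : J.mul a c = 0 := by
  set w := J.mul a c
  by_contra hw
  have hw' : 0 < inner ℝ w w := real_inner_self_pos.2 hw
  set K := inner ℝ (J.mul a w) w
  have hK : 0 ≤ K := ha w
  have key : ∀ s : ℝ, 0 ≤ 2 * s * inner ℝ w w + s ^ 2 * K := by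
    intro s
    have h1 := ha (c + s • w)
    have h2 : inner ℝ (J.mul a w) c = inner ℝ w w := J.inner_mul a w c
    rw [map_add, map_smul, inner_add_left, inner_add_right, inner_add_right, inner_smul_left,
      inner_smul_right, inner_smul_left, inner_smul_right, h, h2] at h1
    simp only [conj_trivial] at h1
    change 0 ≤ 0 + s * inner ℝ w w + (s * inner ℝ w w + s * (s * K)) at h1
    linarith
  -- A value of `s` making the quadratic negative; the denominator is `K + 1` because `K` may
  -- vanish.
  have h3 := key (-inner ℝ w w / (K + 1))
  have hK1 : 0 < K + 1 := by linarith
  have h4 : 2 * (-inner ℝ w w / (K + 1)) * inner ℝ w w + (-inner ℝ w w / (K + 1)) ^ 2 * K =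
      - (inner ℝ w w ^ 2 * (K + 2)) / (K + 1) ^ 2 := by
    field_simp
    ring
  rw [h4] at h3
  have : 0 < inner ℝ w w ^ 2 * (K + 2) / (K + 1) ^ 2 := by positivity
  rw [neg_div] at h3
  linarith

/-- With `b = ∑ λ c_λ` and `c_λ = c_λ²`, the inner product is `∑ λ ⟨a c_λ, c_λ⟩`; its terms are
nonnegative, so each of them vanishes. -/
theorem mul_eq_zero_of_inner {a b : RSpace n} (ha : a ∈ J.psd) (hb : b ∈ J.psd)
    (h : inner ℝ a b = 0) : J.mul a b = 0 := by
  obtain ⟨σ, c, hs⟩ := J.exists_isSpectral b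
  have h1 : ∀ x ∈ σ, 0 ≤ x * inner ℝ (J.mul a (c x)) (c x) := fun x hx =>
    mul_nonneg (hs.nonneg hb hx) (ha _)
  have h2 : ∑ x ∈ σ, x * inner ℝ (J.mul a (c x)) (c x) = 0 := by
    rw [← h]
    conv_rhs => rw [hs.eq_sum, inner_sum]
    refine Finset.sum_congr rfl fun x hx => ?_
    rw [inner_smul_right, J.inner_mul_self_comm, hs.idem x hx]
  have h3 := (Finset.sum_eq_zero_iff_of_nonneg h1).1 h2
  rw [hs.eq_sum, map_sum]
  refine Finset.sum_eq_zero fun x hx => ?_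
  rw [map_smul]
  rcases mul_eq_zero.1 (h3 x hx) with h4 | h4
  · rw [h4, zero_smul]
  · rw [J.mul_eq_zero_of_inner_self ha h4, smul_zero]

/-- At such a `y`, `Δ` is zero and does not decrease in the directions of the cone, so the gradient
`d` belongs to `psd` by self-duality. Euler's identity gives `⟨d, y⟩ = 0`, hence `dy = 0` and `⟨d,
uy⟩ = ⟨dy, u⟩ = 0`. -/
theorem fderiv_det_mul_boundary {y : RSpace n} (h1 : y ∈ J.psd) (h2 : y ∉ J.pd) (u : RSpace n) :
    fderiv ℝ J.det y (J.mul u y) = 0 := by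
  set d := gradient J.det y
  have hd : ∀ v, inner ℝ d v = fderiv ℝ J.det y v := fun v => inner_gradient_left
  have h0 := J.det_eq_zero_of_notMem h1 h2
  have hdp : d ∈ J.psd := by
    refine J.inner_nonneg_of_psd fun w hw => ?_
    rw [hd]
    have h3 := (J.hasDerivAt_det_line_zero y w).tendsto_slope_zero_right
    refine ge_of_tendsto h3 ?_
    filter_upwards [self_mem_nhdsWithin] with t ht
    have ht' : 0 < t := ht
    simp only [zero_add, zero_smul, add_zero, h0, sub_zero, smul_eq_mul]
    exact mul_nonneg (inv_nonneg.2 ht'.le)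
      (J.det_nonneg (J.add_mem_psd h1 (J.smul_mem_psd hw ht'.le)))
  have hdy : inner ℝ d y = 0 := by rw [hd, fderiv_det_self, h0, mul_zero]
  rw [← hd, J.mul_comm, ← J.inner_mul, J.mul_comm, J.mul_eq_zero_of_inner hdp h1 hdy, inner_zero_left]

/-- Apply `eq_mul_det_of_vanish` to `Δ` itself: `Δ(e) = Δ(e)²`, and `Δ(e) > 0`. -/
theorem det_one : J.det J.one = 1 := by
  have h := J.eq_mul_det_of_vanish J.detPoly (fun t x ht => J.det_smul ht.ne' x)
    (fun y h1 h2 => J.det_eq_zero_of_notMem h1 h2) J.one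
  have h1 := J.det_pos J.one_mem_pd
  change J.det J.one = J.det J.one * J.det J.one at h
  exact (mul_right_cancel₀ h1.ne' (by rw [_root_.one_mul]; exact h)).symm

/-- The trace functional, the derivative of the determinant at the unit. -/
theorem fderiv_det_mul (u y : RSpace n) :
    fderiv ℝ J.det y (J.mul u y) = fderiv ℝ J.det J.one u * J.det y := by
  -- The polynomial `y ↦ DΔ(y)(uy)`. It is homogeneous of degree `r` and vanishes on the boundary of
  -- the cone, so it equals its value at `e` times `Δ`.
  set P : MvPolynomial (Fin n) ℝ := ∑ j, MvPolynomial.pderiv j J.detPoly *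
    ∑ k, MvPolynomial.C (J.mul u (EuclideanSpace.single k 1) j) * MvPolynomial.X k
  have hP : ∀ y, evalAt y P = fderiv ℝ J.det y (J.mul u y) := by
    intro y
    have hf : fderiv ℝ J.det y = _ := (J.detPoly.hasFDerivAt_eval y).fderiv
    rw [hf, map_sum, _root_.sum_apply]
    refine Finset.sum_congr rfl fun j _ => ?_
    rw [map_mul, _root_.smul_apply, smul_eq_mul, PiLp.proj_apply]
    congr 1
    have hx : y = ∑ k, y k • EuclideanSpace.single k (1 : ℝ) := by
      have := (EuclideanSpace.basisFun (Fin n) ℝ).sum_repr y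
      simpa using this.symm
    conv_rhs => rw [hx]
    simp [map_sum, _root_.mul_comm]
  have h := J.eq_mul_det_of_vanish P (fun t x ht => ?_) (fun y h1 h2 => ?_) y
  · rwa [hP, hP, J.mul_one] at h
  · rw [hP, hP, map_smul, J.fderiv_det_smul ht.ne']
  · rw [hP, J.fderiv_det_mul_boundary h1 h2]

/-! ### The one-parameter groups generated by multiplications -/

/-- By `fderiv_det_mul`, `Δ` satisfies a linear differential equation with constant coefficient
along `t ↦ exp(tL(u)) y`. -/
theorem det_exp (u y : RSpace n) :
    J.det (NormedSpace.exp (J.mulL u) y) = Real.exp (fderiv ℝ J.det J.one u) * J.det y := by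
  set c := fderiv ℝ J.det J.one u
  set φ : ℝ → RSpace n := fun t => NormedSpace.exp (t • J.mulL u) y
  have hφ : ∀ t, HasDerivAt φ (J.mul u (φ t)) t := fun t => by
    have := (hasDerivAt_exp_smul_const' (𝕂 := ℝ) (J.mulL u) t).clm_apply (hasDerivAt_const t y)
    simpa [φ] using this
  have hd : ∀ t, HasDerivAt (fun t => Real.exp (-(t * c)) * J.det (φ t)) 0 t := fun t => by
    have h1 := (J.differentiable_det (φ t)).hasFDerivAt.comp_hasDerivAt t (hφ t)
    rw [J.fderiv_det_mul] at h1
    have h2 := ((hasDerivAt_id t).mul_const c).neg.exp.mul h1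
    refine h2.congr_deriv ?_
    simp only [id, c, Function.comp]
    ring
  have h3 := is_const_of_deriv_eq_zero (fun t => (hd t).differentiableAt) (fun t => (hd t).deriv) 1 0
  have h0 : φ 0 = y := by
    change (NormedSpace.exp ((0 : ℝ) • J.mulL u) : RSpace n →L[ℝ] RSpace n) y = y
    rw [show (0 : ℝ) • J.mulL u = 0 from
      ContinuousLinearMap.ext fun v => zero_smul ℝ _, NormedSpace.exp_zero]
    rfl
  have h1 : φ 1 = NormedSpace.exp (J.mulL u) y := by
    change (NormedSpace.exp ((1 : ℝ) • J.mulL u) : RSpace n →L[ℝ] RSpace n) y = _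
    rw [show (1 : ℝ) • J.mulL u = J.mulL u from one_smul ℝ _]
  rw [h0, h1, _root_.one_mul, zero_mul, neg_zero, Real.exp_zero, _root_.one_mul, Real.exp_neg] at h3
  rw [← h3, ← mul_assoc, mul_inv_cancel₀ (Real.exp_ne_zero _), _root_.one_mul]

/-- `Δ` never vanishes along the orbit but is zero on `psd` outside `pd`, so the times spent in `pd`
form a closed as well as open set. -/
theorem exp_mem_pd (u : RSpace n) {y : RSpace n} (hy : y ∈ J.pd) :
    NormedSpace.exp (J.mulL u) y ∈ J.pd := by
  set φ : ℝ → RSpace n := fun t => NormedSpace.exp (t • J.mulL u) y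
  have hφ : Continuous φ := by
    refine continuous_iff_continuousAt.2 fun t => HasDerivAt.continuousAt
      (f' := J.mul u (φ t)) ?_
    have := (hasDerivAt_exp_smul_const' (𝕂 := ℝ) (J.mulL u) t).clm_apply (hasDerivAt_const t y)
    simpa [φ] using this
  have hpos : ∀ t, J.det (φ t) ≠ 0 := fun t => by
    have h := J.det_exp (t • u) y
    rw [map_smul] at h
    change J.det (NormedSpace.exp (t • J.mulL u) y) ≠ 0
    rw [h]
    exact mul_ne_zero (Real.exp_ne_zero _) (J.det_pos hy).ne'
  have hclopen : IsClopen (φ ⁻¹' J.pd) := by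
    refine ⟨?_, J.isOpen_pd.preimage hφ⟩
    have : φ ⁻¹' J.pd = φ ⁻¹' J.psd := by
      ext t
      refine ⟨fun h => J.pd_subset_psd h, fun h => ?_⟩
      by_contra hcon
      exact hpos t (J.det_eq_zero_of_notMem h hcon)
    rw [this]
    exact J.isClosed_psd.preimage hφ
  have h0 : (0 : ℝ) ∈ φ ⁻¹' J.pd := by
    change (NormedSpace.exp ((0 : ℝ) • J.mulL u) : RSpace n →L[ℝ] RSpace n) y ∈ J.pd
    rw [show (0 : ℝ) • J.mulL u = 0 from
      ContinuousLinearMap.ext fun v => zero_smul ℝ _, NormedSpace.exp_zero]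
    exact hy
  have h1 := hclopen.eq_univ ⟨0, h0⟩
  have h2 : (1 : ℝ) ∈ φ ⁻¹' J.pd := h1 ▸ Set.mem_univ _
  change (NormedSpace.exp ((1 : ℝ) • J.mulL u) : RSpace n →L[ℝ] RSpace n) y ∈ J.pd at h2
  rwa [show (1 : ℝ) • J.mulL u = J.mulL u from one_smul ℝ _] at h2

theorem exp_neg_exp (u y : RSpace n) :
    NormedSpace.exp (J.mulL (-u)) (NormedSpace.exp (J.mulL u) y) = y := by
  let _ : NormedAlgebra ℚ (RSpace n →L[ℝ] RSpace n) := NormedAlgebra.restrictScalars ℚ ℝ _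
  have hc : Commute (-J.mulL u) (J.mulL u) := (Commute.refl (J.mulL u)).neg_left
  have h := NormedSpace.exp_add_of_commute hc
  rw [neg_add_cancel, NormedSpace.exp_zero] at h
  rw [map_neg]
  exact (congrArg (fun g : RSpace n →L[ℝ] RSpace n => g y) h).symm

theorem exp_mem_pd_iff (u y : RSpace n) : NormedSpace.exp (J.mulL u) y ∈ J.pd ↔ y ∈ J.pd :=
  ⟨fun h => by have := J.exp_mem_pd (-u) h; rwa [exp_neg_exp] at this, J.exp_mem_pd u⟩

theorem inner_exp (u x y : RSpace n) : inner ℝ (NormedSpace.exp (J.mulL u) x) y =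
    inner ℝ x (NormedSpace.exp (J.mulL u) y) := by
  have h1 : IsSelfAdjoint (J.mulL u) :=
    LinearMap.IsSymmetric.isSelfAdjoint (A := J.mulL u) (J.isSymmetric_mul u)
  have h2 := IsSelfAdjoint.exp (𝔸 := RSpace n →L[ℝ] RSpace n) h1
  conv_lhs => rw [← h2.adjoint_eq, ContinuousLinearMap.adjoint_inner_left]

theorem linearDet_exp (u : RSpace n) :
    LinearMap.det (NormedSpace.exp (J.mulL u) : RSpace n →L[ℝ] RSpace n).toLinearMap =
      Real.exp (LinearMap.trace ℝ _ (J.mul u)) := by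
  have hT := J.isSymmetric_mul u
  have hn : Module.finrank ℝ (RSpace n) = n := by simp
  set b := hT.eigenvectorBasis hn
  rw [hT.trace_eq_sum_eigenvalues hn, ← LinearMap.det_toMatrix b.toBasis]
  have hb : ∀ i, NormedSpace.exp (J.mulL u) (b i) = Real.exp (hT.eigenvalues hn i) • b i :=
    fun i => ContinuousLinearMap.exp_apply_of_eigenvector (by
      rw [mulL_apply]; exact hT.apply_eigenvectorBasis hn i)
  have : LinearMap.toMatrix b.toBasis b.toBasis
      (NormedSpace.exp (J.mulL u) : RSpace n →L[ℝ] RSpace n).toLinearMap =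
      Matrix.diagonal fun i => Real.exp (hT.eigenvalues hn i) := by
    ext i j
    rw [LinearMap.toMatrix_apply, OrthonormalBasis.coe_toBasis, ContinuousLinearMap.coe_coe, hb,
      map_smul]
    rw [← OrthonormalBasis.coe_toBasis, Module.Basis.repr_self, Finsupp.smul_single,
      Finsupp.single_apply, Matrix.diagonal_apply]
    by_cases hij : i = j
    · simp [hij]
    · simp [hij, Ne.symm hij]
  rw [this, Matrix.det_diagonal, ← Real.exp_sum]
  rfl

/-! ### Central elements -/

/-- Associativity of the scalar product turns the two sides of the hypothesis into `⟨v(au), w⟩` and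
`⟨a(vu), w⟩`. -/
theorem central_of_symm {a : RSpace n}
    (h : ∀ u v w, inner ℝ a (J.mul u (J.mul v w)) = inner ℝ a (J.mul w (J.mul v u))) (v u : RSpace n) :
    J.mul v (J.mul a u) = J.mul a (J.mul v u) := by
  refine ext_inner_right ℝ fun w => ?_
  have h1 := h u v w
  rw [← J.inner_mul, J.mul_comm u a, ← J.inner_mul, ← J.inner_mul, J.mul_comm w a, J.inner_mul] at h1
  rw [J.inner_mul, h1, real_inner_comm, J.inner_mul a]

/-- Differentiate `DΔ(y)(uy) = DΔ(e)(u) Δ(y)` (`hA`); symmetry of the second derivative then gives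
`DΔ(y)([L(u), L(w)] y) = 0` (`hB`). Differentiate once more at `e`: since `[L(u), L(w)] e = 0`, only
`DΔ(e)([L(u), L(w)] v) = 0` remains. -/
theorem central_gradient (v u : RSpace n) :
    J.mul v (J.mul (gradient J.det J.one) u) = J.mul (gradient J.det J.one) (J.mul v u) := by
  refine J.central_of_symm (fun u v w => ?_) v u
  rw [inner_gradient_left, inner_gradient_left]
  set D := fderiv ℝ J.det
  have hD : Differentiable ℝ D :=
    ((J.contDiff_det (k := 2)).fderiv_right (m := 1) (by norm_num)).differentiable one_ne_zero
  have hsymm : ∀ y a b, fderiv ℝ D y a b = fderiv ℝ D y b a := fun y a b =>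
    ((J.contDiff_det (k := 2)).contDiffAt.isSymmSndFDerivAt (by simp)) a b
  have hline : ∀ y v w z : RSpace n, HasDerivAt (fun s : ℝ => D (y + s • v) (w + s • z))
      (fderiv ℝ D y v w + D y z) 0 := by
    intro y v w z
    have h1 : HasDerivAt (fun s : ℝ => y + s • v) v 0 := by
      simpa using ((hasDerivAt_id (0 : ℝ)).smul_const v).const_add y
    have h2 : HasDerivAt (fun s : ℝ => w + s • z) z 0 := by
      simpa using ((hasDerivAt_id (0 : ℝ)).smul_const z).const_add w
    have h3 : HasDerivAt (fun s : ℝ => D (y + s • v)) (fderiv ℝ D y v) 0 := by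
      have := (hD (y + (0 : ℝ) • v)).hasFDerivAt.comp_hasDerivAt (0 : ℝ) h1
      rw [zero_smul, add_zero] at this
      exact this
    have := h3.clm_apply h2
    simpa using this
  have hA : ∀ y u v, fderiv ℝ D y v (J.mul u y) + D y (J.mul u v) = D J.one u * D y v := by
    intro y u v
    refine (hline y v (J.mul u y) (J.mul u v)).unique ?_
    refine ((J.hasDerivAt_det_line_zero y v).const_mul (D J.one u)).congr_of_eventuallyEq
      (Filter.Eventually.of_forall fun s => ?_)
    simp only []
    rw [← J.fderiv_det_mul, map_add (J.mul u), map_smul (J.mul u)]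
  have hB : ∀ y u w, D y (J.mul u (J.mul w y)) = D y (J.mul w (J.mul u y)) := by
    intro y u w
    have h1 := hA y u (J.mul w y)
    have h2 := hA y w (J.mul u y)
    rw [J.fderiv_det_mul] at h1 h2
    rw [hsymm] at h1
    linarith
  have hC := hline J.one v (J.mul u (J.mul w J.one) - J.mul w (J.mul u J.one))
    (J.mul u (J.mul w v) - J.mul w (J.mul u v))
  have h0 : ∀ s : ℝ, D (J.one + s • v) (J.mul u (J.mul w J.one) - J.mul w (J.mul u J.one) +
      s • (J.mul u (J.mul w v) - J.mul w (J.mul u v))) = 0 := by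
    intro s
    have h1 := hB (J.one + s • v) u w
    rw [← sub_eq_zero, ← map_sub] at h1
    rw [← h1]
    congr 1
    simp only [map_add, map_smul]
    module
  simp only [h0] at hC
  have h1 := hC.unique (hasDerivAt_const (0 : ℝ) (0 : ℝ))
  rw [J.mul_one, J.mul_one, J.mul_comm w u, sub_self, map_zero, zero_add, map_sub, sub_eq_zero] at h1
  rw [J.mul_comm v w, h1, J.mul_comm u v]

/-- The trace form vector: `Tr L(u) = ⟨a, u⟩`. -/
theorem exists_trace_vector : ∃ a : RSpace n, (∀ u, LinearMap.trace ℝ _ (J.mul u) = inner ℝ a u) ∧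
    ∀ v u, J.mul v (J.mul a u) = J.mul a (J.mul v u) := by
  set T : RSpace n →ₗ[ℝ] ℝ := LinearMap.trace ℝ (RSpace n) ∘ₗ J.mul
  set a := (InnerProductSpace.toDual ℝ (RSpace n)).symm (LinearMap.toContinuousLinearMap T)
  have ha : ∀ u, LinearMap.trace ℝ _ (J.mul u) = inner ℝ a u := fun u => by
    simp [a, T]
  refine ⟨a, ha, J.central_of_symm fun u v w => ?_⟩
  rw [← ha, ← ha]
  set tr := LinearMap.trace ℝ (RSpace n)
  -- Take the trace of `mul_sq_mul` and polarize in `x`; cyclicity of the trace makes the result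
  -- symmetric in the two outer factors.
  have hF : ∀ x z, tr (J.mul (J.mul (J.mul x x) z)) = tr (J.mul (J.mul x x) * J.mul z) +
      2 * tr (J.mul (J.mul x z) * J.mul x) - 2 * tr (J.mul x * J.mul z * J.mul x) := by
    intro x z
    rw [J.mul_sq_mul]; simp
  have hS : ∀ x y z, tr (J.mul (J.mul (J.mul x y) z)) = tr (J.mul (J.mul x y) * J.mul z) +
      tr (J.mul (J.mul x z) * J.mul y) + tr (J.mul (J.mul y z) * J.mul x) -
      tr (J.mul x * J.mul z * J.mul y) - tr (J.mul y * J.mul z * J.mul x) := by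
    intro x y z
    have h1 := hF (x + y) z
    have h2 := hF x z
    have h3 := hF y z
    simp only [map_add, LinearMap.add_apply, J.mul_comm y x, mul_add, add_mul] at h1
    linarith
  have h1 := hS v w u
  have h2 := hS v u w
  have h3 : tr (J.mul v * J.mul u * J.mul w) = tr (J.mul u * J.mul w * J.mul v) := by
    rw [LinearMap.trace_mul_cycle, LinearMap.trace_mul_cycle]
  have h4 : tr (J.mul v * J.mul w * J.mul u) = tr (J.mul w * J.mul u * J.mul v) := by
    rw [LinearMap.trace_mul_cycle, LinearMap.trace_mul_cycle]
  rw [J.mul_comm u (J.mul v w), J.mul_comm w (J.mul v u), h1, h2, J.mul_comm w u]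
  linarith

/-- `L(a)` commutes with all multiplications, so its eigenspace `W` is an ideal; so is `Wᗮ`, and the
two annihilate each other. The cone is then the sum of its projections to `W` and `Wᗮ`, and
irreducibility forces `W = V`, which contains `e`. -/
theorem eq_smul_one_of_central (hirr : IsIrreducibleCone J.pd) {a : RSpace n}
    (ha : ∀ v u, J.mul v (J.mul a u) = J.mul a (J.mul v u)) : ∃ k : ℝ, a = k • J.one := by
  have hn : Module.finrank ℝ (RSpace n) = n := by simp
  have hT := J.isSymmetric_mul a
  set k := hT.eigenvalues hn ⟨0, hirr.1⟩
  have hk := hT.hasEigenvalue_eigenvalues hn ⟨0, hirr.1⟩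
  set W := Module.End.eigenspace (J.mul a) k
  have hW : ∀ y, ∀ z ∈ W, J.mul y z ∈ W := fun y z hz => by
    rw [Module.End.mem_eigenspace_iff] at hz ⊢
    rw [← ha, hz, map_smul]
  have hW' : ∀ y, ∀ z ∈ Wᗮ, J.mul y z ∈ Wᗮ := fun y z hz => by
    rw [Submodule.mem_orthogonal] at hz ⊢
    intro w hw
    rw [← J.inner_mul]
    exact hz _ (hW y w hw)
  have hz : ∀ p ∈ W, ∀ q ∈ Wᗮ, J.mul p q = 0 := fun p hp q hq => by
    have h1 := hW' p q hq
    have h2 := hW q p hp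
    rw [J.mul_comm] at h2
    exact (Submodule.disjoint_def.1 W.orthogonal_disjoint) _ h2 h1
  set P := W.starProjection
  have hP : ∀ x, P x ∈ W := W.starProjection_apply_mem
  have hP' : ∀ x, x - P x ∈ Wᗮ := fun x => W.sub_starProjection_mem_orthogonal x
  have hor := hirr.2 W Wᗮ (Submodule.isCompl_orthogonal W)
    ⟨P '' J.pd, (fun x => x - P x) '' J.pd, ?_, ?_, ?_⟩
  · have hWne : W ≠ ⊥ := hk
    have hWo := hor.resolve_left hWne
    rw [Submodule.orthogonal_eq_bot_iff] at hWo
    have h1 : J.one ∈ W := hWo ▸ Submodule.mem_top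
    rw [Module.End.mem_eigenspace_iff, J.mul_one] at h1
    exact ⟨k, h1⟩
  · rintro _ ⟨x, -, rfl⟩; exact hP x
  · rintro _ ⟨x, -, rfl⟩; exact hP' x
  · ext x
    constructor
    · intro hx
      exact ⟨P x, ⟨x, hx, rfl⟩, x - P x, ⟨x, hx, rfl⟩, by simp⟩
    -- For `v = p + q` along `W ⊕ Wᗮ` the cross terms vanish, and the quadratic form is `⟨xp, p⟩ +
    -- ⟨yq, q⟩`.
    · rintro ⟨_, ⟨x, hx, rfl⟩, _, ⟨y, hy, rfl⟩, rfl⟩ v hv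
      simp only []
      set p := P v
      set q := v - P v
      have hpq : v = p + q := by simp [p, q]
      have h1 : J.mul (P x + (y - P y)) v = J.mul x p + J.mul y q := by
        have e1 := hz (P x) (hP x) q (hP' v)
        have e2 := hz p (hP v) (y - P y) (hP' y)
        have e3 := hz p (hP v) (x - P x) (hP' x)
        have e4 := hz (P y) (hP y) q (hP' v)
        rw [J.mul_comm] at e2 e3
        rw [hpq]
        have f1 : J.mul (P x) p = J.mul x p := by
          rw [map_sub J.mul, LinearMap.sub_apply, sub_eq_zero] at e3; exact e3.symm
        have f2 : J.mul (y - P y) q = J.mul y q := by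
          rw [map_sub J.mul, LinearMap.sub_apply, e4, sub_zero]
        rw [map_add J.mul, LinearMap.add_apply, map_add (J.mul (P x)), map_add (J.mul (y - P y)), e1, e2,
          f1, f2]
        abel
      have h2 : inner ℝ (J.mul x p) q = 0 :=
        (Submodule.mem_orthogonal W q).1 (hP' v) _ (hW x p (hP v))
      have h3 : inner ℝ (J.mul y q) p = 0 := by
        rw [real_inner_comm]
        exact (Submodule.mem_orthogonal W _).1 (hW' y q (hP' v)) p (hP v)
      rw [h1, inner_add_left]
      have h4 : inner ℝ (J.mul x p) v = inner ℝ (J.mul x p) p := by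
        conv_lhs => rw [hpq, inner_add_right, h2, add_zero]
      have h5 : inner ℝ (J.mul y q) v = inner ℝ (J.mul y q) q := by
        conv_lhs => rw [hpq, inner_add_right, h3, zero_add]
      rw [h4, h5]
      by_cases hp0 : p = 0
      · have hq0 : q ≠ 0 := fun hq0 => hv (by rw [hpq, hp0, hq0, add_zero])
        exact add_pos_of_nonneg_of_pos (J.pd_subset_psd hx p) (hy q hq0)
      · exact add_pos_of_pos_of_nonneg (hx p hp0) (J.pd_subset_psd hy q)

theorem rank_pos (hn : 0 < n) : 0 < J.rank := by
  obtain ⟨x, hx⟩ := J.dense_regular.nonempty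
  obtain ⟨σ, c, h⟩ := J.exists_isSpectral x
  rw [← hx, h.degree_eq, Finset.card_pos]
  by_contra hσ
  rw [Finset.not_nonempty_iff_eq_empty] at hσ
  have h1 := h.sum_eq
  rw [hσ, Finset.sum_empty] at h1
  have h2 : ∀ v : RSpace n, v = 0 := fun v => by
    rw [← J.one_mul v, ← h1]; simp
  have h3 := h2 (EuclideanSpace.single ⟨0, hn⟩ 1)
  simp at h3

theorem one_ne_zero (hn : 0 < n) : J.one ≠ 0 := fun h1 => by
  have h2 : ∀ v : RSpace n, v = 0 := fun v => by
    rw [← J.one_mul v, h1]; simp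
  have h3 := h2 (EuclideanSpace.single ⟨0, hn⟩ 1)
  simp at h3

/-- `g = exp L(u)` with `u = log x` in the spectral sense. By irreducibility `Tr L` and `DΔ(e)` are
`k⟨e, ·⟩` and `l⟨e, ·⟩`; at `e` they take the values `n` and `r`, so `k/l = n/r`, which is the
exponent. -/
theorem exists_automorphism (hirr : IsIrreducibleCone J.pd) {x : RSpace n} (hx : x ∈ J.pd) :
    ∃ g : RSpace n →L[ℝ] RSpace n, (∀ y, g y ∈ J.pd ↔ y ∈ J.pd) ∧
      (∀ y z, inner ℝ (g y) z = inner ℝ y (g z)) ∧ g J.one = x ∧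
      (∀ y, J.det (g y) = J.det x * J.det y) ∧
      LinearMap.det g.toLinearMap = J.det x ^ ((n : ℝ) / J.rank) := by
  obtain ⟨σ, c, h⟩ := J.exists_isSpectral x
  set u := ∑ a ∈ σ, Real.log a • c a
  have hone : NormedSpace.exp (J.mulL u) J.one = x := by
    conv_rhs => rw [h.eq_sum]
    rw [← h.sum_eq, map_sum]
    refine Finset.sum_congr rfl fun a ha => ?_
    rw [ContinuousLinearMap.exp_apply_of_eigenvector (a := Real.log a)
      (by rw [mulL_apply]; exact h.mul_sum _ ha), Real.exp_log (h.pos hx ha)]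
  have hdet := J.det_exp u J.one
  rw [hone, J.det_one, _root_.mul_one] at hdet
  refine ⟨NormedSpace.exp (J.mulL u), J.exp_mem_pd_iff u, J.inner_exp u, hone, fun y => ?_, ?_⟩
  · rw [J.det_exp, hdet]
  · obtain ⟨a, ha, hac⟩ := J.exists_trace_vector
    obtain ⟨k, hk⟩ := J.eq_smul_one_of_central hirr hac
    obtain ⟨l, hl⟩ := J.eq_smul_one_of_central hirr J.central_gradient
    have hr : (0 : ℝ) < J.rank := by exact_mod_cast J.rank_pos hirr.1
    have h1 : ∀ u, fderiv ℝ J.det J.one u = l * inner ℝ J.one u := fun u => by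
      rw [← inner_gradient_left, hl, inner_smul_left]; rfl
    have h2 : ∀ u, LinearMap.trace ℝ _ (J.mul u) = k * inner ℝ J.one u := fun u => by
      rw [ha, hk, inner_smul_left]; rfl
    have h3 : (J.rank : ℝ) = l * inner ℝ J.one J.one := by
      rw [← h1, J.fderiv_det_self, J.det_one, _root_.mul_one]
    have h4 : (n : ℝ) = k * inner ℝ J.one J.one := by
      have : J.mul J.one = 1 := by ext1 y; exact J.one_mul y
      rw [← h2, this, LinearMap.trace_one]
      simp
    have h5 : inner ℝ J.one J.one ≠ 0 := (real_inner_self_pos.2 (J.one_ne_zero hirr.1)).ne'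
    rw [J.linearDet_exp, hdet, ← Real.exp_mul, h1, h2]
    congr 1
    have hl0 : l ≠ 0 := by
      rintro rfl
      rw [zero_mul] at h3
      exact hr.ne' h3
    rw [h3, h4]
    field_simp

end EuclideanJordanAlgebra

theorem MvPolynomial.exists_eval_bound {n : ℕ} (p : MvPolynomial (Fin n) ℝ) :
    ∃ (C : ℝ) (N : ℕ), 0 ≤ C ∧ ∀ x : RSpace n,
      |MvPolynomial.eval (fun j => x j) p| ≤ C * (1 + ‖x‖) ^ N := by
  induction p using MvPolynomial.induction_on with
  | C a => exact ⟨|a|, 0, abs_nonneg a, fun x => by simp⟩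
  | add p q hp hq =>
    obtain ⟨C, N, hC, h⟩ := hp
    obtain ⟨C', N', hC', h'⟩ := hq
    refine ⟨C + C', max N N', add_nonneg hC hC', fun x => ?_⟩
    have h1 : 1 ≤ 1 + ‖x‖ := by linarith [norm_nonneg x]
    rw [map_add, add_mul]
    refine (abs_add_le _ _).trans (add_le_add ((h x).trans ?_) ((h' x).trans ?_))
    · exact mul_le_mul_of_nonneg_left (pow_le_pow_right₀ h1 (le_max_left _ _)) hC
    · exact mul_le_mul_of_nonneg_left (pow_le_pow_right₀ h1 (le_max_right _ _)) hC'
  | mul_X p i hp =>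
    obtain ⟨C, N, hC, h⟩ := hp
    refine ⟨C, N + 1, hC, fun x => ?_⟩
    rw [map_mul, MvPolynomial.eval_X, abs_mul, pow_succ, ← mul_assoc]
    have h1 : |x i| ≤ 1 + ‖x‖ := by
      have := PiLp.norm_apply_le x i
      rw [Real.norm_eq_abs] at this
      linarith
    exact mul_le_mul (h x) h1 (abs_nonneg _) (by positivity)

namespace EuclideanJordanAlgebra

variable {n : ℕ} (J : EuclideanJordanAlgebra n)

theorem measurableSet_pd : MeasurableSet J.pd := J.isOpen_pd.measurableSet

/-! ### The squaring map on the cone -/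

theorem inner_one_sq (x : RSpace n) : inner ℝ J.one (J.mul x x) = ‖x‖ ^ 2 := by
  rw [← J.inner_mul_self_comm, J.one_mul, real_inner_self_eq_norm_sq]

theorem sq_mem_pd {x : RSpace n} (hx : x ∈ J.pd) : J.mul x x ∈ J.pd := by
  obtain ⟨σ, c, h⟩ := J.exists_isSpectral x
  rw [h.eq_sum, h.mul_sum_sum]
  exact h.sum_mem_pd fun a ha => mul_pos (h.pos hx ha) (h.pos hx ha)

/-- If `x² = z²` then `(x + z)(x - z) = 0`, and `L(x + z)` is positive definite. -/
theorem injOn_sq : Set.InjOn (fun x => J.mul x x) J.pd := by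
  intro x hx z hz hxz
  simp only [] at hxz
  have h1 : J.mul (x + z) (x - z) = 0 := by
    rw [map_add, LinearMap.add_apply, map_sub, map_sub, hxz, J.mul_comm z x]
    abel
  by_contra hne
  have h2 := J.add_mem_pd hx (J.pd_subset_psd hz) (x - z) (sub_ne_zero.2 hne)
  rw [h1, inner_zero_left] at h2
  exact h2.false

theorem image_sq : (fun x => J.mul x x) '' J.pd = J.pd := by
  ext y
  constructor
  · rintro ⟨x, hx, rfl⟩; exact J.sq_mem_pd hx
  · intro hy
    obtain ⟨σ, c, h⟩ := J.exists_isSpectral y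
    refine ⟨∑ a ∈ σ, Real.sqrt a • c a, h.sum_mem_pd fun a ha => Real.sqrt_pos.2 (h.pos hy ha), ?_⟩
    simp only []
    rw [h.mul_sum_sum]
    conv_rhs => rw [h.eq_sum]
    exact Finset.sum_congr rfl fun a ha => by rw [Real.mul_self_sqrt (h.pos hy ha).le]

theorem det_sq {x : RSpace n} (hx : x ∈ J.pd) : J.det (J.mul x x) = J.det x ^ 2 := by
  have hcl : IsClosed {x | J.det (J.mul x x) = J.det x ^ 2} :=
    isClosed_eq (J.continuous_det.comp (J.continuous_mul.comp (continuous_id.prodMk continuous_id)))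
      (J.continuous_det.pow 2)
  refine closure_minimal (fun x hx => ?_) hcl (J.dense_regular_inter hx)
  obtain ⟨σ, c, h⟩ := J.exists_isSpectral x
  have h1 := h.det_transform hx.2 (f := fun a => a * a) fun a ha b hb hab =>
    (mul_self_inj (h.pos hx.1 ha).le (h.pos hx.1 hb).le).1 hab
  change J.det (J.mul x x) = J.det x ^ 2
  rw [J.det_eq_prod h hx.2]
  conv_lhs => rw [h.eq_sum, h.mul_sum_sum]
  rw [h1, Finset.prod_mul_distrib, sq]

theorem hasFDerivAt_sq (x : RSpace n) :
    HasFDerivAt (fun x => J.mul x x) ((2 : ℝ) • J.mulL x) x := by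
  have h := J.mulL.hasFDerivAt.clm_apply (hasFDerivAt_id x)
  refine h.congr_fderiv ?_
  ext1 v
  simp [J.mul_comm v x, two_smul]

theorem lintegral_pd_sq (F : RSpace n → ℝ≥0∞) : ∫⁻ y in J.pd, F y =
    ∫⁻ x in J.pd, ENNReal.ofReal (2 ^ n * |LinearMap.det (J.mul x)|) * F (J.mul x x) := by
  conv_lhs => rw [← J.image_sq]
  rw [lintegral_image_eq_lintegral_abs_det_fderiv_mul volume J.measurableSet_pd
    (fun x _ => (J.hasFDerivAt_sq x).hasFDerivWithinAt) J.injOn_sq]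
  refine lintegral_congr fun x => ?_
  congr 2
  have : ContinuousLinearMap.det ((2 : ℝ) • J.mulL x) = 2 ^ n * LinearMap.det (J.mul x) := by
    change LinearMap.det ((2 : ℝ) • J.mul x) = _
    rw [LinearMap.det_smul]; simp
  rw [this, abs_mul, abs_of_pos (by positivity)]

/-! ### Convergence of the gamma integral -/

theorem norm_le_inner_one : ∃ C : ℝ, 0 < C ∧ ∀ y ∈ J.psd, ‖y‖ ≤ C * inner ℝ J.one y := by
  refine ⟨‖J.mulL‖ + 1, by positivity, fun y hy => ?_⟩
  rw [← range_sq] at hy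
  obtain ⟨x, rfl⟩ := hy
  simp only []
  rw [J.inner_one_sq]
  calc ‖J.mul x x‖ ≤ ‖J.mulL‖ * ‖x‖ * ‖x‖ := J.mulL.le_opNorm₂ x x
    _ ≤ (‖J.mulL‖ + 1) * ‖x‖ ^ 2 := by nlinarith [norm_nonneg x]

theorem exists_lintegral_det_rpow_lt_top_of_nonneg {s : ℝ} (hs : 0 ≤ s) :
    ∃ M : ℕ, ∫⁻ y in J.pd, ENNReal.ofReal (J.det y ^ s / (1 + ‖y‖) ^ M) < ∞ := by
  obtain ⟨C, N, hC, h⟩ := J.detPoly.exists_eval_bound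
  obtain ⟨K, hK⟩ := exists_nat_ge (N * s)
  -- `K` absorbs the growth of `Δ^s`; the further `n + 1` makes the remaining power integrable on
  -- `ℝⁿ`.
  refine ⟨K + (n + 1), ?_⟩
  have hint : Integrable (fun y : RSpace n => C ^ s * (1 + ‖y‖) ^ (-((n : ℝ) + 1))) :=
    (integrable_one_add_norm (by simp)).const_mul _
  refine (setLIntegral_mono' J.measurableSet_pd fun y hy => ?_).trans_lt
    ((setLIntegral_le_lintegral _ _).trans_lt hint.lintegral_lt_top)
  refine ENNReal.ofReal_le_ofReal ?_
  have h1 : 1 ≤ 1 + ‖y‖ := by linarith [norm_nonneg y]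
  have h0 : 0 < 1 + ‖y‖ := by linarith
  have hd : 0 ≤ J.det y := (J.det_pos hy).le
  have h2 : J.det y ^ s ≤ C ^ s * (1 + ‖y‖) ^ K := by
    calc J.det y ^ s ≤ (C * (1 + ‖y‖) ^ N) ^ s :=
          Real.rpow_le_rpow hd ((le_abs_self _).trans (h y)) hs
      _ = C ^ s * (1 + ‖y‖) ^ (N * s) := by
          rw [Real.mul_rpow hC (by positivity), ← Real.rpow_natCast, ← Real.rpow_mul h0.le]
      _ ≤ C ^ s * (1 + ‖y‖) ^ (K : ℝ) :=
          mul_le_mul_of_nonneg_left (Real.rpow_le_rpow_of_exponent_le h1 hK) (by positivity)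
      _ = _ := by rw [Real.rpow_natCast]
  rw [pow_add, div_le_iff₀ (by positivity), Real.rpow_neg h0.le]
  have h3 : (1 + ‖y‖) ^ ((n : ℝ) + 1) = (1 + ‖y‖) ^ (n + 1) := by
    rw [← Real.rpow_natCast]; push_cast; rfl
  rw [h3]
  calc _ ≤ C ^ s * (1 + ‖y‖) ^ K := h2
    _ = _ := by field_simp

/-- Under `y = x²` the weight `Δ(y)^s` becomes `Δ(x)^{2s}`, and the Jacobian supplies one more
factor `Δ(x)` times a polynomial. That polynomial costs `N` powers of `1 + ‖x‖`, recovered from `(1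
+ ‖x‖)² ≤ K (1 + ‖x²‖)`. -/
theorem exists_lintegral_det_rpow_lt_top_step {s : ℝ}
    (h : ∃ M : ℕ, ∫⁻ y in J.pd, ENNReal.ofReal (J.det y ^ (2 * s + 1) / (1 + ‖y‖) ^ M) < ∞) :
    ∃ M : ℕ, ∫⁻ y in J.pd, ENNReal.ofReal (J.det y ^ s / (1 + ‖y‖) ^ M) < ∞ := by
  obtain ⟨M, hM⟩ := h
  obtain ⟨p, hp⟩ := J.exists_det_mul_eq
  obtain ⟨C, N, hC, hb⟩ := p.exists_eval_bound
  set K : ℝ := 2 * (1 + ‖J.one‖)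
  have hK : 0 < K := by positivity
  refine ⟨N + M, ?_⟩
  rw [J.lintegral_pd_sq]
  refine lt_of_le_of_lt (b := ∫⁻ y in J.pd, ENNReal.ofReal (2 ^ n * C * K ^ (N + M)) *
    ENNReal.ofReal (J.det y ^ (2 * s + 1) / (1 + ‖y‖) ^ M)) ?_ ?_
  · refine setLIntegral_mono' J.measurableSet_pd fun x hx => ?_
    rw [← ENNReal.ofReal_mul (by positivity), ← ENNReal.ofReal_mul (by positivity)]
    refine ENNReal.ofReal_le_ofReal ?_
    have hd := J.det_pos hx
    have h0 : 0 < 1 + ‖x‖ := by linarith [norm_nonneg x]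
    have h1 : 1 ≤ 1 + ‖x‖ := by linarith [norm_nonneg x]
    rw [hp, abs_mul, abs_of_pos hd, J.det_sq hx]
    have e1 : (J.det x ^ 2) ^ s = J.det x ^ (2 * s) := by
      rw [← Real.rpow_natCast, ← Real.rpow_mul hd.le]; norm_num
    have e2 : J.det x ^ (2 * s + 1) = J.det x * J.det x ^ (2 * s) := by
      rw [Real.rpow_add_one hd.ne', _root_.mul_comm]
    have h2 : (1 + ‖x‖) ^ 2 ≤ K * (1 + ‖J.mul x x‖) := by
      have h3 : ‖x‖ ^ 2 ≤ ‖J.one‖ * ‖J.mul x x‖ := by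
        rw [← J.inner_one_sq]; exact real_inner_le_norm _ _
      simp only [K]
      nlinarith [sq_nonneg (‖x‖ - 1), norm_nonneg J.one, norm_nonneg (J.mul x x)]
    have h4 : (1 + ‖x‖) ^ (N + M) * (1 + ‖x‖) ^ (N + M) ≤
        K ^ (N + M) * (1 + ‖J.mul x x‖) ^ (N + M) := by
      rw [← mul_pow, ← mul_pow, ← sq]
      exact pow_le_pow_left₀ (by positivity) h2 _
    have h5 : (1 + ‖x‖) ^ N * (1 + ‖x‖) ^ M ≤ (1 + ‖x‖) ^ (N + M) * (1 + ‖x‖) ^ (N + M) := by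
      rw [← pow_add, ← pow_add]
      exact pow_le_pow_right₀ h1 (by omega)
    have h6 := hb x
    have h7 : 0 < J.det x ^ (2 * s) := Real.rpow_pos_of_pos hd _
    rw [e1, e2, ← mul_div_assoc, ← mul_div_assoc, div_le_div_iff₀ (by positivity) (by positivity)]
    calc 2 ^ n * (J.det x * |evalAt x p|) * J.det x ^ (2 * s) * (1 + ‖x‖) ^ M
        ≤ 2 ^ n * (J.det x * (C * (1 + ‖x‖) ^ N)) * J.det x ^ (2 * s) * (1 + ‖x‖) ^ M := by
          gcongr
      _ = 2 ^ n * C * (J.det x * J.det x ^ (2 * s)) * ((1 + ‖x‖) ^ N * (1 + ‖x‖) ^ M) := by ring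
      _ ≤ 2 ^ n * C * (J.det x * J.det x ^ (2 * s)) *
          (K ^ (N + M) * (1 + ‖J.mul x x‖) ^ (N + M)) :=
          mul_le_mul_of_nonneg_left (h5.trans h4) (by positivity)
      _ = _ := by ring
  · rw [lintegral_const_mul' _ _ ENNReal.ofReal_ne_top]
    exact ENNReal.mul_lt_top ENNReal.ofReal_lt_top hM

/-- Each step `s ↦ 2s + 1` doubles `s + 1`, so finitely many steps lead to a nonnegative exponent.
-/
theorem exists_lintegral_det_rpow_lt_top {s : ℝ} (hs : -1 < s) :
    ∃ M : ℕ, ∫⁻ y in J.pd, ENNReal.ofReal (J.det y ^ s / (1 + ‖y‖) ^ M) < ∞ := by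
  have key : ∀ (k : ℕ) (s : ℝ), 1 ≤ 2 ^ k * (s + 1) →
      ∃ M : ℕ, ∫⁻ y in J.pd, ENNReal.ofReal (J.det y ^ s / (1 + ‖y‖) ^ M) < ∞ := by
    intro k
    induction k with
    | zero => exact fun s hs => J.exists_lintegral_det_rpow_lt_top_of_nonneg (by linarith)
    | succ k ih =>
      intro s hs
      refine J.exists_lintegral_det_rpow_lt_top_step (ih _ ?_)
      rw [pow_succ] at hs
      linarith
  obtain ⟨k, hk⟩ := pow_unbounded_of_one_lt (s + 1)⁻¹ (one_lt_two (α := ℝ))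
  refine key k s ?_
  have h1 : 0 < s + 1 := by linarith
  rw [inv_lt_iff_one_lt_mul₀ h1] at hk
  linarith

/-- The density of the gamma integral. -/
noncomputable def gammaDensity (s : ℝ) (x y : RSpace n) : ℝ≥0∞ :=
  ENNReal.ofReal (Real.exp (-inner ℝ x y) * J.det y ^ s)

/-- On the cone `‖y‖` is controlled by `⟨e, y⟩`, so the exponential beats any power of `1 + ‖y‖`. -/
theorem lintegral_gammaDensity_one_lt_top {s : ℝ} (hs : -1 < s) :
    ∫⁻ y in J.pd, J.gammaDensity s J.one y < ∞ := by
  obtain ⟨M, hM⟩ := J.exists_lintegral_det_rpow_lt_top hs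
  obtain ⟨C, hC, hle⟩ := J.norm_le_inner_one
  set K : ℝ := (1 + C) ^ M * (M.factorial * Real.exp 1)
  refine lt_of_le_of_lt (b := ∫⁻ y in J.pd, ENNReal.ofReal K *
    ENNReal.ofReal (J.det y ^ s / (1 + ‖y‖) ^ M)) ?_ ?_
  · refine setLIntegral_mono' J.measurableSet_pd fun y hy => ?_
    rw [gammaDensity, ← ENNReal.ofReal_mul (by positivity)]
    refine ENNReal.ofReal_le_ofReal ?_
    have hd := Real.rpow_pos_of_pos (J.det_pos hy) s
    set t := inner ℝ J.one y
    have ht : 0 ≤ t := J.inner_psd_nonneg (J.pd_subset_psd J.one_mem_pd) (J.pd_subset_psd hy)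
    have h1 := hle y (J.pd_subset_psd hy)
    have h2 : 1 + ‖y‖ ≤ (1 + C) * (1 + t) := by nlinarith
    have h3 : (1 + ‖y‖) ^ M ≤ (1 + C) ^ M * (1 + t) ^ M := by
      rw [← mul_pow]; exact pow_le_pow_left₀ (by positivity) h2 _
    have h4 := Real.pow_div_factorial_le_exp (1 + t) (by positivity) M
    rw [div_le_iff₀ (by positivity), Real.exp_add] at h4
    have h5 : (1 + ‖y‖) ^ M * Real.exp (-t) ≤ K := by
      calc _ ≤ (1 + C) ^ M * (1 + t) ^ M * Real.exp (-t) := by gcongr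
        _ ≤ (1 + C) ^ M * (Real.exp 1 * Real.exp t * M.factorial) * Real.exp (-t) := by gcongr
        _ = (1 + C) ^ M * (M.factorial * Real.exp 1) * (Real.exp t * Real.exp (-t)) := by ring
        _ = K := by rw [← Real.exp_add]; simp [K]
    rw [← mul_div_assoc, le_div_iff₀ (by positivity)]
    calc _ = (1 + ‖y‖) ^ M * Real.exp (-t) * J.det y ^ s := by ring
      _ ≤ _ := mul_le_mul_of_nonneg_right h5 hd.le
  · rw [lintegral_const_mul' _ _ ENNReal.ofReal_ne_top]
    exact ENNReal.mul_lt_top ENNReal.ofReal_lt_top hM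

theorem lintegral_gammaDensity_pos (s : ℝ) (x : RSpace n) {U : Set (RSpace n)} (hU : IsOpen U)
    (hne : U.Nonempty) (hsub : U ⊆ J.pd) :
    0 < ∫⁻ y in U, J.gammaDensity s x y := by
  have hm : Measurable (J.gammaDensity s x) := by
    refine ENNReal.measurable_ofReal.comp (Measurable.mul ?_ ?_)
    · exact (Real.continuous_exp.comp ((continuous_const.inner continuous_id).neg)).measurable
    · exact J.continuous_det.measurable.pow_const s
  rw [setLIntegral_pos_iff hm]
  refine (hU.measure_pos volume hne).trans_le (measure_mono fun y hy => ⟨?_, hy⟩)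
  have : 0 < Real.exp (-inner ℝ x y) * J.det y ^ s :=
    mul_pos (Real.exp_pos _) (Real.rpow_pos_of_pos (J.det_pos (hsub hy)) s)
  simpa [gammaDensity] using this

theorem gammaCone_eq (ν : ℝ) : J.gammaCone ν =
    (∫⁻ y in J.pd, J.gammaDensity (ν - n / J.rank) J.one y).toReal := by
  rw [gammaCone, cone_eq, integral_eq_lintegral_of_nonneg_ae]
  · rfl
  · filter_upwards [ae_restrict_mem J.measurableSet_pd] with y hy
    exact mul_nonneg (Real.exp_pos _).le (Real.rpow_nonneg (J.det_pos hy).le _)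
  · refine Measurable.aestronglyMeasurable (Measurable.mul ?_ ?_)
    · exact (Real.continuous_exp.comp ((continuous_const.inner continuous_id).neg)).measurable
    · exact J.continuous_det.measurable.pow_const _

/-- Change of variables in the gamma integral. -/
theorem lintegral_gammaDensity (hirr : IsIrreducibleCone J.pd) (s : ℝ) {x : RSpace n}
    (hx : x ∈ J.pd) : ∫⁻ y in J.pd, J.gammaDensity s x y =
      ENNReal.ofReal (J.det x ^ (-(s + n / J.rank))) *
        ∫⁻ y in J.pd, J.gammaDensity s J.one y := by
  obtain ⟨g, hg, hsymm, hone, hdet, hlin⟩ := J.exists_automorphism hirr hx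
  have hd := J.det_pos hx
  have hlin0 : LinearMap.det g.toLinearMap ≠ 0 := by
    rw [hlin]; exact (Real.rpow_pos_of_pos hd _).ne'
  have hbij : Function.Bijective g := by
    have := LinearMap.equivOfDetNeZero g.toLinearMap hlin0 |>.bijective
    exact this
  have himg : g '' J.pd = J.pd := by
    ext y
    constructor
    · rintro ⟨z, hz, rfl⟩; exact (hg z).2 hz
    · intro hy
      obtain ⟨z, rfl⟩ := hbij.2 y
      exact ⟨z, (hg z).1 hy, rfl⟩
  have h1 : ∫⁻ y in J.pd, J.gammaDensity s J.one y =
      ENNReal.ofReal (J.det x ^ (s + n / J.rank)) * ∫⁻ y in J.pd, J.gammaDensity s x y := by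
    conv_lhs => rw [← himg]
    rw [lintegral_image_eq_lintegral_abs_det_fderiv_mul volume J.measurableSet_pd
      (fun x _ => g.hasFDerivAt.hasFDerivWithinAt) hbij.1.injOn,
      ← lintegral_const_mul' _ _ ENNReal.ofReal_ne_top]
    refine setLIntegral_congr_fun J.measurableSet_pd fun y hy => ?_
    have e1 : ContinuousLinearMap.det g = J.det x ^ ((n : ℝ) / J.rank) := hlin
    rw [e1, abs_of_pos (Real.rpow_pos_of_pos hd _), gammaDensity, gammaDensity,
      ← ENNReal.ofReal_mul (Real.rpow_nonneg hd.le _),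
      ← ENNReal.ofReal_mul (Real.rpow_nonneg hd.le _), ← hsymm, hone, hdet,
      Real.mul_rpow hd.le (J.det_pos hy).le, Real.rpow_add hd]
    congr 1
    ring
  rw [h1, ← mul_assoc, ← ENNReal.ofReal_mul (Real.rpow_nonneg hd.le _), ← Real.rpow_add hd,
    neg_add_cancel, Real.rpow_zero, ENNReal.ofReal_one, _root_.one_mul]

theorem exists_inner_neg {x : RSpace n} (hx : x ∉ J.psd) : ∃ y ∈ J.pd, inner ℝ x y < 0 := by
  simp only [psd, Set.mem_ofPred_eq, not_forall, not_le] at hx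
  obtain ⟨v, hv⟩ := hx
  rw [J.inner_mul_self_comm] at hv
  have hc : ContinuousAt (fun t : ℝ => inner ℝ x (J.mul v v + t • J.one)) 0 := by fun_prop
  have h1 : ∀ᶠ t in nhdsWithin (0 : ℝ) (Set.Ioi 0), inner ℝ x (J.mul v v + t • J.one) < 0 := by
    refine (hc.eventually_lt_const (by simpa using hv)).filter_mono nhdsWithin_le_nhds
  obtain ⟨t, ht, ht'⟩ := (h1.and self_mem_nhdsWithin).exists
  exact ⟨_, J.add_smul_one_mem_pd (J.sq_mem_psd v) ht', ht⟩

/-- On a nonempty open part of the cone `⟨x, y⟩ < -δ`. The dilation `y ↦ ty` shows that the integral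
is at least a positive multiple of `t^{n + rs} e^{tδ}` for every `t > 0`. -/
theorem lintegral_gammaDensity_eq_top (s : ℝ) {x : RSpace n} (hx : x ∉ J.psd) :
    ∫⁻ y in J.pd, J.gammaDensity s x y = ∞ := by
  obtain ⟨y₀, hy₀, hneg⟩ := J.exists_inner_neg hx
  set δ := -inner ℝ x y₀ / 2
  have hδ : 0 < δ := by simp only [δ]; linarith
  set U := J.pd ∩ {y | inner ℝ x y < -δ}
  have hU : IsOpen U := J.isOpen_pd.inter (isOpen_lt (by fun_prop) continuous_const)
  have hU0 : y₀ ∈ U := ⟨hy₀, by simp only [Set.mem_ofPred_eq, δ]; linarith⟩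
  set c := ∫⁻ y in U, J.gammaDensity s 0 y
  have hc : 0 < c := J.lintegral_gammaDensity_pos s 0 hU ⟨y₀, hU0⟩ Set.inter_subset_left
  have key : ∀ t : ℝ, 0 < t → ENNReal.ofReal (t ^ n * t ^ (J.rank * s) * Real.exp (t * δ)) * c ≤
      ∫⁻ y in J.pd, J.gammaDensity s x y := by
    intro t ht
    have himg : (fun y : RSpace n => t • y) '' J.pd = J.pd := by
      ext y
      constructor
      · rintro ⟨z, hz, rfl⟩; exact J.smul_mem_pd hz ht
      · intro hy
        exact ⟨t⁻¹ • y, J.smul_mem_pd hy (inv_pos.2 ht), by simp [smul_smul, ht.ne']⟩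
    conv_rhs => rw [← himg]
    rw [lintegral_image_eq_lintegral_abs_det_fderiv_mul (f := fun y : RSpace n => t • y) volume
      J.measurableSet_pd (fun x _ => ((t • ContinuousLinearMap.id ℝ (RSpace n)).hasFDerivAt (x := x)).hasFDerivWithinAt)
      (smul_right_injective _ ht.ne').injOn, ← lintegral_const_mul' _ _ ENNReal.ofReal_ne_top]
    refine (setLIntegral_mono' hU.measurableSet fun y hy => ?_).trans
      (lintegral_mono_set Set.inter_subset_left)
    have e1 : ContinuousLinearMap.det (t • ContinuousLinearMap.id ℝ (RSpace n)) = t ^ n := by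
      change LinearMap.det (t • LinearMap.id) = _
      rw [LinearMap.det_smul]; simp
    have hd := J.det_pos hy.1
    rw [e1, abs_of_pos (by positivity), gammaDensity, gammaDensity,
      ← ENNReal.ofReal_mul (by positivity), ← ENNReal.ofReal_mul (by positivity)]
    refine ENNReal.ofReal_le_ofReal ?_
    have e2 : (t ^ J.rank * J.det y) ^ s = t ^ (J.rank * s) * J.det y ^ s := by
      rw [Real.mul_rpow (by positivity) hd.le, ← Real.rpow_natCast, ← Real.rpow_mul ht.le]
    rw [inner_zero_left, neg_zero, Real.exp_zero, _root_.one_mul, J.det_smul ht.ne', e2,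
      inner_smul_right]
    have h1 : Real.exp (t * δ) ≤ Real.exp (-(t * inner ℝ x y)) := by
      refine Real.exp_le_exp.2 ?_
      have : inner ℝ x y < -δ := hy.2
      nlinarith
    calc _ = t ^ n * t ^ (J.rank * s) * J.det y ^ s * Real.exp (t * δ) := by ring
      _ ≤ t ^ n * t ^ (J.rank * s) * J.det y ^ s * Real.exp (-(t * inner ℝ x y)) :=
        mul_le_mul_of_nonneg_left h1 (by positivity)
      _ = _ := by ring
  have hlim : Filter.Tendsto (fun t : ℝ => t ^ n * t ^ (J.rank * s) * Real.exp (t * δ))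
      Filter.atTop Filter.atTop := by
    have h1 := tendsto_exp_mul_div_rpow_atTop (-(n + J.rank * s)) δ hδ
    refine h1.congr' ?_
    filter_upwards [Filter.eventually_gt_atTop 0] with t ht
    rw [Real.rpow_neg ht.le, div_inv_eq_mul, Real.rpow_add ht, Real.rpow_natCast, _root_.mul_comm δ t]
    ring
  by_contra hne
  have h2 : Filter.Tendsto (fun t : ℝ => ENNReal.ofReal
      (t ^ n * t ^ (J.rank * s) * Real.exp (t * δ)) * c) Filter.atTop (nhds ∞) := by
    have := ENNReal.Tendsto.mul_const (b := c) (ENNReal.tendsto_ofReal_atTop.comp hlim)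
      (Or.inl ENNReal.top_ne_zero)
    rwa [ENNReal.top_mul hc.ne'] at this
  refine hne (top_le_iff.1 (le_of_tendsto h2 ?_))
  filter_upwards [Filter.eventually_gt_atTop 0] with t ht using key t ht

end EuclideanJordanAlgebra

/-! ### Agreement of the `L²` Fourier transform with the Fourier integral -/

section Plancherel

open FourierTransform SchwartzMap

variable {n : ℕ}

theorem integral_fourier_mul_eq {f g : RSpace n → ℂ} (hf : Integrable f) (hg : Integrable g) :
    ∫ x, 𝓕 f x * g x = ∫ x, f x * 𝓕 g x := by
  simpa using! (VectorFourier.integral_fourierIntegral_smul_eq_flip (L := innerₗ (RSpace n))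
      Real.continuous_fourierChar continuous_inner hf hg)

theorem continuous_fourier {f : RSpace n → ℂ} (hf : Integrable f) : Continuous (𝓕 f) :=
  VectorFourier.fourierIntegral_continuous (L := innerₗ (RSpace n))
    Real.continuous_fourierChar continuous_inner hf

theorem integral_schwartz_mul_fourier (f : Lp ℂ 2 (volume : Measure (RSpace n)))
    (g : 𝓢(RSpace n, ℂ)) :
    ∫ x, (𝓕 g : 𝓢(RSpace n, ℂ)) x • f x =
      ∫ x, g x • (𝓕 f : Lp ℂ 2 (volume : Measure (RSpace n))) x := by
  have h := congrArg (fun T => T g) (Lp.fourier_toTemperedDistribution_eq f)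
  simpa only [TemperedDistribution.fourier_apply, Lp.toTemperedDistribution_apply] using h

theorem ae_eq_of_integral_schwartz {f g : RSpace n → ℂ} (hf : LocallyIntegrable f)
    (hg : LocallyIntegrable g) (h : ∀ φ : 𝓢(RSpace n, ℂ), ∫ x, φ x * f x = ∫ x, φ x * g x) :
    f =ᵐ[volume] g := by
  suffices H : ∀ φ : RSpace n → ℝ, ContDiff ℝ ((⊤ : ℕ∞) : WithTop ℕ∞) φ → HasCompactSupport φ →
      ∫ x, φ x • f x = ∫ x, φ x • g x from ae_eq_of_integral_contDiff_smul_eq hf hg H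
  intro φ hφ hc
  have hφ' : ContDiff ℝ ((⊤ : ℕ∞) : WithTop ℕ∞) fun x => (φ x : ℂ) :=
    Complex.ofRealCLM.contDiff.comp hφ
  have hc' : HasCompactSupport fun x => (φ x : ℂ) := hc.comp_left Complex.ofReal_zero
  have h' := h (hc'.toSchwartzMap hφ')
  simp only [Complex.real_smul]
  exact h'

/-- Both sides have the same pairing with every Schwartz function, since the Fourier transform moves
across the pairing in either sense. -/
theorem coeFn_fourier_toLp {f : RSpace n → ℂ} (hf : Integrable f) (hf2 : MemLp f 2) :
    ((𝓕 (hf2.toLp f) : Lp ℂ 2 (volume : Measure (RSpace n))) : RSpace n → ℂ) =ᵐ[volume] 𝓕 f := by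
  refine ae_eq_of_integral_schwartz ((Lp.memLp _).locallyIntegrable (by norm_num))
    (continuous_fourier hf).locallyIntegrable fun g => ?_
  have h2 : ∫ x, (𝓕 g : 𝓢(RSpace n, ℂ)) x • hf2.toLp f x =
      ∫ x, f x * 𝓕 (g : RSpace n → ℂ) x := by
    refine integral_congr_ae ?_
    filter_upwards [hf2.coeFn_toLp] with x hx
    rw [hx, smul_eq_mul, mul_comm, SchwartzMap.fourier_coe]
  rw [integral_schwartz_mul_fourier, ← integral_fourier_mul_eq hf g.integrable] at h2
  simp only [smul_eq_mul] at h2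
  rw [h2]
  simp only [mul_comm]

theorem integral_schwartz_mul_fourierInv (f : Lp ℂ 2 (volume : Measure (RSpace n)))
    (g : 𝓢(RSpace n, ℂ)) :
    ∫ x, (𝓕⁻ g : 𝓢(RSpace n, ℂ)) x • f x =
      ∫ x, g x • (𝓕⁻ f : Lp ℂ 2 (volume : Measure (RSpace n))) x := by
  have h := congrArg (fun T => T g) (Lp.fourierInv_toTemperedDistribution_eq f)
  simpa only [TemperedDistribution.fourierInv_apply, Lp.toTemperedDistribution_apply] using h

theorem coeFn_fourierInv_toLp {f : RSpace n → ℂ} (hf : Integrable f) (hf2 : MemLp f 2) :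
    ((𝓕⁻ (hf2.toLp f) : Lp ℂ 2 (volume : Measure (RSpace n))) : RSpace n → ℂ) =ᵐ[volume] 𝓕⁻ f := by
  have hcont : Continuous (𝓕⁻ f) := by
    have : 𝓕⁻ f = fun x => 𝓕 f (-x) := funext fun x => Real.fourierInv_eq_fourier_neg f x
    rw [this]
    exact (continuous_fourier hf).comp continuous_neg
  refine ae_eq_of_integral_schwartz ((Lp.memLp _).locallyIntegrable (by norm_num))
    hcont.locallyIntegrable fun g => ?_
  have h2 : ∫ x, (𝓕⁻ g : 𝓢(RSpace n, ℂ)) x • hf2.toLp f x =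
      ∫ x, f (-x) * 𝓕 (g : RSpace n → ℂ) x := by
    rw [← integral_neg_eq_self (fun x => f (-x) * 𝓕 (g : RSpace n → ℂ) x)]
    refine integral_congr_ae ?_
    filter_upwards [hf2.coeFn_toLp] with x hx
    rw [hx, smul_eq_mul, mul_comm, SchwartzMap.fourierInv_coe, Real.fourierInv_eq_fourier_neg,
      neg_neg]
  have h3 : 𝓕 (fun x => f (-x)) = 𝓕⁻ f :=
    funext fun x => (congrFun (Real.fourierInv_eq_fourier_comp_neg f) x).symm
  rw [integral_schwartz_mul_fourierInv, ← integral_fourier_mul_eq hf.comp_neg g.integrable, h3] at h2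
  simp only [smul_eq_mul] at h2
  rw [h2]
  simp only [mul_comm]

theorem eLpNorm_fourierInv {f : RSpace n → ℂ} (hf : Integrable f) (hf2 : MemLp f 2) :
    eLpNorm (𝓕⁻ f) 2 volume = eLpNorm f 2 volume := by
  have h : ‖(𝓕⁻ (hf2.toLp f) : Lp ℂ 2 (volume : Measure (RSpace n)))‖ₑ = ‖hf2.toLp f‖ₑ := by
    rw [← ofReal_norm, ← ofReal_norm, ← Lp.norm_fourier_eq, FourierTransform.fourier_fourierInv_eq]
  rw [Lp.enorm_def, Lp.enorm_toLp] at h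
  rw [← h]
  exact (eLpNorm_congr_ae (coeFn_fourierInv_toLp hf hf2)).symm

/-- A square integrable function with integrable `L²` Fourier transform satisfies the inversion
formula. -/
theorem ae_eq_fourierInv {f : Lp ℂ 2 (volume : Measure (RSpace n))} {g : RSpace n → ℂ}
    (hg : Integrable g) (hfg : (𝓕 f : Lp ℂ 2 (volume : Measure (RSpace n))) =ᵐ[volume] g) :
    f =ᵐ[volume] 𝓕⁻ g := by
  have hg2 : MemLp g 2 := (memLp_congr_ae hfg).1 (Lp.memLp _)
  have h : (𝓕 f : Lp ℂ 2 (volume : Measure (RSpace n))) = hg2.toLp g :=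
    Lp.ext (hfg.trans hg2.coeFn_toLp.symm)
  have h' := coeFn_fourierInv_toLp hg hg2
  rwa [← h, FourierTransform.fourierInv_fourier_eq] at h'

end Plancherel

/-! ### Mean value estimates on tubes -/

section MeanValue

open Complex

variable {n : ℕ}

/-- The point `x + iy` of `ℂⁿ`. -/
def complexPoint (x y : RSpace n) : CSpace n := WithLp.toLp 2 fun j => (⟨x j, y j⟩ : ℂ)

theorem complexPoint_apply (x y : RSpace n) (j : Fin n) : complexPoint x y j = x j + y j * I :=
  Complex.mk_eq_add_mul_I _ _

theorem complexPoint_mem_tube {Ω : Set (RSpace n)} {x y : RSpace n} :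
    complexPoint x y ∈ tube Ω ↔ y ∈ Ω := Iff.rfl

theorem zeroExtend_complexPoint {Ω : Set (RSpace n)} (F : tube Ω → ℂ) (x : RSpace n) (y : Ω) :
    zeroExtend F (complexPoint x y) = F (tubePoint x y) :=
  zeroExtend_coe F (tubePoint x y)

theorem complexPoint_add (x y x' y' : RSpace n) :
    complexPoint (x + x') (y + y') = complexPoint x y + complexPoint x' y' := by
  ext j
  simp only [complexPoint_apply, PiLp.add_apply, ofReal_add]
  ring

/-- The real part of a point of `ℂⁿ`. -/
def rePart (z : CSpace n) : RSpace n := WithLp.toLp 2 fun j => (z j).re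

/-- The imaginary part of a point of `ℂⁿ`. -/
def imPart (z : CSpace n) : RSpace n := WithLp.toLp 2 fun j => (z j).im

theorem mem_tube {Ω : Set (RSpace n)} {z : CSpace n} : z ∈ tube Ω ↔ imPart z ∈ Ω := Iff.rfl

theorem complexPoint_re_im (z : CSpace n) : complexPoint (rePart z) (imPart z) = z := rfl

theorem imPart_complexPoint (x y : RSpace n) : imPart (complexPoint x y) = y := rfl

theorem continuous_imPart : Continuous (imPart : CSpace n → RSpace n) :=
  (PiLp.continuous_toLp 2 _).comp (continuous_pi fun j => by fun_prop)

theorem continuous_complexPoint : Continuous fun p : RSpace n × RSpace n =>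
    complexPoint p.1 p.2 := by
  refine (PiLp.continuous_toLp 2 _).comp (continuous_pi fun j => ?_)
  have h : (fun p : RSpace n × RSpace n => (⟨p.1 j, p.2 j⟩ : ℂ)) =
      fun p => ((p.1 j : ℝ) : ℂ) + ((p.2 j : ℝ) : ℂ) * I := by
    funext p
    exact Complex.mk_eq_add_mul_I _ _
  rw [h]
  fun_prop

theorem norm_sq_complexPoint (x y : RSpace n) :
    ‖complexPoint x y‖ ^ 2 = ‖x‖ ^ 2 + ‖y‖ ^ 2 := by
  simp only [EuclideanSpace.norm_sq_eq, ← Finset.sum_add_distrib]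
  refine Finset.sum_congr rfl fun j _ => ?_
  rw [← Complex.normSq_eq_norm_sq, Complex.normSq_apply]
  simp only [complexPoint, Real.norm_eq_abs, sq_abs]
  ring

theorem norm_left_le_complexPoint (x y : RSpace n) : ‖x‖ ≤ ‖complexPoint x y‖ := by
  refine le_of_sq_le_sq ?_ (norm_nonneg _)
  rw [norm_sq_complexPoint]
  nlinarith [sq_nonneg ‖y‖]

theorem norm_right_le_complexPoint (x y : RSpace n) : ‖y‖ ≤ ‖complexPoint x y‖ := by
  refine le_of_sq_le_sq ?_ (norm_nonneg _)
  rw [norm_sq_complexPoint]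
  nlinarith [sq_nonneg ‖x‖]

theorem isOpen_tube {Ω : Set (RSpace n)} (hΩ : IsOpen Ω) : IsOpen (tube Ω) :=
  hΩ.preimage continuous_imPart

/-- Multiplication by `e^{iθ}` on `V × V`. -/
noncomputable def complexRotation (θ : ℝ) : RSpace n × RSpace n →ₗ[ℝ] RSpace n × RSpace n :=
  LinearMap.prod
    (Real.cos θ • LinearMap.fst ℝ (RSpace n) (RSpace n) -
      Real.sin θ • LinearMap.snd ℝ (RSpace n) (RSpace n))
    (Real.sin θ • LinearMap.fst ℝ (RSpace n) (RSpace n) +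
      Real.cos θ • LinearMap.snd ℝ (RSpace n) (RSpace n))

theorem complexRotation_apply (θ : ℝ) (p : RSpace n × RSpace n) : complexRotation θ p =
    (Real.cos θ • p.1 - Real.sin θ • p.2, Real.sin θ • p.1 + Real.cos θ • p.2) := rfl

theorem complexPoint_complexRotation (θ : ℝ) (p : RSpace n × RSpace n) :
    complexPoint (complexRotation θ p).1 (complexRotation θ p).2 = exp (θ * I) • complexPoint p.1 p.2 := by
  ext j
  rw [complexRotation_apply, PiLp.smul_apply, complexPoint_apply, complexPoint_apply, exp_mul_I,
    smul_eq_mul]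
  simp only [PiLp.sub_apply, PiLp.add_apply, PiLp.smul_apply, smul_eq_mul, ofReal_sub, ofReal_add,
    ofReal_mul, ofReal_cos, ofReal_sin]
  linear_combination (-(sin θ : ℂ) * p.2 j) * I_sq

/-- The balls of `ℂⁿ`, in real coordinates. -/
def complexBall (n : ℕ) (ρ : ℝ) : Set (RSpace n × RSpace n) := {p | ‖complexPoint p.1 p.2‖ < ρ}

theorem isOpen_complexBall (ρ : ℝ) : IsOpen (complexBall n ρ) :=
  isOpen_lt continuous_complexPoint.norm continuous_const

theorem complexBall_subset (ρ : ℝ) :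
    complexBall n ρ ⊆ Metric.ball 0 ρ ×ˢ Metric.ball 0 ρ := fun p hp => by
  simp only [Set.mem_prod, mem_ball_zero_iff]
  exact ⟨(norm_left_le_complexPoint _ _).trans_lt hp, (norm_right_le_complexPoint _ _).trans_lt hp⟩

theorem volume_complexBall_lt_top (ρ : ℝ) : volume (complexBall n ρ) < ∞ := by
  refine (measure_mono (complexBall_subset ρ)).trans_lt ?_
  rw [Measure.volume_eq_prod, Measure.prod_prod]
  exact ENNReal.mul_lt_top measure_ball_lt_top measure_ball_lt_top

theorem volume_complexBall_pos {ρ : ℝ} (hρ : 0 < ρ) : 0 < volume (complexBall n ρ) := by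
  refine (isOpen_complexBall ρ).measure_pos _ ⟨0, ?_⟩
  have h : ‖complexPoint (0 : RSpace n) 0‖ ^ 2 = 0 := by simp [norm_sq_complexPoint]
  have h' : ‖complexPoint (0 : RSpace n) 0‖ = 0 := by simpa using h
  change ‖complexPoint (0 : RSpace n) 0‖ < ρ
  rwa [h']

theorem complexRotation_mem_complexBall (θ ρ : ℝ) (p : RSpace n × RSpace n) :
    complexRotation θ p ∈ complexBall n ρ ↔ p ∈ complexBall n ρ := by
  change ‖complexPoint (complexRotation θ p).1 (complexRotation θ p).2‖ < ρ ↔ ‖complexPoint p.1 p.2‖ < ρ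
  rw [complexPoint_complexRotation, norm_smul, Complex.norm_exp_ofReal_mul_I, one_mul]

/-- An invertible linear map scales Haar measure by a constant; the constant is `1` because a ball
of finite positive volume is preserved. -/
theorem measurePreserving_complexRotation (θ : ℝ) :
    MeasurePreserving (complexRotation θ : RSpace n × RSpace n → RSpace n × RSpace n) := by
  have : (volume : Measure (RSpace n × RSpace n)).IsAddHaarMeasure :=
    Measure.prod.instIsAddHaarMeasure volume volume
  have hc : Continuous (complexRotation θ : RSpace n × RSpace n → RSpace n × RSpace n) :=
    LinearMap.continuous_of_finiteDimensional _
  have hdet : LinearMap.det (complexRotation θ : RSpace n × RSpace n →ₗ[ℝ] _) ≠ 0 := by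
    have h : (complexRotation (-θ) : RSpace n × RSpace n →ₗ[ℝ] _) ∘ₗ complexRotation θ = LinearMap.id := by
      refine LinearMap.ext fun p => ?_
      have hs := Real.sin_sq_add_cos_sq θ
      rw [LinearMap.comp_apply, complexRotation_apply, complexRotation_apply, Real.cos_neg, Real.sin_neg,
        LinearMap.id_apply]
      refine Prod.ext ?_ ?_
      · simp only [smul_sub, smul_add, smul_smul]
        refine Eq.trans (b := (Real.sin θ ^ 2 + Real.cos θ ^ 2) • p.1) (by module) ?_
        rw [hs, one_smul]
      · simp only [smul_sub, smul_add, smul_smul]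
        refine Eq.trans (b := (Real.sin θ ^ 2 + Real.cos θ ^ 2) • p.2) (by module) ?_
        rw [hs, one_smul]
    intro h0
    have := congrArg LinearMap.det h
    rw [LinearMap.det_comp, h0, mul_zero, LinearMap.det_id] at this
    exact zero_ne_one this
  refine ⟨hc.measurable, ?_⟩
  rw [Measure.map_linearMap_addHaar_eq_smul_addHaar _ hdet]
  have h1 := Measure.addHaar_preimage_linearMap (volume : Measure (RSpace n × RSpace n)) hdet
    (complexBall n 1)
  have h2 : (complexRotation θ : RSpace n × RSpace n → _) ⁻¹' complexBall n 1 = complexBall n 1 :=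
    Set.ext fun p => complexRotation_mem_complexBall θ 1 p
  rw [h2] at h1
  have h3 : ENNReal.ofReal |(LinearMap.det (complexRotation θ : RSpace n × RSpace n →ₗ[ℝ] _))⁻¹| = 1 := by
    have := (ENNReal.mul_left_inj (volume_complexBall_pos (n := n) one_pos).ne'
      (volume_complexBall_lt_top (n := n) 1).ne).1 (h1.symm.trans (one_mul _).symm)
    exact this
  rw [h3, one_smul]

theorem enorm_le_lintegral_circle {φ : ℂ → ℂ} {U : Set ℂ} (hφ : DifferentiableOn ℂ φ U)
    (hsub : Metric.closedBall 0 1 ⊆ U) :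
    ‖φ 0‖ₑ ≤ ENNReal.ofReal (2 * Real.pi)⁻¹ *
      ∫⁻ θ in Set.Ioc 0 (2 * Real.pi), ‖φ (exp (θ * I))‖ₑ := by
  have hd : DiffContOnCl ℂ φ (Metric.ball 0 |1|) := by
    rw [abs_one]
    refine (hφ.mono ?_).diffContOnCl
    rwa [closure_ball _ one_ne_zero]
  rw [← hd.circleAverage, Real.circleAverage_def, enorm_smul,
    intervalIntegral.integral_of_le (by positivity)]
  simp only [circleMap, zero_add, ofReal_one, one_mul]
  gcongr
  · rw [Real.enorm_of_nonneg (by positivity)]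
  · exact enorm_integral_le_lintegral_enorm _

/-- Average over the circle `e^{iθ}p` for each `p` in the ball, then integrate over `p`; invariance
of ball and measure under rotation removes `θ`. -/
theorem enorm_mul_volume_complexBall_le {F : CSpace n → ℂ} {U : Set (CSpace n)}
    (hF : DifferentiableOn ℂ F U) (hFm : Measurable F) {ρ : ℝ} {x y : RSpace n}
    (hsub : ∀ p ∈ complexBall n ρ, complexPoint (x + p.1) (y + p.2) ∈ U) :
    ‖F (complexPoint x y)‖ₑ * volume (complexBall n ρ) ≤
      ∫⁻ p in complexBall n ρ, ‖F (complexPoint (x + p.1) (y + p.2))‖ₑ := by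
  set D := complexBall n ρ
  have hD : MeasurableSet D := (isOpen_complexBall ρ).measurableSet
  set Φ : RSpace n × RSpace n → ℝ≥0∞ :=
    D.indicator fun p => ‖F (complexPoint (x + p.1) (y + p.2))‖ₑ
  have hΦ : Measurable Φ := by
    refine Measurable.indicator ?_ hD
    refine (hFm.comp ?_).enorm
    exact (continuous_complexPoint.comp (by fun_prop :
      Continuous fun p : RSpace n × RSpace n => (x + p.1, y + p.2))).measurable
  have hrot : Continuous fun q : (RSpace n × RSpace n) × ℝ => complexRotation q.2 q.1 := by
    simp only [complexRotation_apply]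
    fun_prop
  have hpt : ∀ p ∈ D, ‖F (complexPoint x y)‖ₑ ≤ ENNReal.ofReal (2 * Real.pi)⁻¹ *
      ∫⁻ θ in Set.Ioc 0 (2 * Real.pi), Φ (complexRotation θ p) := by
    intro p hp
    set ψ : ℂ → CSpace n := fun w => complexPoint x y + w • complexPoint p.1 p.2
    have hψ : Differentiable ℂ ψ := by fun_prop
    have h0 := enorm_le_lintegral_circle (φ := F ∘ ψ) (U := ψ ⁻¹' U)
      (hF.comp hψ.differentiableOn (Set.mapsTo_preimage _ _))
      (fun w hw => by
        rw [mem_closedBall_zero_iff] at hw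
        have h1 : w • complexPoint p.1 p.2 = complexPoint (rePart (w • complexPoint p.1 p.2))
          (imPart (w • complexPoint p.1 p.2)) := rfl
        change complexPoint x y + w • complexPoint p.1 p.2 ∈ U
        rw [h1, ← complexPoint_add]
        refine hsub (rePart (w • complexPoint p.1 p.2), imPart (w • complexPoint p.1 p.2)) ?_
        change ‖w • complexPoint p.1 p.2‖ < ρ
        rw [norm_smul]
        exact (mul_le_of_le_one_left (norm_nonneg _) hw).trans_lt hp)
    have h1 : (F ∘ ψ) 0 = F (complexPoint x y) := by simp [ψ]
    rw [h1] at h0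
    refine h0.trans_eq ?_
    congr 1
    refine lintegral_congr fun θ => ?_
    have h2 : complexRotation θ p ∈ D := (complexRotation_mem_complexBall θ ρ p).2 hp
    simp only [Φ, Set.indicator_of_mem h2, complexPoint_add, complexPoint_complexRotation]
    rfl
  have hinner : ∀ θ : ℝ, ∫⁻ p in D, Φ (complexRotation θ p) = ∫⁻ p, Φ p := fun θ => by
    rw [← (measurePreserving_complexRotation (n := n) θ).lintegral_comp hΦ]
    refine setLIntegral_eq_of_support_subset ?_
    intro p hp
    by_contra h
    refine hp ?_
    have : complexRotation θ p ∉ D := fun h' => h ((complexRotation_mem_complexBall θ ρ p).1 h')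
    exact Set.indicator_of_notMem this _
  calc ‖F (complexPoint x y)‖ₑ * volume D = ∫⁻ p in D, ‖F (complexPoint x y)‖ₑ := by
        rw [setLIntegral_const]
    _ ≤ ∫⁻ p in D, ENNReal.ofReal (2 * Real.pi)⁻¹ *
          ∫⁻ θ in Set.Ioc 0 (2 * Real.pi), Φ (complexRotation θ p) := setLIntegral_mono' hD hpt
    _ = ENNReal.ofReal (2 * Real.pi)⁻¹ *
          ∫⁻ p in D, ∫⁻ θ in Set.Ioc 0 (2 * Real.pi), Φ (complexRotation θ p) :=
        lintegral_const_mul' _ _ ENNReal.ofReal_ne_top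
    _ = ENNReal.ofReal (2 * Real.pi)⁻¹ *
          ∫⁻ θ in Set.Ioc 0 (2 * Real.pi), ∫⁻ p in D, Φ (complexRotation θ p) := by
        rw [lintegral_lintegral_swap]
        exact (hΦ.comp hrot.measurable).aemeasurable
    _ = ∫⁻ p, Φ p := by
        simp only [hinner, setLIntegral_const, Real.volume_Ioc, sub_zero]
        rw [mul_comm (∫⁻ p, Φ p), ← mul_assoc, ← ENNReal.ofReal_mul (by positivity),
          inv_mul_cancel₀ (by positivity), ENNReal.ofReal_one, one_mul]
    _ = _ := lintegral_indicator hD _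

theorem enorm_sq_mul_volume_complexBall_le {F : CSpace n → ℂ} {U : Set (CSpace n)}
    (hF : DifferentiableOn ℂ F U) (hFm : Measurable F) {ρ : ℝ} {x y : RSpace n}
    (hsub : ∀ p ∈ complexBall n ρ, complexPoint (x + p.1) (y + p.2) ∈ U) :
    ‖F (complexPoint x y)‖ₑ ^ 2 * volume (complexBall n ρ) ≤
      ∫⁻ a in Metric.ball 0 ρ, ∫⁻ b in Metric.ball 0 ρ,
        ‖F (complexPoint (x + a) (y + b))‖ₑ ^ 2 := by
  have h := enorm_mul_volume_complexBall_le (hF.pow 2) (hFm.pow_const 2) hsub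
  simp only [Pi.pow_apply, enorm_pow] at h
  refine h.trans ((lintegral_mono_set (complexBall_subset ρ)).trans_eq ?_)
  rw [Measure.volume_eq_prod, ← Measure.prod_restrict, lintegral_prod]
  refine Measurable.aemeasurable ?_
  refine ((hFm.comp ?_).enorm).pow_const 2
  exact (continuous_complexPoint.comp (by fun_prop :
      Continuous fun p : RSpace n × RSpace n => (x + p.1, y + p.2))).measurable

end MeanValue

/-! ### Uniform bounds, slices and change of contour on tubes -/

section LocalEstimates

open Complex Filter Topology

variable {n : ℕ}

theorem eLpNorm_two_sq {α : Type*} [MeasurableSpace α] {μ : Measure α} (f : α → ℂ) :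
    eLpNorm f 2 μ ^ 2 = ∫⁻ x, ‖f x‖ₑ ^ 2 ∂μ := by
  have h := eLpNorm_nnreal_pow_eq_lintegral (f := f) (μ := μ) (p := 2) two_ne_zero
  simpa using h

theorem memLp_two_of_lintegral {α : Type*} [MeasurableSpace α] {μ : Measure α} {f : α → ℂ}
    (hf : AEStronglyMeasurable f μ) (h : ∫⁻ x, ‖f x‖ₑ ^ 2 ∂μ < ∞) : MemLp f 2 μ := by
  refine ⟨hf, ?_⟩
  rw [← eLpNorm_two_sq] at h
  exact (ENNReal.pow_lt_top_iff.1 h).resolve_right two_ne_zero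

/-- Holomorphic functions on a tube that are square integrable over `V × K` for every compact
subset `K` of the base. -/
structure IsLocallyHardy (Ω : Set (RSpace n)) (F : CSpace n → ℂ) : Prop where
  measurable : Measurable F
  differentiableOn : DifferentiableOn ℂ F (tube Ω)
  lintegral_lt_top : ∀ K ⊆ Ω, IsCompact K → ∫⁻ y in K, ∫⁻ x, ‖F (complexPoint x y)‖ₑ ^ 2 < ∞

namespace IsLocallyHardy

variable {Ω : Set (RSpace n)} {F : CSpace n → ℂ}

theorem measurable_slice (hF : IsLocallyHardy Ω F) (y : RSpace n) :
    Measurable fun x => F (complexPoint x y) :=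
  hF.measurable.comp (continuous_complexPoint.comp
    (by fun_prop : Continuous fun x : RSpace n => (x, y))).measurable

theorem measurable_comp (hF : IsLocallyHardy Ω F) {α : Type*} [MeasurableSpace α]
    {f g : α → RSpace n} (hf : Measurable f) (hg : Measurable g) :
    Measurable fun a => ‖F (complexPoint (f a) (g a))‖ₑ ^ 2 :=
  Measurable.pow_const (Measurable.enorm (hF.measurable.comp
    (continuous_complexPoint.measurable.comp (hf.prodMk hg)))) 2

theorem measurable_shift (hF : IsLocallyHardy Ω F) (x y : RSpace n) :
    Measurable fun p : RSpace n × RSpace n => ‖F (complexPoint (x + p.1) (y + p.2))‖ₑ ^ 2 :=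
  hF.measurable_comp (measurable_fst.const_add x) (measurable_snd.const_add y)

theorem exists_radius (hF : IsLocallyHardy Ω F) (hΩ : IsOpen Ω) {K : Set (RSpace n)}
    (hK : IsCompact K) (hKΩ : K ⊆ Ω) :
    ∃ (ρ : ℝ) (M : ℝ≥0∞), 0 < ρ ∧ M < ∞ ∧ (∀ y ∈ K, ∀ b ∈ Metric.ball 0 ρ, y + b ∈ Ω) ∧
      ∀ y ∈ K, ∫⁻ b in Metric.ball 0 ρ, ∫⁻ x, ‖F (complexPoint x (y + b))‖ₑ ^ 2 ≤ M := by
  obtain ⟨ρ, hρ, hsub⟩ := hK.exists_cthickening_subset_open hΩ hKΩ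
  have hmem : ∀ y ∈ K, ∀ b ∈ Metric.ball (0 : RSpace n) ρ, y + b ∈ Metric.cthickening ρ K :=
    fun y hy b hb => Metric.mem_cthickening_of_dist_le _ y _ _ hy (by
      rw [mem_ball_zero_iff] at hb
      simpa using hb.le)
  refine ⟨ρ, _, hρ, hF.lintegral_lt_top _ hsub hK.cthickening,
    fun y hy b hb => hsub (hmem y hy b hb), fun y hy => ?_⟩
  set g : RSpace n → ℝ≥0∞ := fun y => ∫⁻ x, ‖F (complexPoint x y)‖ₑ ^ 2
  calc ∫⁻ b in Metric.ball 0 ρ, g (y + b)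
      ≤ ∫⁻ b, (Metric.cthickening ρ K).indicator g (y + b) := by
        rw [← lintegral_indicator measurableSet_ball]
        refine lintegral_mono fun b => ?_
        by_cases hb : b ∈ Metric.ball (0 : RSpace n) ρ
        · rw [Set.indicator_of_mem hb, Set.indicator_of_mem (hmem y hy b hb)]
        · rw [Set.indicator_of_notMem hb]
          exact zero_le
    _ = ∫⁻ b, (Metric.cthickening ρ K).indicator g b := lintegral_add_left_eq_self _ y
    _ = _ := lintegral_indicator Metric.isClosed_cthickening.measurableSet _

/-- The mean value inequality on balls of a fixed radius; enlarging the integral in the real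
direction to all of `V` makes the bound uniform in `x`. -/
theorem exists_bound (hF : IsLocallyHardy Ω F) (hΩ : IsOpen Ω) {K : Set (RSpace n)}
    (hK : IsCompact K) (hKΩ : K ⊆ Ω) :
    ∃ C : ℝ, 0 ≤ C ∧ ∀ y ∈ K, ∀ x, ‖F (complexPoint x y)‖ ≤ C := by
  obtain ⟨ρ, M, hρ, hM, hΩ', hb⟩ := hF.exists_radius hΩ hK hKΩ
  have hv := volume_complexBall_pos (n := n) hρ
  have hv' := volume_complexBall_lt_top (n := n) ρ
  have hfin : M / volume (complexBall n ρ) < ∞ := ENNReal.div_lt_top hM.ne hv.ne'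
  refine ⟨√(M / volume (complexBall n ρ)).toReal, Real.sqrt_nonneg _, fun y hy x => ?_⟩
  have h1 := enorm_sq_mul_volume_complexBall_le hF.differentiableOn hF.measurable (ρ := ρ)
    (x := x) (y := y) fun p hp => hΩ' y hy p.2 (complexBall_subset ρ hp).2
  have h2 : ∫⁻ a in Metric.ball 0 ρ, ∫⁻ b in Metric.ball 0 ρ,
      ‖F (complexPoint (x + a) (y + b))‖ₑ ^ 2 ≤ M := by
    rw [lintegral_lintegral_swap (hF.measurable_shift x y).aemeasurable]
    refine (lintegral_mono fun b => ?_).trans (hb y hy)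
    refine (setLIntegral_le_lintegral _ _).trans_eq ?_
    exact lintegral_add_left_eq_self (fun a => ‖F (complexPoint a (y + b))‖ₑ ^ 2) x
  have h3 : ‖F (complexPoint x y)‖ₑ ^ 2 ≤ M / volume (complexBall n ρ) :=
    (ENNReal.le_div_iff_mul_le (Or.inl hv.ne') (Or.inl hv'.ne)).2 (h1.trans h2)
  refine Real.le_sqrt_of_sq_le ?_
  have h4 := ENNReal.toReal_mono hfin.ne h3
  simpa using h4

/-- Integrate the mean value inequality over `x`. This gives finiteness for every `y`, where Tonelli
alone would give almost every `y`. -/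
theorem lintegral_slice_lt_top (hF : IsLocallyHardy Ω F) (hΩ : IsOpen Ω) {y : RSpace n}
    (hy : y ∈ Ω) : ∫⁻ x, ‖F (complexPoint x y)‖ₑ ^ 2 < ∞ := by
  obtain ⟨ρ, M, hρ, hM, hΩ', hb⟩ := hF.exists_radius hΩ (isCompact_singleton (x := y))
    (Set.singleton_subset_iff.2 hy)
  have hv := volume_complexBall_pos (n := n) hρ
  have hv' := volume_complexBall_lt_top (n := n) ρ
  have h1 : (∫⁻ x, ‖F (complexPoint x y)‖ₑ ^ 2) * volume (complexBall n ρ) ≤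
      volume (Metric.ball (0 : RSpace n) ρ) * M := by
    rw [← lintegral_mul_const' _ _ hv'.ne]
    refine (lintegral_mono fun x => enorm_sq_mul_volume_complexBall_le hF.differentiableOn
      hF.measurable fun p hp => hΩ' y rfl p.2 (complexBall_subset ρ hp).2).trans ?_
    have hm1 : Measurable fun q : (RSpace n × RSpace n) × RSpace n =>
        ‖F (complexPoint (q.1.1 + q.1.2) (y + q.2))‖ₑ ^ 2 :=
      hF.measurable_comp (measurable_fst.fst.add measurable_fst.snd) (measurable_snd.const_add y)
    rw [lintegral_lintegral_swap (Measurable.aemeasurable (hm1.lintegral_prod_right'))]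
    have hm2 : ∀ a : RSpace n, Measurable fun q : RSpace n × RSpace n =>
        ‖F (complexPoint (q.1 + a) (y + q.2))‖ₑ ^ 2 := fun a =>
      hF.measurable_comp (measurable_fst.add_const a) (measurable_snd.const_add y)
    calc ∫⁻ a in Metric.ball 0 ρ, ∫⁻ x, ∫⁻ b in Metric.ball 0 ρ,
          ‖F (complexPoint (x + a) (y + b))‖ₑ ^ 2
        ≤ ∫⁻ _ in Metric.ball (0 : RSpace n) ρ, M := by
          refine lintegral_mono fun a => ?_
          rw [lintegral_lintegral_swap (hm2 a).aemeasurable]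
          refine (lintegral_mono fun b => ?_).trans (hb y rfl)
          exact (lintegral_add_right_eq_self
            (fun x => ‖F (complexPoint x (y + b))‖ₑ ^ 2) a).le
      _ = volume (Metric.ball (0 : RSpace n) ρ) * M := by rw [setLIntegral_const, mul_comm]
  have h2 := h1.trans_lt (ENNReal.mul_lt_top measure_ball_lt_top hM)
  by_contra h
  rw [not_lt, top_le_iff] at h
  rw [h, ENNReal.top_mul hv.ne'] at h2
  exact lt_irrefl _ h2

theorem memLp_slice (hF : IsLocallyHardy Ω F) (hΩ : IsOpen Ω) {y : RSpace n} (hy : y ∈ Ω) :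
    MemLp (fun x => F (complexPoint x y)) 2 :=
  memLp_two_of_lintegral (hF.measurable_slice y).aestronglyMeasurable
    (hF.lintegral_slice_lt_top hΩ hy)

end IsLocallyHardy

theorem integrable_exp_neg_mul_norm_sq {c : ℝ} (hc : 0 < c) :
    Integrable fun x : RSpace n => Real.exp (-c * ‖x‖ ^ 2) := by
  have h := (GaussianFourier.integrable_cexp_neg_mul_sq_norm_add (V := RSpace n) (b := (c : ℂ))
    (by simpa using hc) 0 0).norm
  refine h.congr (Eventually.of_forall fun x => ?_)
  simp only [Complex.norm_exp]
  congr 1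
  simp [← ofReal_pow, ← ofReal_neg, ← ofReal_mul]

/-- The integral over `V + iy` of a holomorphic function with Gaussian decay does not depend on
`y`. -/
theorem integral_complexPoint_eq {Ω : Set (RSpace n)} (hΩ : IsOpen Ω) (hconv : Convex ℝ Ω)
    {H : CSpace n → ℂ} (hH : DifferentiableOn ℂ H (tube Ω)) (hHm : Measurable H) {c : ℝ}
    (hc : 0 < c)
    (hbd : ∀ K ⊆ Ω, IsCompact K → ∃ C : ℝ, 0 ≤ C ∧
      ∀ y ∈ K, ∀ x, ‖H (complexPoint x y)‖ ≤ C * Real.exp (-c * ‖x‖ ^ 2))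
    {y₁ y₂ : RSpace n} (hy₁ : y₁ ∈ Ω) (hy₂ : y₂ ∈ Ω) :
    ∫ x, H (complexPoint x y₁) = ∫ x, H (complexPoint x y₂) := by
  set v := y₂ - y₁
  set W : Set ℂ := {w | y₁ + w.im • v ∈ Ω}
  have hcontW : Continuous fun w : ℂ => y₁ + w.im • v := by fun_prop
  have hW : IsOpen W := hΩ.preimage hcontW
  have hWc : Convex ℝ W := by
    intro a ha b hb s t hs ht hst
    have h := hconv ha hb hs ht hst
    change y₁ + (s • a + t • b).im • v ∈ Ω
    convert h using 1
    rw [show y₁ = (s + t) • y₁ by rw [hst, one_smul]]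
    simp only [add_im, smul_im, smul_eq_mul, hst, one_smul]
    rw [show y₁ + (s * a.im + t * b.im) • v = (s + t) • y₁ + (s * a.im + t * b.im) • v by
      rw [hst, one_smul]]
    module
  have hpt : ∀ (x : RSpace n) (w : ℂ), complexPoint x y₁ + w • complexPoint v 0 =
      complexPoint (x + w.re • v) (y₁ + w.im • v) := fun x w => by
    rw [complexPoint_add]
    congr 1
    ext j
    simp only [PiLp.smul_apply, complexPoint_apply, smul_eq_mul, ofReal_mul, PiLp.zero_apply,
      ofReal_zero, zero_mul, add_zero]
    conv_lhs => rw [← re_add_im w]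
    ring
  -- The integral `k(w)` over `V + iy₁ + wv` is holomorphic in `w`. By translation invariance it
  -- depends only on `Im w`, so its derivative is zero; compare `w = 0` and `w = i`.
  set h : ℂ → RSpace n → ℂ := fun w x => H (complexPoint x y₁ + w • complexPoint v 0)
  set k : ℂ → ℂ := fun w => ∫ x, h w x
  have hk : ∀ w, k w = ∫ x, H (complexPoint x (y₁ + w.im • v)) := fun w => by
    simp only [k, h, hpt]
    exact integral_add_right_eq_self (fun x => H (complexPoint x (y₁ + w.im • v))) (w.re • v)
  have hψ : ∀ x : RSpace n, Differentiable ℂ fun w : ℂ =>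
      complexPoint x y₁ + w • complexPoint v 0 := fun x => by fun_prop
  have hd : ∀ x, DifferentiableOn ℂ (fun w => h w x) W := fun x =>
    hH.comp (hψ x).differentiableOn fun w hw => by
      rw [hpt]
      exact hw
  have hhm : ∀ w, Measurable (h w) := fun w => hHm.comp (((continuous_complexPoint.comp
    (by fun_prop : Continuous fun x : RSpace n => (x, y₁))).add_const _).measurable)
  have hderiv : ∀ w₀ ∈ W, DifferentiableAt ℂ k w₀ := by
    intro w₀ hw₀
    obtain ⟨ρ', hρ', hsub'⟩ := Metric.isOpen_iff.1 hW w₀ hw₀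
    obtain ⟨ρ, hρ, hρρ⟩ : ∃ ρ : ℝ, 0 < ρ ∧ 2 * ρ < ρ' := ⟨ρ' / 4, by linarith, by linarith⟩
    have hsub : Metric.closedBall w₀ (2 * ρ) ⊆ W :=
      (Metric.closedBall_subset_ball hρρ).trans hsub'
    obtain ⟨C, hC, hCb⟩ := hbd ((fun w : ℂ => y₁ + w.im • v) '' Metric.closedBall w₀ (2 * ρ))
      (Set.image_subset_iff.2 hsub) ((isCompact_closedBall _ _).image hcontW)
    set R := (‖w₀‖ + 2 * ρ) * ‖v‖
    -- `R` bounds the real shift, and `‖x‖² ≤ 2‖x + Re(w)v‖² + 2R²` costs half of the Gaussian rate.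
    -- Cauchy's estimate on radius `ρ` passes the bound to the derivative.
    set B : RSpace n → ℝ := fun x => C * (Real.exp (c * R ^ 2) * Real.exp (-(c / 2) * ‖x‖ ^ 2))
    have hB : Integrable B :=
      ((integrable_exp_neg_mul_norm_sq (half_pos hc)).const_mul _).const_mul _
    have hhB : ∀ w ∈ Metric.closedBall w₀ (2 * ρ), ∀ x, ‖h w x‖ ≤ B x := by
      intro w hw x
      simp only [h, hpt]
      refine (hCb _ ⟨w, hw, rfl⟩ _).trans (mul_le_mul_of_nonneg_left ?_ hC)
      rw [← Real.exp_add, Real.exp_le_exp]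
      have hwn : ‖w‖ ≤ ‖w₀‖ + 2 * ρ := by
        rw [mem_closedBall_iff_norm] at hw
        have := norm_le_norm_add_norm_sub' w w₀
        linarith
      have h1 : ‖w.re • v‖ ≤ R := by
        rw [norm_smul]
        exact mul_le_mul_of_nonneg_right ((Complex.abs_re_le_norm w).trans hwn) (norm_nonneg _)
      have h2 : ‖x‖ ≤ ‖x + w.re • v‖ + ‖w.re • v‖ := by
        have := norm_sub_le (x + w.re • v) (w.re • v)
        rwa [add_sub_cancel_right] at this
      have h3 : ‖x‖ ^ 2 ≤ 2 * ‖x + w.re • v‖ ^ 2 + 2 * R ^ 2 := by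
        have h4 : ‖x‖ ≤ ‖x + w.re • v‖ + R := h2.trans (by linarith)
        have h5 : ‖x‖ ^ 2 ≤ (‖x + w.re • v‖ + R) ^ 2 :=
          pow_le_pow_left₀ (norm_nonneg _) h4 2
        nlinarith [sq_nonneg (‖x + w.re • v‖ - R)]
      nlinarith
    refine (hasDerivAt_integral_of_dominated_loc_of_deriv_le (F := h)
      (F' := fun w x => deriv (fun w => h w x) w) (bound := fun x => B x / ρ)
      (Metric.ball_mem_nhds w₀ hρ) (Eventually.of_forall fun w => (hhm w).aestronglyMeasurable)
      (hB.mono' (hhm w₀).aestronglyMeasurable (Eventually.of_forall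
        (hhB w₀ (Metric.mem_closedBall_self (by linarith))))) ?_
      (Eventually.of_forall fun x w hw => ?_) (hB.div_const _)
      (Eventually.of_forall fun x w hw => ?_)).2.differentiableAt
    · have he : (fun x => deriv (fun w => h w x) w₀) = fun x =>
          fderiv ℂ H (complexPoint x y₁ + w₀ • complexPoint v 0) (complexPoint v 0) := by
        funext x
        have hz : complexPoint x y₁ + w₀ • complexPoint v 0 ∈ tube Ω := by rw [hpt]; exact hw₀
        have h1 := (hH.differentiableAt ((isOpen_tube hΩ).mem_nhds hz)).hasFDerivAt
        have h2 : HasDerivAt (fun w : ℂ => complexPoint x y₁ + w • complexPoint v 0)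
            (complexPoint v 0) w₀ := by
          simpa using ((hasDerivAt_id w₀).smul_const (complexPoint v 0)).const_add
            (complexPoint x y₁)
        exact (h1.comp_hasDerivAt w₀ h2).deriv
      rw [he]
      exact ((measurable_fderiv_apply_const ℂ H (complexPoint v 0)).comp
        (((continuous_complexPoint.comp (by fun_prop : Continuous fun x : RSpace n =>
          (x, y₁))).add_const _).measurable)).aestronglyMeasurable
    · have hsubw : Metric.closedBall w ρ ⊆ Metric.closedBall w₀ (2 * ρ) := by
        refine Metric.closedBall_subset_closedBall' ?_
        have := Metric.mem_ball.1 hw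
        linarith
      refine Complex.norm_deriv_le_of_forall_mem_sphere_norm_le hρ ?_ fun z hz =>
        hhB z (hsubw (Metric.sphere_subset_closedBall hz)) x
      refine ((hd x).mono ?_).diffContOnCl
      rw [closure_ball _ hρ.ne']
      exact hsubw.trans hsub
    · refine ((hd x).differentiableAt (hW.mem_nhds (hsub ?_))).hasDerivAt
      exact Metric.closedBall_subset_closedBall (by linarith) (Metric.ball_subset_closedBall hw)
  have hzero : ∀ w ∈ W, deriv k w = 0 := by
    intro w hw
    have h1 : HasDerivAt (fun s : ℝ => w + (s : ℂ)) 1 0 := by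
      simpa using (Complex.ofRealCLM.hasDerivAt (x := (0 : ℝ))).const_add w
    have h0 : HasDerivAt k (deriv k w) ((fun s : ℝ => w + (s : ℂ)) 0) := by
      simpa using (hderiv w hw).hasDerivAt
    have h2 := h0.comp_of_eq (0 : ℝ) h1 rfl
    have h3 : (k ∘ fun s : ℝ => w + (s : ℂ)) = fun _ => k w := by
      funext s
      simp [hk]
    rw [h3, mul_one] at h2
    exact h2.unique (hasDerivAt_const _ _)
  have h0 : (0 : ℂ) ∈ W := by simpa [W] using hy₁
  have hI : I ∈ W := by simpa [W, v] using hy₂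
  have h := hW.is_const_of_deriv_eq_zero hWc.isPreconnected
    (fun w hw => (hderiv w hw).differentiableWithinAt) hzero h0 hI
  rw [hk, hk] at h
  simpa [v] using h

end LocalEstimates

/-! ### The common spectrum of the slices -/

section PaleyWiener

open Complex Filter Topology FourierTransform

variable {n : ℕ}

/-- The bilinear pairing `∑ zⱼ ξⱼ` of `ℂⁿ` with `ℝⁿ`. -/
noncomputable def pairing (ξ : RSpace n) : CSpace n →L[ℂ] ℂ :=
  ∑ j, (ξ j : ℂ) • (EuclideanSpace.proj j : CSpace n →L[ℂ] ℂ)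

theorem pairing_apply (ξ : RSpace n) (z : CSpace n) : pairing ξ z = ∑ j, (ξ j : ℂ) * z j := by
  simp [pairing]

theorem pairing_complexPoint (ξ x y : RSpace n) :
    pairing ξ (complexPoint x y) = (inner ℝ x ξ : ℝ) + (inner ℝ y ξ : ℝ) * I := by
  simp only [pairing_apply, complexPoint_apply, PiLp.inner_apply, RCLike.inner_apply, conj_trivial,
    ofReal_sum, ofReal_mul, Finset.sum_mul, ← Finset.sum_add_distrib]
  exact Finset.sum_congr rfl fun j _ => by ring

/-- The quadratic form `∑ zⱼ²` on `ℂⁿ`. -/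
def sumSq (z : CSpace n) : ℂ := ∑ j, z j ^ 2

theorem differentiable_sumSq : Differentiable ℂ (sumSq : CSpace n → ℂ) := by
  have h : ∀ j : Fin n, Differentiable ℂ fun z : CSpace n => z j := fun j =>
    (EuclideanSpace.proj j : CSpace n →L[ℂ] ℂ).differentiable
  have h2 : (sumSq : CSpace n → ℂ) = fun z => ∑ j, z j ^ 2 := rfl
  rw [h2]
  exact Differentiable.fun_sum fun j _ => (h j).pow 2

theorem sumSq_complexPoint_re (x y : RSpace n) :
    (sumSq (complexPoint x y)).re = ‖x‖ ^ 2 - ‖y‖ ^ 2 := by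
  simp only [sumSq, re_sum, EuclideanSpace.norm_sq_eq, ← Finset.sum_sub_distrib]
  refine Finset.sum_congr rfl fun j _ => ?_
  simp only [complexPoint, sq, mul_re, Real.norm_eq_abs, abs_mul_abs_self]

theorem norm_exp_sumSq (ε : ℝ) (x y : RSpace n) :
    ‖exp (-(ε : ℂ) * sumSq (complexPoint x y))‖ =
      Real.exp (ε * ‖y‖ ^ 2) * Real.exp (-ε * ‖x‖ ^ 2) := by
  rw [Complex.norm_exp, ← Real.exp_add, ← ofReal_neg, re_ofReal_mul, sumSq_complexPoint_re]
  congr 1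
  ring

namespace IsLocallyHardy

variable {Ω : Set (RSpace n)} {F : CSpace n → ℂ}

/-- The factor `exp(-ε ∑ zⱼ²)` is entire, has Gaussian decay along `V + iy` and tends to `1` with
`ε`: slices become integrable while holomorphy is kept. -/
theorem integrable_damped (hF : IsLocallyHardy Ω F) (hΩ : IsOpen Ω) {ε : ℝ} (hε : 0 < ε)
    {y : RSpace n} (hy : y ∈ Ω) :
    Integrable fun x => F (complexPoint x y) * exp (-(ε : ℂ) * sumSq (complexPoint x y)) := by
  obtain ⟨C, hC, hb⟩ := hF.exists_bound hΩ (isCompact_singleton (x := y))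
    (Set.singleton_subset_iff.2 hy)
  have hcont : Continuous fun x : RSpace n => complexPoint x y :=
    continuous_complexPoint.comp (by fun_prop : Continuous fun x : RSpace n => (x, y))
  have hcexp : Continuous fun x : RSpace n => exp (-(ε : ℂ) * sumSq (complexPoint x y)) :=
    Complex.continuous_exp.comp
      (continuous_const.mul (differentiable_sumSq.continuous.comp hcont))
  refine ((integrable_exp_neg_mul_norm_sq hε).const_mul (C * Real.exp (ε * ‖y‖ ^ 2))).mono'
    ((hF.measurable_slice y).mul hcexp.measurable).aestronglyMeasurable
    (Eventually.of_forall fun x => ?_)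
  rw [norm_mul, norm_exp_sumSq, ← mul_assoc]
  gcongr
  exact hb y rfl x

theorem memLp_damped (hF : IsLocallyHardy Ω F) (hΩ : IsOpen Ω) {ε : ℝ} (hε : 0 < ε)
    {y : RSpace n} (hy : y ∈ Ω) :
    MemLp (fun x => F (complexPoint x y) * exp (-(ε : ℂ) * sumSq (complexPoint x y))) 2 := by
  refine (hF.memLp_slice hΩ hy).of_le_mul (c := Real.exp (ε * ‖y‖ ^ 2))
    (hF.integrable_damped hΩ hε hy).aestronglyMeasurable (Eventually.of_forall fun x => ?_)
  rw [norm_mul, norm_exp_sumSq, mul_comm]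
  refine mul_le_mul_of_nonneg_right ?_ (norm_nonneg _)
  refine mul_le_of_le_one_right (Real.exp_pos _).le (Real.exp_le_one_iff.2 ?_)
  nlinarith [sq_nonneg ‖x‖]

/-- Each side is the integral over `V + iy` of the damped function times the entire `e^{-2πi⟨z,ξ⟩}`,
so the contour can be moved. -/
theorem exp_mul_fourier_damped_eq (hF : IsLocallyHardy Ω F) (hΩ : IsOpen Ω) (hconv : Convex ℝ Ω)
    {ε : ℝ} (hε : 0 < ε) (ξ : RSpace n) {y₁ y₂ : RSpace n} (hy₁ : y₁ ∈ Ω) (hy₂ : y₂ ∈ Ω) :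
    (Real.exp (2 * Real.pi * inner ℝ y₁ ξ) : ℂ) *
      𝓕 (fun x => F (complexPoint x y₁) * exp (-(ε : ℂ) * sumSq (complexPoint x y₁))) ξ =
    (Real.exp (2 * Real.pi * inner ℝ y₂ ξ) : ℂ) *
      𝓕 (fun x => F (complexPoint x y₂) * exp (-(ε : ℂ) * sumSq (complexPoint x y₂))) ξ := by
  set H : CSpace n → ℂ := fun z =>
    F z * exp (-(ε : ℂ) * sumSq z) * exp (-(2 * Real.pi * I) * pairing ξ z)
  have hexp : ∀ x y : RSpace n, exp (-(2 * Real.pi * I) * pairing ξ (complexPoint x y)) =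
      (Real.exp (2 * Real.pi * inner ℝ y ξ) : ℂ) *
        exp (((-2 * Real.pi * inner ℝ x ξ : ℝ) : ℂ) * I) := fun x y => by
    rw [pairing_complexPoint, ofReal_exp, ← Complex.exp_add]
    congr 1
    push_cast
    linear_combination (-(2 * Real.pi * (inner ℝ y ξ : ℝ)) : ℂ) * I_sq
  have hint : ∀ y : RSpace n, ∫ x, H (complexPoint x y) =
      (Real.exp (2 * Real.pi * inner ℝ y ξ) : ℂ) *
      𝓕 (fun x => F (complexPoint x y) * exp (-(ε : ℂ) * sumSq (complexPoint x y))) ξ :=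
    fun y => by
      rw [Real.fourier_eq', ← integral_const_mul]
      refine integral_congr_ae (Eventually.of_forall fun x => ?_)
      simp only [H, hexp, smul_eq_mul]
      ring
  rw [← hint, ← hint]
  have hd2 : Differentiable ℂ fun z : CSpace n =>
      exp (-(ε : ℂ) * sumSq z) * exp (-(2 * Real.pi * I) * pairing ξ z) :=
    ((differentiable_sumSq.const_mul _).cexp).mul
      (((pairing ξ).differentiable.const_mul _).cexp)
  have hHeq : H = fun z => F z *
      (exp (-(ε : ℂ) * sumSq z) * exp (-(2 * Real.pi * I) * pairing ξ z)) := by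
    funext z
    simp only [H, mul_assoc]
  refine integral_complexPoint_eq hΩ hconv (H := H) ?_ ?_ hε ?_ hy₁ hy₂
  · rw [hHeq]
    exact hF.differentiableOn.mul hd2.differentiableOn
  · rw [hHeq]
    exact hF.measurable.mul hd2.continuous.measurable
  · intro K hKΩ hK
    obtain ⟨C, hC, hb⟩ := hF.exists_bound hΩ hK hKΩ
    obtain ⟨D, hD⟩ := (hK.image (f := fun y : RSpace n => Real.exp (ε * ‖y‖ ^ 2) *
      Real.exp (2 * Real.pi * inner ℝ y ξ)) (by fun_prop)).bddAbove
    refine ⟨C * max D 0, mul_nonneg hC (le_max_right _ _), fun y hy x => ?_⟩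
    have hDy := hD ⟨y, hy, rfl⟩
    simp only [H]
    rw [norm_mul, norm_mul, norm_exp_sumSq, hexp, norm_mul, Complex.norm_exp_ofReal_mul_I, mul_one,
      Complex.norm_real, Real.norm_of_nonneg (Real.exp_pos _).le]
    calc ‖F (complexPoint x y)‖ * (Real.exp (ε * ‖y‖ ^ 2) * Real.exp (-ε * ‖x‖ ^ 2)) *
          Real.exp (2 * Real.pi * inner ℝ y ξ)
        = ‖F (complexPoint x y)‖ * (Real.exp (ε * ‖y‖ ^ 2) *
          Real.exp (2 * Real.pi * inner ℝ y ξ)) * Real.exp (-ε * ‖x‖ ^ 2) := by ring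
      _ ≤ _ := by
        gcongr
        · exact hb y hy x
        · exact hDy.trans (le_max_left _ _)

theorem tendsto_damped (hF : IsLocallyHardy Ω F) (hΩ : IsOpen Ω) {y : RSpace n} (hy : y ∈ Ω) :
    Tendsto (fun k : ℕ => (hF.memLp_damped hΩ (ε := 1 / ((k : ℝ) + 1)) (by positivity) hy).toLp)
      atTop (𝓝 (hF.memLp_slice hΩ hy).toLp) := by
  rw [Lp.tendsto_Lp_iff_tendsto_eLpNorm'']
  -- As `ε ≤ 1`, the damping factor has modulus at most `e^{‖y‖²}`; the `1` accounts for the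
  -- subtracted function.
  set C := (Real.exp (‖y‖ ^ 2) + 1)
  have hle : ∀ (k : ℕ) (x : RSpace n), ‖F (complexPoint x y) *
      exp (-((1 / ((k : ℝ) + 1) : ℝ) : ℂ) * sumSq (complexPoint x y)) - F (complexPoint x y)‖ₑ ^ 2 ≤
        ‖C * ‖F (complexPoint x y)‖‖ₑ ^ 2 := by
    intro k x
    gcongr
    rw [enorm_le_iff_norm_le, Real.norm_of_nonneg (by positivity)]
    have h0 : (0 : ℝ) < 1 / ((k : ℝ) + 1) := by positivity
    have h1 : 1 / ((k : ℝ) + 1) ≤ 1 := by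
      rw [div_le_one (by positivity)]
      linarith [(Nat.cast_nonneg k : (0 : ℝ) ≤ k)]
    have h2 : Real.exp (1 / ((k : ℝ) + 1) * ‖y‖ ^ 2) ≤ Real.exp (‖y‖ ^ 2) :=
      Real.exp_le_exp.2 (mul_le_of_le_one_left (sq_nonneg _) h1)
    have h3 : Real.exp (-(1 / ((k : ℝ) + 1)) * ‖x‖ ^ 2) ≤ 1 :=
      Real.exp_le_one_iff.2 (by nlinarith [sq_nonneg ‖x‖])
    refine (norm_sub_le _ _).trans ?_
    rw [norm_mul, norm_exp_sumSq, add_mul, one_mul, mul_comm]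
    gcongr
    calc _ ≤ Real.exp (‖y‖ ^ 2) * 1 := mul_le_mul h2 h3 (Real.exp_pos _).le (Real.exp_pos _).le
      _ = _ := mul_one _
  have hlim : Tendsto (fun k : ℕ => ∫⁻ x, ‖F (complexPoint x y) *
      exp (-((1 / ((k : ℝ) + 1) : ℝ) : ℂ) * sumSq (complexPoint x y)) -
        F (complexPoint x y)‖ₑ ^ 2) atTop (𝓝 (∫⁻ _ : RSpace n, 0)) := by
    refine tendsto_lintegral_of_dominated_convergence' _ (fun k => ?_)
      (fun k => Eventually.of_forall (hle k)) ?_ (Eventually.of_forall fun x => ?_)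
    · exact ((hF.memLp_damped hΩ (ε := 1 / ((k : ℝ) + 1)) (by positivity)
        hy).aestronglyMeasurable.sub (hF.memLp_slice hΩ hy).aestronglyMeasurable).enorm.pow_const 2
    · simp only [enorm_mul, mul_pow, enorm_norm]
      rw [lintegral_const_mul' _ _ (by finiteness)]
      exact (ENNReal.mul_lt_top (by finiteness) (hF.lintegral_slice_lt_top hΩ hy)).ne
    · have h1 : Tendsto (fun k : ℕ => (((1 / ((k : ℝ) + 1) : ℝ)) : ℂ)) atTop (𝓝 ((0 : ℝ) : ℂ)) :=
        (Complex.continuous_ofReal.tendsto 0).comp tendsto_one_div_add_atTop_nhds_zero_nat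
      have hc : Continuous fun e : ℂ => ‖F (complexPoint x y) *
        exp (-e * sumSq (complexPoint x y)) - F (complexPoint x y)‖ₑ ^ 2 := by fun_prop
      have h2 := (hc.tendsto ((0 : ℝ) : ℂ)).comp h1
      simpa [Function.comp_def] using h2
  rw [lintegral_zero] at hlim
  have h2 : ∀ k : ℕ, eLpNorm ((fun x => F (complexPoint x y) *
      exp (-((1 / ((k : ℝ) + 1) : ℝ) : ℂ) * sumSq (complexPoint x y))) -
        fun x => F (complexPoint x y)) 2 volume = (∫⁻ x, ‖F (complexPoint x y) *
      exp (-((1 / ((k : ℝ) + 1) : ℝ) : ℂ) * sumSq (complexPoint x y)) -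
        F (complexPoint x y)‖ₑ ^ 2) ^ (1 / 2 : ℝ) := by
    intro k
    have h := eLpNorm_two_sq (μ := volume) ((fun x => F (complexPoint x y) *
      exp (-((1 / ((k : ℝ) + 1) : ℝ) : ℂ) * sumSq (complexPoint x y))) -
        fun x => F (complexPoint x y))
    simp only [Pi.sub_apply] at h
    rw [← h, ← ENNReal.rpow_natCast, ← ENNReal.rpow_mul]
    norm_num
  simp only [h2]
  have h3 := (ENNReal.continuous_rpow_const (y := (1 / 2 : ℝ))).tendsto 0 |>.comp hlim
  simpa [Function.comp_def] using h3

/-- The `L²` Fourier transforms of the restrictions of `F` to the subspaces `V + iy`. -/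
noncomputable def sliceFourier (hF : IsLocallyHardy Ω F) (hΩ : IsOpen Ω) {y : RSpace n}
    (hy : y ∈ Ω) : Lp ℂ 2 (volume : Measure (RSpace n)) :=
  𝓕 (hF.memLp_slice hΩ hy).toLp

/-- Remove the damping: `L²` convergence gives almost everywhere convergence along a subsequence,
chosen for `y₁` and then refined for `y₂`. -/
theorem sliceFourier_ae_eq (hF : IsLocallyHardy Ω F) (hΩ : IsOpen Ω) (hconv : Convex ℝ Ω)
    {y₁ y₂ : RSpace n} (hy₁ : y₁ ∈ Ω) (hy₂ : y₂ ∈ Ω) :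
    (fun ξ => (Real.exp (2 * Real.pi * inner ℝ y₁ ξ) : ℂ) * hF.sliceFourier hΩ hy₁ ξ) =ᵐ[volume]
      fun ξ => (Real.exp (2 * Real.pi * inner ℝ y₂ ξ) : ℂ) * hF.sliceFourier hΩ hy₂ ξ := by
  have hε : ∀ k : ℕ, (0 : ℝ) < 1 / ((k : ℝ) + 1) := fun k => by positivity
  have hlim : ∀ {y : RSpace n} (hy : y ∈ Ω), Tendsto (fun k : ℕ =>
      (𝓕 (hF.memLp_damped hΩ (hε k) hy).toLp : Lp ℂ 2 (volume : Measure (RSpace n)))) atTop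
        (𝓝 (hF.sliceFourier hΩ hy)) := fun hy =>
    ((Lp.fourierTransformₗᵢ (RSpace n) ℂ).continuous.tendsto _).comp (hF.tendsto_damped hΩ hy)
  obtain ⟨φ, hφ, h1⟩ := (tendstoInMeasure_of_tendsto_Lp (hlim hy₁)).exists_seq_tendsto_ae
  obtain ⟨θ, hθ, h2⟩ := (tendstoInMeasure_of_tendsto_Lp
    ((hlim hy₂).comp hφ.tendsto_atTop)).exists_seq_tendsto_ae
  have h3 : ∀ᵐ ξ, ∀ k, (𝓕 (hF.memLp_damped hΩ (hε k) hy₁).toLp :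
      Lp ℂ 2 (volume : Measure (RSpace n))) ξ = _ := ae_all_iff.2 fun k =>
    coeFn_fourier_toLp (hF.integrable_damped hΩ (hε k) hy₁) (hF.memLp_damped hΩ (hε k) hy₁)
  have h4 : ∀ᵐ ξ, ∀ k, (𝓕 (hF.memLp_damped hΩ (hε k) hy₂).toLp :
      Lp ℂ 2 (volume : Measure (RSpace n))) ξ = _ := ae_all_iff.2 fun k =>
    coeFn_fourier_toLp (hF.integrable_damped hΩ (hε k) hy₂) (hF.memLp_damped hΩ (hε k) hy₂)
  filter_upwards [h1, h2, h3, h4] with ξ h1 h2 h3 h4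
  have h1' := (h1.comp hθ.tendsto_atTop).const_mul (Real.exp (2 * Real.pi * inner ℝ y₁ ξ) : ℂ)
  have h2' := h2.const_mul (Real.exp (2 * Real.pi * inner ℝ y₂ ξ) : ℂ)
  refine tendsto_nhds_unique h1' (h2'.congr fun k => ?_)
  simp only [Function.comp_apply]
  rw [h3, h4]
  exact (hF.exp_mul_fourier_damped_eq hΩ hconv (hε _) ξ hy₁ hy₂).symm

/-- The Fourier transform of the boundary value. -/
theorem exists_spectrum (hF : IsLocallyHardy Ω F) (hΩ : IsOpen Ω) (hconv : Convex ℝ Ω)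
    (hne : Ω.Nonempty) :
    ∃ g : RSpace n → ℂ, StronglyMeasurable g ∧ ∀ y (hy : y ∈ Ω),
      hF.sliceFourier hΩ hy =ᵐ[volume]
        fun ξ => (Real.exp (-(2 * Real.pi * inner ℝ y ξ)) : ℂ) * g ξ := by
  obtain ⟨y₀, hy₀⟩ := hne
  refine ⟨fun ξ => (Real.exp (2 * Real.pi * inner ℝ y₀ ξ) : ℂ) * hF.sliceFourier hΩ hy₀ ξ,
    ?_, fun y hy => ?_⟩
  · refine StronglyMeasurable.mul (Continuous.stronglyMeasurable ?_) (Lp.stronglyMeasurable _)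
    fun_prop
  · filter_upwards [hF.sliceFourier_ae_eq hΩ hconv hy₀ hy] with ξ hξ
    rw [hξ, ← mul_assoc, ← ofReal_mul, ← Real.exp_add, neg_add_cancel, Real.exp_zero, ofReal_one,
      one_mul]

theorem lintegral_slice_eq (hF : IsLocallyHardy Ω F) (hΩ : IsOpen Ω) {g : RSpace n → ℂ}
    (hg : ∀ y (hy : y ∈ Ω), hF.sliceFourier hΩ hy =ᵐ[volume]
        fun ξ => (Real.exp (-(2 * Real.pi * inner ℝ y ξ)) : ℂ) * g ξ)
    {y : RSpace n} (hy : y ∈ Ω) :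
    ∫⁻ x, ‖F (complexPoint x y)‖ₑ ^ 2 =
      ∫⁻ ξ, ENNReal.ofReal (Real.exp (-inner ℝ ((4 * Real.pi) • ξ) y)) * ‖g ξ‖ₑ ^ 2 := by
  have h : ‖hF.sliceFourier hΩ hy‖ₑ = ‖(hF.memLp_slice hΩ hy).toLp‖ₑ := by
    rw [← ofReal_norm, ← ofReal_norm]
    congr 1
    exact Lp.norm_fourier_eq _
  rw [Lp.enorm_toLp, Lp.enorm_def] at h
  rw [← eLpNorm_two_sq, ← h, eLpNorm_congr_ae (hg y hy), eLpNorm_two_sq]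
  refine lintegral_congr fun ξ => ?_
  rw [enorm_mul, mul_pow]
  congr 1
  rw [← ofReal_norm, Complex.norm_real, Real.norm_of_nonneg (Real.exp_pos _).le,
    ← ENNReal.ofReal_pow (Real.exp_pos _).le, ← Real.exp_nat_mul, real_inner_smul_left,
    real_inner_comm]
  congr 2
  push_cast
  ring

end IsLocallyHardy

end PaleyWiener

/-! ### The Fourier–Laplace transform over the cone and differential operators -/

section LaplaceExtension

open Complex Filter Topology

theorem norm_exp_pairing {n : ℕ} (ξ : RSpace n) (z : CSpace n) :
    ‖exp (2 * Real.pi * I * pairing ξ z)‖ = Real.exp (-(2 * Real.pi * inner ℝ (imPart z) ξ)) := by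
  rw [Complex.norm_exp, ← complexPoint_re_im z, pairing_complexPoint, imPart_complexPoint]
  congr 1
  simp [mul_assoc]

theorem one_add_mul_pow_le_exp {a b : ℝ} (ha : 0 ≤ a) (hb : 0 < b) (N : ℕ) :
    ∃ M : ℝ, 0 ≤ M ∧ ∀ t : ℝ, 0 ≤ t → (1 + a * t) ^ N ≤ M * Real.exp (b * t) := by
  -- The denominator `N + 1` makes `N s ≤ b` and stays positive for `N = 0`.
  set s := b / (N + 1)
  have hs : 0 < s := by positivity
  refine ⟨(max 1 (a / s)) ^ N, by positivity, fun t ht => ?_⟩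
  have h1 : 1 + a * t ≤ max 1 (a / s) * Real.exp (s * t) := by
    have h2 : 1 + s * t ≤ Real.exp (s * t) := by linarith [Real.add_one_le_exp (s * t)]
    have h3 : a * t = a / s * (s * t) := by field_simp
    calc 1 + a * t ≤ max 1 (a / s) * (1 + s * t) := by
          rw [mul_add, mul_one, h3]
          gcongr
          · exact le_max_left _ _
          · exact le_max_right _ _
      _ ≤ _ := by gcongr
  calc (1 + a * t) ^ N ≤ (max 1 (a / s) * Real.exp (s * t)) ^ N := by gcongr
    _ = (max 1 (a / s)) ^ N * Real.exp (N * (s * t)) := by rw [mul_pow, ← Real.exp_nat_mul]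
    _ ≤ _ := by
      rw [← mul_assoc]
      have h4 : N * s ≤ b := by
        rw [mul_div_assoc', div_le_iff₀ (by positivity)]
        nlinarith
      gcongr

namespace EuclideanJordanAlgebra

variable {n : ℕ} (J : EuclideanJordanAlgebra n)

/-- The functions whose Fourier–Laplace transform over the cone converges on the tube. -/
structure IsLaplaceAdmissible (f : RSpace n → ℂ) : Prop where
  measurable : Measurable f
  integrable : ∀ y ∈ J.pd,
    IntegrableOn (fun ξ => Real.exp (-(2 * Real.pi * inner ℝ y ξ)) * ‖f ξ‖) J.pd

/-- The Fourier–Laplace transform `z ↦ ∫_Ω e^{2πi⟨z,ξ⟩} f(ξ) dξ`. -/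
noncomputable def laplaceExt (f : RSpace n → ℂ) (z : CSpace n) : ℂ :=
  ∫ ξ in J.pd, exp (2 * Real.pi * I * pairing ξ z) * f ξ

variable {J}

theorem continuous_pairing_left (z : CSpace n) : Continuous fun ξ : RSpace n => pairing ξ z := by
  simp only [pairing_apply]
  fun_prop

theorem continuous_pairing : Continuous (pairing : RSpace n → CSpace n →L[ℂ] ℂ) := by
  unfold pairing
  fun_prop

theorem IsLaplaceAdmissible.integrableOn {f : RSpace n → ℂ} (hf : J.IsLaplaceAdmissible f)
    {z : CSpace n} (hz : z ∈ tube J.pd) :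
    IntegrableOn (fun ξ => exp (2 * Real.pi * I * pairing ξ z) * f ξ) J.pd := by
  refine (hf.integrable _ hz).mono' ?_ (Eventually.of_forall fun ξ => ?_)
  · refine (Measurable.mul ?_ hf.measurable).aestronglyMeasurable
    exact (Complex.continuous_exp.comp
      (continuous_const.mul (continuous_pairing_left z))).measurable
  · rw [norm_mul, norm_exp_pairing]
    rfl

/-- Replacing `y` by `y - εe` gains `e^{2πε⟨e,ξ⟩}`, which absorbs polynomial growth because `‖ξ‖ ≤
A⟨e, ξ⟩` on the cone. -/
theorem exists_bound_mul_exp {h : RSpace n → ℂ} {C : ℝ} {N : ℕ} (hC : 0 ≤ C)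
    (hb : ∀ ξ, ‖h ξ‖ ≤ C * (1 + ‖ξ‖) ^ N) {y : RSpace n} (hy : y ∈ J.pd) :
    ∃ y' ∈ J.pd, ∃ M : ℝ, 0 ≤ M ∧ ∀ ξ ∈ J.pd,
      Real.exp (-(2 * Real.pi * inner ℝ y ξ)) * ‖h ξ‖ ≤
        M * Real.exp (-(2 * Real.pi * inner ℝ y' ξ)) := by
  obtain ⟨ε, hε, hy'⟩ := J.exists_sub_mem_pd hy
  obtain ⟨A, hA, hle⟩ := J.norm_le_inner_one
  obtain ⟨M, hM, hMb⟩ := one_add_mul_pow_le_exp hA.le (b := 2 * Real.pi * ε) (by positivity) N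
  refine ⟨_, hy', C * M, by positivity, fun ξ hξ => ?_⟩
  have h1 := J.inner_psd_nonneg (J.pd_subset_psd J.one_mem_pd) (J.pd_subset_psd hξ)
  have h2 : (1 + ‖ξ‖) ^ N ≤ M * Real.exp (2 * Real.pi * ε * inner ℝ J.one ξ) := by
    refine le_trans ?_ (hMb _ h1)
    gcongr
    exact hle ξ (J.pd_subset_psd hξ)
  rw [inner_sub_left, real_inner_smul_left]
  calc Real.exp (-(2 * Real.pi * inner ℝ y ξ)) * ‖h ξ‖
      ≤ Real.exp (-(2 * Real.pi * inner ℝ y ξ)) *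
        (C * (M * Real.exp (2 * Real.pi * ε * inner ℝ J.one ξ))) := by
        gcongr
        exact (hb ξ).trans (by gcongr)
    _ = C * M * (Real.exp (-(2 * Real.pi * inner ℝ y ξ)) *
        Real.exp (2 * Real.pi * ε * inner ℝ J.one ξ)) := by ring
    _ = _ := by
        rw [← Real.exp_add]
        congr 2
        ring

theorem IsLaplaceAdmissible.mul_of_bound {f h : RSpace n → ℂ} (hf : J.IsLaplaceAdmissible f)
    (hh : Measurable h) {C : ℝ} {N : ℕ} (hC : 0 ≤ C) (hb : ∀ ξ, ‖h ξ‖ ≤ C * (1 + ‖ξ‖) ^ N) :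
    J.IsLaplaceAdmissible fun ξ => h ξ * f ξ := by
  refine ⟨hh.mul hf.measurable, fun y hy => ?_⟩
  obtain ⟨y', hy', M, hM, hMb⟩ := exists_bound_mul_exp hC hb hy
  refine ((hf.integrable _ hy').const_mul M).mono' ?_ ?_
  · refine (Measurable.mul ?_ (hh.mul hf.measurable).norm).aestronglyMeasurable
    exact (by fun_prop : Continuous fun ξ : RSpace n =>
      Real.exp (-(2 * Real.pi * inner ℝ y ξ))).measurable
  · filter_upwards [ae_restrict_mem J.measurableSet_pd] with ξ hξ
    rw [Real.norm_of_nonneg (by positivity), norm_mul, ← _root_.mul_assoc, ← _root_.mul_assoc]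
    exact mul_le_mul_of_nonneg_right (hMb ξ hξ) (norm_nonneg _)

theorem IsLaplaceAdmissible.coord_mul {f : RSpace n → ℂ} (hf : J.IsLaplaceAdmissible f)
    (j : Fin n) : J.IsLaplaceAdmissible fun ξ => (2 * Real.pi * I * ξ j) * f ξ := by
  refine hf.mul_of_bound (C := 2 * Real.pi) (N := 1) ?_ (by positivity) fun ξ => ?_
  · exact (by fun_prop : Continuous fun ξ : RSpace n => (2 * Real.pi * I * ξ j : ℂ)).measurable
  · simp only [norm_mul, norm_real, norm_I, _root_.mul_one, pow_one, Complex.norm_ofNat,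
      Real.norm_of_nonneg Real.pi_pos.le]
    have h := PiLp.norm_apply_le ξ j
    exact mul_le_mul_of_nonneg_left (by linarith) (mul_nonneg zero_le_two Real.pi_pos.le)

theorem IsLaplaceAdmissible.add {f g : RSpace n → ℂ} (hf : J.IsLaplaceAdmissible f)
    (hg : J.IsLaplaceAdmissible g) : J.IsLaplaceAdmissible fun ξ => f ξ + g ξ := by
  refine ⟨hf.measurable.add hg.measurable, fun y hy => ?_⟩
  refine ((hf.integrable y hy).add (hg.integrable y hy)).mono' ?_ (Eventually.of_forall fun ξ => ?_)
  · refine (Measurable.mul ?_ (hf.measurable.add hg.measurable).norm).aestronglyMeasurable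
    exact (by fun_prop : Continuous fun ξ : RSpace n =>
      Real.exp (-(2 * Real.pi * inner ℝ y ξ))).measurable
  · rw [Real.norm_of_nonneg (by positivity), Pi.add_apply, ← mul_add]
    gcongr
    exact norm_add_le _ _

theorem IsLaplaceAdmissible.const_mul {f : RSpace n → ℂ} (hf : J.IsLaplaceAdmissible f) (c : ℂ) :
    J.IsLaplaceAdmissible fun ξ => c * f ξ :=
  hf.mul_of_bound measurable_const (norm_nonneg c) (N := 0) fun ξ => by simp

theorem laplaceExt_add {f g : RSpace n → ℂ} (hf : J.IsLaplaceAdmissible f)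
    (hg : J.IsLaplaceAdmissible g) {z : CSpace n} (hz : z ∈ tube J.pd) :
    J.laplaceExt (fun ξ => f ξ + g ξ) z = J.laplaceExt f z + J.laplaceExt g z := by
  rw [laplaceExt, laplaceExt, laplaceExt, ← integral_add (hf.integrableOn hz) (hg.integrableOn hz)]
  simp only [mul_add]

theorem laplaceExt_const_mul (f : RSpace n → ℂ) (c : ℂ) (z : CSpace n) :
    J.laplaceExt (fun ξ => c * f ξ) z = c * J.laplaceExt f z := by
  rw [laplaceExt, laplaceExt, ← integral_const_mul]
  congr 1
  funext ξ
  ring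

theorem laplaceExt_congr {f g : RSpace n → ℂ} (h : ∀ ξ ∈ J.pd, f ξ = g ξ) :
    J.laplaceExt f = J.laplaceExt g := by
  funext z
  refine setIntegral_congr_fun J.measurableSet_pd fun ξ hξ => ?_
  simp only [h ξ hξ]

theorem norm_pairing_le (ξ : RSpace n) : ‖pairing ξ‖ ≤ ∑ j, |ξ j| := by
  refine ContinuousLinearMap.opNorm_le_bound _ (Finset.sum_nonneg fun j _ => abs_nonneg _)
    fun z => ?_
  rw [pairing_apply, Finset.sum_mul]
  refine (norm_sum_le _ _).trans (Finset.sum_le_sum fun j _ => ?_)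
  rw [norm_mul, norm_real, Real.norm_eq_abs]
  exact mul_le_mul_of_nonneg_left (PiLp.norm_apply_le z j) (abs_nonneg _)

/-- Differentiation under the integral. With `y' = Im z - εe`, every `w` near `z` has `Im w - y'` in
the cone, so `e^{-2π⟨y',ξ⟩}` dominates all the kernels at once. -/
theorem IsLaplaceAdmissible.hasFDerivAt {f : RSpace n → ℂ} (hf : J.IsLaplaceAdmissible f)
    {z : CSpace n} (hz : z ∈ tube J.pd) :
    Integrable (fun ξ => (exp (2 * Real.pi * I * pairing ξ z) * f ξ) •
      ((2 * Real.pi * I : ℂ) • pairing ξ)) (volume.restrict J.pd) ∧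
    HasFDerivAt (J.laplaceExt f) (∫ ξ in J.pd, (exp (2 * Real.pi * I * pairing ξ z) * f ξ) •
      ((2 * Real.pi * I : ℂ) • pairing ξ)) z := by
  obtain ⟨ε, hε, hy'⟩ := J.exists_sub_mem_pd (mem_tube.1 hz)
  set y' := imPart z - ε • J.one
  set s : Set (CSpace n) := {w | imPart w - y' ∈ J.pd}
  have hs : IsOpen s := J.isOpen_pd.preimage (continuous_imPart.sub continuous_const)
  have hzs : z ∈ s := by
    change imPart z - y' ∈ J.pd
    simp only [y', sub_sub_cancel]
    exact J.smul_mem_pd J.one_mem_pd hε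
  set bound : RSpace n → ℝ := fun ξ =>
    ∑ j, Real.exp (-(2 * Real.pi * inner ℝ y' ξ)) * ‖(2 * Real.pi * I * ξ j) * f ξ‖
  have hbound : Integrable bound (volume.restrict J.pd) :=
    integrable_finsetSum _ fun j _ => (hf.coord_mul j).integrable y' hy'
  have hm : ∀ w, Measurable fun ξ => exp (2 * Real.pi * I * pairing ξ w) * f ξ := fun w =>
    Measurable.mul (Complex.continuous_exp.comp
      (continuous_const.mul (continuous_pairing_left w))).measurable hf.measurable
  have hF'm : AEStronglyMeasurable (fun ξ => (exp (2 * Real.pi * I * pairing ξ z) * f ξ) •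
      ((2 * Real.pi * I : ℂ) • pairing ξ)) (volume.restrict J.pd) :=
    (hm z).aestronglyMeasurable.smul
      ((continuous_pairing (n := n)).const_smul (2 * Real.pi * I : ℂ)).aestronglyMeasurable
  have hle : ∀ ξ ∈ J.pd, ∀ w ∈ s, ‖(exp (2 * Real.pi * I * pairing ξ w) * f ξ) •
      ((2 * Real.pi * I : ℂ) • pairing ξ)‖ ≤ bound ξ := by
    intro ξ hξ w hw
    have h1 : inner ℝ y' ξ ≤ inner ℝ (imPart w) ξ := by
      have h2 := J.inner_psd_nonneg (J.pd_subset_psd hw) (J.pd_subset_psd hξ)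
      rw [inner_sub_left] at h2
      linarith
    rw [norm_smul, norm_mul, norm_exp_pairing, norm_smul]
    calc Real.exp (-(2 * Real.pi * inner ℝ (imPart w) ξ)) * ‖f ξ‖ *
          (‖(2 * Real.pi * I : ℂ)‖ * ‖pairing ξ‖)
        ≤ Real.exp (-(2 * Real.pi * inner ℝ y' ξ)) * ‖f ξ‖ *
          (‖(2 * Real.pi * I : ℂ)‖ * ∑ j, |ξ j|) := by
          gcongr
          exact norm_pairing_le ξ
      _ = bound ξ := by
          simp only [bound, Finset.mul_sum, norm_mul, norm_real, Real.norm_eq_abs]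
          refine Finset.sum_congr rfl fun j _ => ?_
          ring
  refine ⟨hbound.mono' hF'm ?_, hasFDerivAt_integral_of_dominated_of_fderiv_le (𝕜 := ℂ)
    (F := fun w ξ => exp (2 * Real.pi * I * pairing ξ w) * f ξ)
    (F' := fun w ξ => (exp (2 * Real.pi * I * pairing ξ w) * f ξ) •
      ((2 * Real.pi * I : ℂ) • pairing ξ)) (bound := bound)
    (hs.mem_nhds hzs) (Eventually.of_forall fun w => (hm w).aestronglyMeasurable)
    (hf.integrableOn hz) hF'm ?_ hbound ?_⟩
  · filter_upwards [ae_restrict_mem J.measurableSet_pd] with ξ hξ using hle ξ hξ z hzs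
  · filter_upwards [ae_restrict_mem J.measurableSet_pd] with ξ hξ using hle ξ hξ
  · refine Eventually.of_forall fun ξ w _ => ?_
    have h1 : HasFDerivAt (fun w => exp (2 * Real.pi * I * pairing ξ w))
        (exp (2 * Real.pi * I * pairing ξ w) • ((2 * Real.pi * I : ℂ) • pairing ξ)) w :=
      ((pairing ξ).hasFDerivAt.const_mul (2 * Real.pi * I : ℂ)).cexp
    have h2 := h1.mul_const (f ξ)
    rwa [smul_smul, _root_.mul_comm (f ξ)] at h2

theorem IsLaplaceAdmissible.differentiableOn {f : RSpace n → ℂ} (hf : J.IsLaplaceAdmissible f) :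
    DifferentiableOn ℂ (J.laplaceExt f) (tube J.pd) := fun _ hz =>
  (hf.hasFDerivAt hz).2.differentiableAt.differentiableWithinAt

theorem IsLaplaceAdmissible.partialX_eqOn {f : RSpace n → ℂ} (hf : J.IsLaplaceAdmissible f)
    (j : Fin n) {H : CSpace n → ℂ} (hH : Set.EqOn H (J.laplaceExt f) (tube J.pd)) :
    Set.EqOn (partialX j H) (J.laplaceExt fun ξ => (2 * Real.pi * I * ξ j) * f ξ) (tube J.pd) := by
  intro z hz
  obtain ⟨hi, hd⟩ := hf.hasFDerivAt hz
  have h1 : H =ᶠ[𝓝 z] J.laplaceExt f := hH.eventuallyEq_of_mem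
    ((isOpen_tube J.isOpen_pd).mem_nhds hz)
  rw [partialX, h1.lineDeriv_eq, ((hd.restrictScalars ℝ).hasLineDerivAt _).lineDeriv]
  change (∫ ξ in J.pd, (exp (2 * Real.pi * I * pairing ξ z) * f ξ) •
      ((2 * Real.pi * I : ℂ) • pairing ξ)) (EuclideanSpace.single j (1 : ℂ)) = _
  rw [ContinuousLinearMap.integral_apply hi, laplaceExt]
  congr 1
  funext ξ
  have h2 : pairing ξ (EuclideanSpace.single j (1 : ℂ)) = ξ j := by
    simp [pairing_apply]
  simp only [_root_.smul_apply, h2, smul_eq_mul]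
  ring

theorem IsLaplaceAdmissible.partialX_iterate {f : RSpace n → ℂ} (hf : J.IsLaplaceAdmissible f)
    (j : Fin n) {H : CSpace n → ℂ} (hH : Set.EqOn H (J.laplaceExt f) (tube J.pd)) (k : ℕ) :
    (J.IsLaplaceAdmissible fun ξ => (2 * Real.pi * I * ξ j) ^ k * f ξ) ∧
    Set.EqOn ((partialX j)^[k] H) (J.laplaceExt fun ξ => (2 * Real.pi * I * ξ j) ^ k * f ξ)
      (tube J.pd) := by
  induction k with
  | zero => simpa using ⟨hf, hH⟩
  | succ k ih =>
    have h1 := ih.1.coord_mul j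
    have h2 := ih.1.partialX_eqOn j ih.2
    rw [Function.iterate_succ_apply']
    simp only [← _root_.mul_assoc, ← pow_succ'] at h1 h2
    exact ⟨h1, h2⟩

theorem IsLaplaceAdmissible.partialPow_eqOn {f : RSpace n → ℂ} (hf : J.IsLaplaceAdmissible f)
    (α : Fin n →₀ ℕ) {H : CSpace n → ℂ} (hH : Set.EqOn H (J.laplaceExt f) (tube J.pd)) :
    (J.IsLaplaceAdmissible fun ξ => (∏ j, (2 * Real.pi * I * ξ j) ^ α j) * f ξ) ∧
    Set.EqOn (partialPow α H) (J.laplaceExt fun ξ => (∏ j, (2 * Real.pi * I * ξ j) ^ α j) * f ξ)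
      (tube J.pd) := by
  simp only [Fin.prod_univ_def]
  unfold partialPow
  induction List.finRange n with
  | nil => simpa using ⟨hf, hH⟩
  | cons j l ih =>
    have h := ih.1.partialX_iterate j ih.2 (α j)
    simpa only [List.foldr_cons, List.map_cons, List.prod_cons, _root_.mul_assoc] using h

theorem isLaplaceAdmissible_finset_sum {ι : Type*} (S : Finset ι) {f : ι → RSpace n → ℂ}
    (hf : ∀ i ∈ S, J.IsLaplaceAdmissible (f i)) :
    (J.IsLaplaceAdmissible fun ξ => ∑ i ∈ S, f i ξ) ∧ ∀ z ∈ tube J.pd,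
      J.laplaceExt (fun ξ => ∑ i ∈ S, f i ξ) z = ∑ i ∈ S, J.laplaceExt (f i) z := by
  classical
  induction S using Finset.induction_on with
  | empty =>
    refine ⟨⟨by simp, fun y _ => by simp⟩, fun z _ => by simp [laplaceExt]⟩
  | insert i S hi ih =>
    have h1 := hf i (Finset.mem_insert_self i S)
    have h2 := ih fun k hk => hf k (Finset.mem_insert_of_mem hk)
    simp only [Finset.sum_insert hi]
    refine ⟨h1.add h2.1, fun z hz => ?_⟩
    rw [laplaceExt_add h1 h2.1 hz, h2.2 z hz]

/-- Each `∂ⱼ` brings down `2πiξⱼ`, and `1/i` cancels the `i`: the symbol is `p(2πξ)`. -/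
theorem IsLaplaceAdmissible.diffOp_eqOn {f : RSpace n → ℂ} (hf : J.IsLaplaceAdmissible f)
    (p : MvPolynomial (Fin n) ℝ) {H : CSpace n → ℂ}
    (hH : Set.EqOn H (J.laplaceExt f) (tube J.pd)) :
    (J.IsLaplaceAdmissible fun ξ => (evalAt ((2 * Real.pi) • ξ) p : ℂ) * f ξ) ∧
    Set.EqOn (diffOp p H) (J.laplaceExt fun ξ => (evalAt ((2 * Real.pi) • ξ) p : ℂ) * f ξ)
      (tube J.pd) := by
  have hterm : ∀ α : Fin n →₀ ℕ, ∀ ξ : RSpace n,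
      ((p.coeff α * ∏ j, ((2 * Real.pi) • ξ) j ^ α j : ℝ) : ℂ) * f ξ =
        ((p.coeff α : ℝ) : ℂ) * (1 / I) ^ (∑ j, α j) *
          ((∏ j, (2 * Real.pi * I * ξ j) ^ α j) * f ξ) := by
    intro α ξ
    have h1 : (1 / I) ^ (∑ j, α j) * ∏ j, (2 * Real.pi * I * ξ j : ℂ) ^ α j =
        ∏ j, ((2 * Real.pi * ξ j : ℝ) : ℂ) ^ α j := by
      rw [← Finset.prod_pow_eq_pow_sum, ← Finset.prod_mul_distrib]
      refine Finset.prod_congr rfl fun j _ => ?_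
      rw [← mul_pow]
      congr 1
      push_cast
      field_simp
    rw [_root_.mul_assoc, ← _root_.mul_assoc _ (∏ j, _), h1]
    simp only [PiLp.smul_apply, smul_eq_mul]
    push_cast
    ring
  have hsum : (fun ξ => (evalAt ((2 * Real.pi) • ξ) p : ℂ) * f ξ) = fun ξ =>
      ∑ α ∈ p.support, ((p.coeff α : ℝ) : ℂ) * (1 / I) ^ (∑ j, α j) *
          ((∏ j, (2 * Real.pi * I * ξ j) ^ α j) * f ξ) := by
    funext ξ
    rw [MvPolynomial.eval_eq', ofReal_sum, Finset.sum_mul]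
    exact Finset.sum_congr rfl fun α _ => hterm α ξ
  have h := isLaplaceAdmissible_finset_sum (J := J) p.support (f := fun α ξ =>
    ((p.coeff α : ℝ) : ℂ) * (1 / I) ^ (∑ j, α j) * ((∏ j, (2 * Real.pi * I * ξ j) ^ α j) * f ξ))
    fun α _ => (hf.partialPow_eqOn α hH).1.const_mul _
  rw [hsum]
  refine ⟨h.1, fun z hz => ?_⟩
  rw [h.2 z hz, diffOp]
  refine Finset.sum_congr rfl fun α _ => ?_
  rw [laplaceExt_const_mul, (hf.partialPow_eqOn α hH).2 hz]

theorem IsLaplaceAdmissible.box_iterate {f : RSpace n → ℂ} (hf : J.IsLaplaceAdmissible f)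
    {F : tube J.pd → ℂ} (hF : Set.EqOn (zeroExtend F) (J.laplaceExt f) (tube J.pd)) (m : ℕ) :
    (J.IsLaplaceAdmissible fun ξ => (J.det ((2 * Real.pi) • ξ) : ℂ) ^ m * f ξ) ∧
    Set.EqOn (zeroExtend (J.box^[m] F))
      (J.laplaceExt fun ξ => (J.det ((2 * Real.pi) • ξ) : ℂ) ^ m * f ξ) (tube J.pd) := by
  induction m with
  | zero => simpa using ⟨hf, hF⟩
  | succ m ih =>
    have h := ih.1.diffOp_eqOn J.detPoly ih.2
    simp only [← _root_.mul_assoc] at h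
    rw [Function.iterate_succ_apply']
    simp only [pow_succ']
    refine ⟨h.1, fun z hz => ?_⟩
    exact (zeroExtend_coe _ ⟨z, hz⟩).trans (h.2 hz)

end EuclideanJordanAlgebra

end LaplaceExtension

/-! ### Spectra with square integrable slices -/

section SpectralRepresentation

open Complex Filter Topology FourierTransform

theorem enorm_exp_sq {n : ℕ} (y ξ : RSpace n) :
    ‖(Real.exp (-(2 * Real.pi * inner ℝ y ξ)) : ℂ)‖ₑ ^ 2 =
      ENNReal.ofReal (Real.exp (-inner ℝ ((4 * Real.pi) • ξ) y)) := by
  rw [← ofReal_norm, Complex.norm_real, Real.norm_of_nonneg (Real.exp_pos _).le,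
    ← ENNReal.ofReal_pow (Real.exp_pos _).le, ← Real.exp_nat_mul, real_inner_smul_left,
    real_inner_comm]
  congr 2
  push_cast
  ring

theorem continuous_exp_inner {n : ℕ} (y : RSpace n) :
    Continuous fun ξ : RSpace n => (Real.exp (-(2 * Real.pi * inner ℝ y ξ)) : ℂ) := by
  fun_prop

namespace EuclideanJordanAlgebra

variable {n : ℕ} (J : EuclideanJordanAlgebra n)

/-- `∫_Ω e^{-4π⟨y,ξ⟩} |f(ξ)|² dξ`. -/
noncomputable def sliceEnergy (f : RSpace n → ℂ) (y : RSpace n) : ℝ≥0∞ :=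
  ∫⁻ ξ in J.pd, ENNReal.ofReal (Real.exp (-inner ℝ ((4 * Real.pi) • ξ) y)) * ‖f ξ‖ₑ ^ 2

/-- The functions on the cone whose Fourier–Laplace transform is square integrable over every
`V + iy`. -/
structure IsLaplaceSq (f : RSpace n → ℂ) : Prop where
  measurable : Measurable f
  energy_lt_top : ∀ y ∈ J.pd, J.sliceEnergy f y < ∞

variable {J}

theorem lintegral_exp_lt_top (hirr : IsIrreducibleCone J.pd) {y : RSpace n} (hy : y ∈ J.pd) :
    ∫⁻ ξ in J.pd, ENNReal.ofReal (Real.exp (-inner ℝ y ξ)) < ∞ := by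
  have h := J.lintegral_gammaDensity hirr 0 hy
  simp only [gammaDensity, Real.rpow_zero, _root_.mul_one] at h
  rw [h]
  refine ENNReal.mul_lt_top ENNReal.ofReal_lt_top ?_
  have h2 := J.lintegral_gammaDensity_one_lt_top (s := 0) (by norm_num)
  simpa only [gammaDensity, Real.rpow_zero, _root_.mul_one] using h2

theorem sliceEnergy_eq (f : RSpace n → ℂ) (y : RSpace n) : J.sliceEnergy f y =
    ∫⁻ ξ in J.pd, ‖(Real.exp (-(2 * Real.pi * inner ℝ y ξ)) : ℂ) * f ξ‖ₑ ^ 2 := by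
  simp only [enorm_mul, mul_pow, enorm_exp_sq]
  rfl

theorem IsLaplaceSq.memLp {f : RSpace n → ℂ} (hf : J.IsLaplaceSq f) {y : RSpace n}
    (hy : y ∈ J.pd) :
    MemLp (fun ξ => (Real.exp (-(2 * Real.pi * inner ℝ y ξ)) : ℂ) * f ξ) 2
      (volume.restrict J.pd) := by
  refine memLp_two_of_lintegral
    (((continuous_exp_inner y).measurable.mul hf.measurable).aestronglyMeasurable) ?_
  rw [← sliceEnergy_eq]
  exact hf.energy_lt_top y hy

/-- Cauchy–Schwarz: one half of the exponential makes `f` square integrable, and the other half is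
square integrable by the gamma integral with `s = 0`. -/
theorem IsLaplaceSq.isLaplaceAdmissible (hirr : IsIrreducibleCone J.pd) {f : RSpace n → ℂ}
    (hf : J.IsLaplaceSq f) : J.IsLaplaceAdmissible f := by
  refine ⟨hf.measurable, fun y hy => ?_⟩
  have hy' : (1 / 2 : ℝ) • y ∈ J.pd := J.smul_mem_pd hy (by norm_num)
  have h1 : MemLp (fun ξ => (Real.exp (-(2 * Real.pi * inner ℝ ((1 / 2 : ℝ) • y) ξ)) : ℂ)) 2
      (volume.restrict J.pd) := by
    refine memLp_two_of_lintegral (continuous_exp_inner _).aestronglyMeasurable ?_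
    simp only [enorm_exp_sq]
    have h2 := lintegral_exp_lt_top hirr (J.smul_mem_pd hy' (t := 4 * Real.pi) (by positivity))
    refine lt_of_eq_of_lt (lintegral_congr fun ξ => ?_) h2
    rw [real_inner_smul_left, real_inner_smul_left _ ξ, real_inner_comm]
  refine ((hf.memLp hy').integrable_mul h1).norm.congr (Eventually.of_forall fun ξ => ?_)
  simp only [Pi.mul_apply, norm_mul, Complex.norm_real, Real.norm_of_nonneg (Real.exp_pos _).le]
  rw [_root_.mul_right_comm, ← Real.exp_add, real_inner_smul_left]
  congr 2
  ring

theorem IsLaplaceSq.mul_of_bound {f h : RSpace n → ℂ} (hf : J.IsLaplaceSq f)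
    (hh : Measurable h) {C : ℝ} {N : ℕ} (hC : 0 ≤ C) (hb : ∀ ξ, ‖h ξ‖ ≤ C * (1 + ‖ξ‖) ^ N) :
    J.IsLaplaceSq fun ξ => h ξ * f ξ := by
  refine ⟨hh.mul hf.measurable, fun y hy => ?_⟩
  obtain ⟨y', hy', M, hM, hMb⟩ := exists_bound_mul_exp hC hb hy
  have h1 := hf.energy_lt_top y' hy'
  rw [sliceEnergy_eq] at h1 ⊢
  refine lt_of_le_of_lt (setLIntegral_mono' J.measurableSet_pd
    (g := fun ξ => ‖(M : ℂ)‖ₑ ^ 2 *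
      ‖(Real.exp (-(2 * Real.pi * inner ℝ y' ξ)) : ℂ) * f ξ‖ₑ ^ 2) fun ξ hξ => ?_) ?_
  · rw [← mul_pow, ← enorm_mul]
    gcongr
    rw [enorm_le_iff_norm_le]
    simp only [norm_mul, Complex.norm_real, Real.norm_of_nonneg (Real.exp_pos _).le,
      Real.norm_of_nonneg hM]
    rw [← _root_.mul_assoc, ← _root_.mul_assoc]
    exact mul_le_mul_of_nonneg_right (hMb ξ hξ) (norm_nonneg _)
  · rw [lintegral_const_mul' _ _ (by finiteness)]
    exact ENNReal.mul_lt_top (by finiteness) h1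

theorem laplaceExt_complexPoint (f : RSpace n → ℂ) (y x : RSpace n) :
    J.laplaceExt f (complexPoint x y) = 𝓕⁻ (J.pd.indicator fun ξ =>
      (Real.exp (-(2 * Real.pi * inner ℝ y ξ)) : ℂ) * f ξ) x := by
  rw [Real.fourierInv_eq', laplaceExt, ← integral_indicator J.measurableSet_pd]
  congr 1
  funext ξ
  by_cases hξ : ξ ∈ J.pd
  · simp only [Set.indicator_of_mem hξ]
    rw [pairing_complexPoint, smul_eq_mul, ← _root_.mul_assoc, ofReal_exp, ← Complex.exp_add,
      real_inner_comm x ξ]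
    congr 2
    push_cast
    linear_combination (2 * Real.pi * (inner ℝ y ξ : ℝ) : ℂ) * I_sq
  · simp [Set.indicator_of_notMem hξ]

theorem IsLaplaceSq.integrable_indicator (hirr : IsIrreducibleCone J.pd) {f : RSpace n → ℂ}
    (hf : J.IsLaplaceSq f) {y : RSpace n} (hy : y ∈ J.pd) :
    Integrable (J.pd.indicator fun ξ =>
      (Real.exp (-(2 * Real.pi * inner ℝ y ξ)) : ℂ) * f ξ) := by
  rw [integrable_indicator_iff J.measurableSet_pd]
  refine ((hf.isLaplaceAdmissible hirr).integrable y hy).mono'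
    ((continuous_exp_inner y).measurable.mul hf.measurable).aestronglyMeasurable
    (Eventually.of_forall fun ξ => ?_)
  rw [norm_mul, Complex.norm_real, Real.norm_of_nonneg (Real.exp_pos _).le]

theorem IsLaplaceSq.lintegral_slice (hirr : IsIrreducibleCone J.pd) {f : RSpace n → ℂ}
    (hf : J.IsLaplaceSq f) {y : RSpace n} (hy : y ∈ J.pd) :
    ∫⁻ x, ‖J.laplaceExt f (complexPoint x y)‖ₑ ^ 2 = J.sliceEnergy f y := by
  have h2 : MemLp (J.pd.indicator fun ξ =>
      (Real.exp (-(2 * Real.pi * inner ℝ y ξ)) : ℂ) * f ξ) 2 :=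
    (memLp_indicator_iff_restrict J.measurableSet_pd).2 (hf.memLp hy)
  have h := eLpNorm_fourierInv (hf.integrable_indicator hirr hy) h2
  simp only [laplaceExt_complexPoint]
  rw [← eLpNorm_two_sq, h, eLpNorm_indicator_eq_eLpNorm_restrict J.measurableSet_pd,
    eLpNorm_two_sq, sliceEnergy_eq]

theorem measurable_gammaDensity_comp (s : ℝ) {α : Type*} [MeasurableSpace α]
    {f g : α → RSpace n} (hf : Measurable f) (hg : Measurable g) :
    Measurable fun a => J.gammaDensity s (f a) (g a) := by
  unfold gammaDensity
  refine ENNReal.measurable_ofReal.comp (Measurable.mul ?_ ?_)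
  · exact Real.measurable_exp.comp (hf.inner hg).neg
  · exact (J.continuous_det.measurable.comp hg).pow_const s

/-- Tonelli: the two exponentials in `y` combine into one with parameter `x + 4πξ`. -/
theorem lintegral_gammaDensity_mul (s : ℝ) (x : RSpace n) {g : RSpace n → ℂ} (hg : Measurable g)
    (μ : Measure (RSpace n)) [SFinite μ] :
    ∫⁻ y in J.pd, J.gammaDensity s x y *
      ∫⁻ ξ, ENNReal.ofReal (Real.exp (-inner ℝ ((4 * Real.pi) • ξ) y)) * ‖g ξ‖ₑ ^ 2 ∂μ =
    ∫⁻ ξ, (∫⁻ y in J.pd, J.gammaDensity s (x + (4 * Real.pi) • ξ) y) * ‖g ξ‖ₑ ^ 2 ∂μ := by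
  have hpt : ∀ y ξ : RSpace n, J.gammaDensity s x y *
      (ENNReal.ofReal (Real.exp (-inner ℝ ((4 * Real.pi) • ξ) y)) * ‖g ξ‖ₑ ^ 2) =
      J.gammaDensity s (x + (4 * Real.pi) • ξ) y * ‖g ξ‖ₑ ^ 2 := fun y ξ => by
    rw [← _root_.mul_assoc, gammaDensity, gammaDensity, _root_.mul_comm (ENNReal.ofReal _),
      ← ENNReal.ofReal_mul (Real.exp_pos _).le, ← _root_.mul_assoc, ← Real.exp_add, inner_add_left,
      neg_add_rev]
  have hm : Measurable fun p : RSpace n × RSpace n =>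
      J.gammaDensity s (x + (4 * Real.pi) • p.2) p.1 * ‖g p.2‖ₑ ^ 2 := by
    refine Measurable.mul ?_ ((hg.comp measurable_snd).enorm.pow_const 2)
    have hc : Continuous fun p : RSpace n × RSpace n => x + (4 * Real.pi) • p.2 := by fun_prop
    exact measurable_gammaDensity_comp s hc.measurable measurable_fst
  have hm1 : ∀ y, Measurable fun ξ : RSpace n =>
      ENNReal.ofReal (Real.exp (-inner ℝ ((4 * Real.pi) • ξ) y)) * ‖g ξ‖ₑ ^ 2 := fun y => by
    refine Measurable.mul ?_ (hg.enorm.pow_const 2)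
    exact ENNReal.measurable_ofReal.comp (by fun_prop : Continuous fun ξ : RSpace n =>
      Real.exp (-inner ℝ ((4 * Real.pi) • ξ) y)).measurable
  calc _ = ∫⁻ y in J.pd, ∫⁻ ξ, J.gammaDensity s (x + (4 * Real.pi) • ξ) y * ‖g ξ‖ₑ ^ 2 ∂μ := by
        refine lintegral_congr fun y => ?_
        rw [← lintegral_const_mul _ (hm1 y)]
        exact lintegral_congr fun ξ => hpt y ξ
    _ = ∫⁻ ξ, (∫⁻ y in J.pd, J.gammaDensity s (x + (4 * Real.pi) • ξ) y * ‖g ξ‖ₑ ^ 2) ∂μ :=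
        lintegral_lintegral_swap hm.aemeasurable
    _ = _ := by
        refine lintegral_congr fun ξ => ?_
        rw [lintegral_mul_const]
        exact measurable_gammaDensity_comp s measurable_const measurable_id

/-- A weighted integrability condition confines the spectrum to a translate of the closed cone. -/
theorem ae_mem_psd_of_lintegral (s : ℝ) (x : RSpace n) {g : RSpace n → ℂ} (hg : Measurable g)
    (h : ∫⁻ y in J.pd, J.gammaDensity s x y *
      ∫⁻ ξ, ENNReal.ofReal (Real.exp (-inner ℝ ((4 * Real.pi) • ξ) y)) * ‖g ξ‖ₑ ^ 2 < ∞) :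
    ∀ᵐ ξ, g ξ ≠ 0 → x + (4 * Real.pi) • ξ ∈ J.psd := by
  rw [lintegral_gammaDensity_mul s x hg] at h
  have hm : Measurable fun ξ : RSpace n => (∫⁻ y in J.pd,
      J.gammaDensity s (x + (4 * Real.pi) • ξ) y) * ‖g ξ‖ₑ ^ 2 := by
    refine Measurable.mul ?_ (hg.enorm.pow_const 2)
    refine Measurable.lintegral_prod_right' (f := fun p : RSpace n × RSpace n =>
      J.gammaDensity s (x + (4 * Real.pi) • p.1) p.2) ?_
    have hc : Continuous fun p : RSpace n × RSpace n => x + (4 * Real.pi) • p.1 := by fun_prop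
    exact measurable_gammaDensity_comp s hc.measurable measurable_snd
  filter_upwards [ae_lt_top hm h.ne] with ξ hξ hne
  -- Outside `psd` the inner gamma integral is infinite, which is compatible with finiteness only
  -- where `g` vanishes.
  by_contra hx
  rw [J.lintegral_gammaDensity_eq_top s hx, ENNReal.top_mul (by simpa using hne)] at hξ
  exact lt_irrefl _ hξ

/-- The boundary of a convex set is null, so open and closed cone need not be distinguished. -/
theorem ae_mem_pd_of_psd {g : RSpace n → ℂ} (h : ∀ᵐ ξ, g ξ ≠ 0 → ξ ∈ J.psd) :
    ∀ᵐ ξ, ξ ∉ J.pd → g ξ = 0 := by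
  have hfr : (volume : Measure (RSpace n)) (frontier J.pd) = 0 := J.convex_pd.addHaar_frontier _
  filter_upwards [h, measure_eq_zero_iff_ae_notMem.1 hfr] with ξ hξ hf hn
  by_contra hne
  refine hf ⟨?_, ?_⟩
  · rw [J.closure_pd]
    exact hξ hne
  · rwa [J.isOpen_pd.interior_eq]

/-- A function on the tube whose spectrum is supported by the cone is the Fourier–Laplace
transform of its spectrum. -/
theorem eqOn_laplaceExt_of_spectrum (hirr : IsIrreducibleCone J.pd) {F : CSpace n → ℂ}
    (hF : IsLocallyHardy J.pd F) {g : RSpace n → ℂ} (hgm : Measurable g)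
    (hg : ∀ y (hy : y ∈ J.pd), hF.sliceFourier J.isOpen_pd hy =ᵐ[volume]
        fun ξ => (Real.exp (-(2 * Real.pi * inner ℝ y ξ)) : ℂ) * g ξ)
    (hsupp : ∀ᵐ ξ, ξ ∉ J.pd → g ξ = 0) :
    J.IsLaplaceSq g ∧ Set.EqOn F (J.laplaceExt g) (tube J.pd) := by
  have hsq : J.IsLaplaceSq g := by
    refine ⟨hgm, fun y hy => ?_⟩
    have h := hF.lintegral_slice_lt_top J.isOpen_pd hy
    rw [hF.lintegral_slice_eq J.isOpen_pd hg hy] at h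
    exact (setLIntegral_le_lintegral _ _).trans_lt h
  refine ⟨hsq, fun z hz => ?_⟩
  have hy : imPart z ∈ J.pd := hz
  set y := imPart z
  have h1 : hF.sliceFourier J.isOpen_pd hy =ᵐ[volume] J.pd.indicator fun ξ =>
      (Real.exp (-(2 * Real.pi * inner ℝ y ξ)) : ℂ) * g ξ := by
    filter_upwards [hg y hy, hsupp] with ξ h1 h2
    rw [h1]
    by_cases hξ : ξ ∈ J.pd
    · rw [Set.indicator_of_mem hξ]
    · rw [Set.indicator_of_notMem hξ, h2 hξ, mul_zero]
  have h2 := ae_eq_fourierInv (hsq.integrable_indicator hirr hy) h1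
  have h3 : (fun x => F (complexPoint x y)) =ᵐ[volume]
      fun x => J.laplaceExt g (complexPoint x y) := by
    filter_upwards [h2, (hF.memLp_slice J.isOpen_pd hy).coeFn_toLp] with x h2 h3
    rw [laplaceExt_complexPoint, ← h2, h3]
  have hc : Continuous fun x : RSpace n => complexPoint x y :=
    continuous_complexPoint.comp (by fun_prop : Continuous fun x : RSpace n => (x, y))
  -- Both slices are continuous, so almost everywhere equality is equality.
  have h4 := (Continuous.ae_eq_iff_eq volume
    (hF.differentiableOn.continuousOn.comp_continuous hc fun x => hy)
    ((hsq.isLaplaceAdmissible hirr).differentiableOn.continuousOn.comp_continuous hc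
      fun x => hy)).1 h3
  exact congrFun h4 (rePart z)

/-- The energy of the boundary value. -/
theorem iSup_sliceEnergy {f : RSpace n → ℂ} (hf : Measurable f) :
    ⨆ y : J.pd, J.sliceEnergy f y = ∫⁻ ξ in J.pd, ‖f ξ‖ₑ ^ 2 := by
  refine le_antisymm (iSup_le fun y => setLIntegral_mono' J.measurableSet_pd fun ξ hξ => ?_) ?_
  · refine mul_le_of_le_one_left zero_le ?_
    rw [ENNReal.ofReal_le_one, Real.exp_le_one_iff, real_inner_smul_left]
    have := J.inner_psd_nonneg (J.pd_subset_psd hξ) (J.pd_subset_psd y.2)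
    have : 0 ≤ 4 * Real.pi * inner ℝ ξ (y : RSpace n) := by positivity
    linarith
  -- Monotone convergence along `e/(k+1) → 0` gives the other inequality.
  · have hk : ∀ k : ℕ, (1 / ((k : ℝ) + 1)) • J.one ∈ J.pd := fun k =>
      J.smul_mem_pd J.one_mem_pd (by positivity)
    refine le_of_tendsto' (lintegral_tendsto_of_tendsto_of_monotone
      (f := fun (k : ℕ) ξ => ENNReal.ofReal (Real.exp (-inner ℝ ((4 * Real.pi) • ξ)
        ((1 / ((k : ℝ) + 1)) • J.one))) * ‖f ξ‖ₑ ^ 2) (fun k => ?_) ?_ ?_)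
      fun k => le_iSup (fun y : J.pd => J.sliceEnergy f y) ⟨_, hk k⟩
    · refine (Measurable.mul ?_ (hf.enorm.pow_const 2)).aemeasurable
      exact ENNReal.measurable_ofReal.comp (by fun_prop : Continuous fun ξ : RSpace n =>
        Real.exp (-inner ℝ ((4 * Real.pi) • ξ) ((1 / ((k : ℝ) + 1)) • J.one))).measurable
    · filter_upwards [ae_restrict_mem J.measurableSet_pd] with ξ hξ k l hkl
      have h := J.inner_psd_nonneg (J.pd_subset_psd hξ) (J.pd_subset_psd J.one_mem_pd)
      have h' : 1 / ((l : ℝ) + 1) ≤ 1 / ((k : ℝ) + 1) := Nat.one_div_le_one_div hkl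
      simp only [real_inner_smul_left, real_inner_smul_right]
      gcongr
    · refine Eventually.of_forall fun ξ => ?_
      have hc : Continuous fun t : ℝ => ENNReal.ofReal (Real.exp (-inner ℝ ((4 * Real.pi) • ξ)
        (t • J.one))) * ‖f ξ‖ₑ ^ 2 := by
        refine (ENNReal.continuous_mul_const (by finiteness)).comp
          (ENNReal.continuous_ofReal.comp ?_)
        fun_prop
      have h := (hc.tendsto 0).comp tendsto_one_div_add_atTop_nhds_zero_nat
      simpa [Function.comp_def] using h

end EuclideanJordanAlgebra

end SpectralRepresentation

/-! ### Hardy and Bergman norms in terms of the spectrum -/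

section HardyBergman

open Complex Filter Topology

theorem measurable_zeroExtend {n : ℕ} {Ω : Set (RSpace n)} (hΩ : IsOpen Ω) {F : tube Ω → ℂ}
    (hF : IsHolomorphic F) : Measurable (zeroExtend F) :=
  (MeasurableEmbedding.subtype_coe (isOpen_tube hΩ).measurableSet).measurable_extend
    hF.continuous.measurable measurable_zero

theorem hardyENorm_sq {n : ℕ} {Ω : Set (RSpace n)} (F : tube Ω → ℂ) :
    hardyENorm F ^ 2 = ⨆ y : Ω, ∫⁻ x, ‖zeroExtend F (complexPoint x y)‖ₑ ^ 2 := by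
  rw [hardyENorm, Monotone.map_iSup_of_continuousAt (f := fun a : ℝ≥0∞ => a ^ 2)
    (ENNReal.continuous_pow 2).continuousAt (fun a b h => pow_le_pow_left' h 2) (by simp)]
  refine iSup_congr fun y => ?_
  rw [eLpNorm_two_sq]
  simp only [zeroExtend_complexPoint]

namespace EuclideanJordanAlgebra

variable {n : ℕ} {J : EuclideanJordanAlgebra n}

theorem bergmanENorm_sq {Ω : Set (RSpace n)} (hΩ : IsOpen Ω) (ν : ℝ) {F : tube Ω → ℂ}
    (hF : IsHolomorphic F) :
    J.bergmanENorm ν F ^ 2 = ∫⁻ y in Ω, ENNReal.ofReal (J.det y ^ (ν - (n : ℝ) / J.rank)) *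
      ∫⁻ x, ‖zeroExtend F (complexPoint x y)‖ₑ ^ 2 := by
  have hm : Measurable fun p : RSpace n × Ω => ‖F (tubePoint p.1 p.2)‖ₑ ^ 2 :=
    (hF.continuous.comp continuous_tubePoint).measurable.enorm.pow_const 2
  have hd : Measurable fun y : RSpace n =>
      ENNReal.ofReal (J.det y ^ (ν - (n : ℝ) / J.rank)) :=
    ENNReal.measurable_ofReal.comp (J.continuous_det.measurable.pow_const _)
  have hd' : Measurable fun p : RSpace n × Ω =>
      ENNReal.ofReal (J.det p.2 ^ (ν - (n : ℝ) / J.rank)) :=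
    hd.comp (measurable_subtype_coe.comp measurable_snd)
  have hσ : SigmaFinite (Measure.comap (Subtype.val : Ω → RSpace n) volume) := by
    refine SigmaFinite.of_map _ measurable_subtype_coe.aemeasurable ?_
    rw [map_comap_subtype_coe hΩ.measurableSet]
    infer_instance
  rw [bergmanENorm, eLpNorm_two_sq, bergmanMeasure,
    lintegral_withDensity_eq_lintegral_mul _ hd' hm, lintegral_prod_symm' _ (hd'.mul hm),
    ← lintegral_subtype_comap hΩ.measurableSet]
  refine lintegral_congr fun y => ?_
  simp only [Pi.mul_apply, zeroExtend_complexPoint]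
  exact lintegral_const_mul' _ _ ENNReal.ofReal_ne_top

theorem isLocallyHardy_of_hardyENorm {F : tube J.pd → ℂ} (hF : IsHolomorphic F)
    (h : hardyENorm F < ∞) : IsLocallyHardy J.pd (zeroExtend F) := by
  refine ⟨measurable_zeroExtend J.isOpen_pd hF, hF, fun K hK hKc => ?_⟩
  have h1 : hardyENorm F ^ 2 < ∞ := ENNReal.pow_lt_top h
  rw [hardyENorm_sq] at h1
  refine lt_of_le_of_lt (setLIntegral_mono' hKc.measurableSet
    (g := fun _ => ⨆ y : J.pd, ∫⁻ x, ‖zeroExtend F (complexPoint x y)‖ₑ ^ 2) fun y hy =>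
    le_iSup (fun y : J.pd => ∫⁻ x, ‖zeroExtend F (complexPoint x y)‖ₑ ^ 2) ⟨y, hK hy⟩) ?_
  rw [setLIntegral_const]
  exact ENNReal.mul_lt_top h1 hKc.measure_lt_top

/-- The weight is bounded below by a positive constant on each compact part of the cone. -/
theorem isLocallyHardy_of_bergmanENorm {F : tube J.pd → ℂ} (hF : IsHolomorphic F) {ν : ℝ}
    (h : J.bergmanENorm ν F < ∞) : IsLocallyHardy J.pd (zeroExtend F) := by
  refine ⟨measurable_zeroExtend J.isOpen_pd hF, hF, fun K hK hKc => ?_⟩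
  have h1 : J.bergmanENorm ν F ^ 2 < ∞ := ENNReal.pow_lt_top h
  rw [bergmanENorm_sq J.isOpen_pd ν hF] at h1
  set s := ν - (n : ℝ) / J.rank
  obtain ⟨δ, hδ, hle⟩ : ∃ δ : ℝ, 0 < δ ∧ ∀ y ∈ K, δ ≤ J.det y ^ s := by
    rcases K.eq_empty_or_nonempty with rfl | hne
    · exact ⟨1, one_pos, fun y hy => hy.elim⟩
    · have hc : ContinuousOn (fun y => J.det y ^ s) K :=
        J.continuous_det.continuousOn.rpow_const fun y hy => Or.inl (J.det_pos (hK hy)).ne'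
      obtain ⟨y₀, hy₀, hmin⟩ := hKc.exists_isMinOn hne hc
      exact ⟨_, Real.rpow_pos_of_pos (J.det_pos (hK hy₀)) s, fun y hy => hmin hy⟩
  have h2 : ENNReal.ofReal δ * ∫⁻ y in K, ∫⁻ x, ‖zeroExtend F (complexPoint x y)‖ₑ ^ 2 < ∞ := by
    rw [← lintegral_const_mul' _ _ ENNReal.ofReal_ne_top]
    refine lt_of_le_of_lt ?_ h1
    refine (setLIntegral_mono' hKc.measurableSet fun y hy => ?_).trans (lintegral_mono_set hK)
    gcongr
    exact hle y hy
  by_contra h3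
  rw [not_lt, top_le_iff] at h3
  rw [h3, ENNReal.mul_top (by simpa using hδ)] at h2
  exact lt_irrefl _ h2

/-- The slice norms are bounded but carry no decaying weight, so they are tested against
`e^{-⟨εe,y⟩}`. This puts `εe + 4πξ` in the closed cone for almost every `ξ` of the spectrum, and `ε
→ 0`. -/
theorem exists_laplaceExt_of_hardy (hirr : IsIrreducibleCone J.pd) {F : tube J.pd → ℂ}
    (hF : IsHolomorphic F) (h : hardyENorm F < ∞) :
    ∃ f, J.IsLaplaceSq f ∧ Set.EqOn (zeroExtend F) (J.laplaceExt f) (tube J.pd) := by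
  have hl := isLocallyHardy_of_hardyENorm hF h
  obtain ⟨g, hgm, hg⟩ := hl.exists_spectrum J.isOpen_pd J.convex_pd ⟨_, J.one_mem_pd⟩
  refine ⟨g, eqOn_laplaceExt_of_spectrum hirr hl hgm.measurable hg (ae_mem_pd_of_psd ?_)⟩
  have hfin : hardyENorm F ^ 2 < ∞ := ENNReal.pow_lt_top h
  rw [hardyENorm_sq] at hfin
  have hk : ∀ k : ℕ, ∀ᵐ ξ, g ξ ≠ 0 →
      (1 / ((k : ℝ) + 1)) • J.one + (4 * Real.pi) • ξ ∈ J.psd := by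
    intro k
    refine ae_mem_psd_of_lintegral 0 _ hgm.measurable ?_
    refine lt_of_le_of_lt (setLIntegral_mono' J.measurableSet_pd
      (g := fun y => J.gammaDensity 0 ((1 / ((k : ℝ) + 1)) • J.one) y *
        ⨆ y : J.pd, ∫⁻ x, ‖zeroExtend F (complexPoint x y)‖ₑ ^ 2) fun y hy => ?_) ?_
    · rw [← hl.lintegral_slice_eq J.isOpen_pd hg hy]
      gcongr
      exact le_iSup (fun y : J.pd => ∫⁻ x, ‖zeroExtend F (complexPoint x y)‖ₑ ^ 2) ⟨y, hy⟩
    · rw [lintegral_mul_const' _ _ hfin.ne]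
      refine ENNReal.mul_lt_top ?_ hfin
      rw [J.lintegral_gammaDensity hirr 0 (J.smul_mem_pd J.one_mem_pd (by positivity))]
      exact ENNReal.mul_lt_top ENNReal.ofReal_lt_top
        (J.lintegral_gammaDensity_one_lt_top (by norm_num))
  filter_upwards [ae_all_iff.2 hk] with ξ hξ hne
  have hc : Continuous fun t : ℝ => t • J.one + (4 * Real.pi) • ξ := by fun_prop
  have h1 := (hc.tendsto 0).comp tendsto_one_div_add_atTop_nhds_zero_nat
  have h2 := J.isClosed_psd.mem_of_tendsto h1 (Eventually.of_forall fun k => hξ k hne)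
  rw [zero_smul, zero_add] at h2
  have h3 := J.smul_mem_psd h2 (t := (4 * Real.pi)⁻¹) (by positivity)
  rwa [smul_smul, inv_mul_cancel₀ (by positivity), one_smul] at h3

/-- The Bergman norm is itself the weighted integral of `ae_mem_psd_of_lintegral` with `x = 0`, so
no regularization is needed. -/
theorem exists_laplaceExt_of_bergman (hirr : IsIrreducibleCone J.pd) {ν : ℝ} {F : tube J.pd → ℂ}
    (hF : IsHolomorphic F) (h : J.bergmanENorm ν F < ∞) :
    ∃ f, J.IsLaplaceSq f ∧ Set.EqOn (zeroExtend F) (J.laplaceExt f) (tube J.pd) := by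
  have hl := isLocallyHardy_of_bergmanENorm hF h
  obtain ⟨g, hgm, hg⟩ := hl.exists_spectrum J.isOpen_pd J.convex_pd ⟨_, J.one_mem_pd⟩
  refine ⟨g, eqOn_laplaceExt_of_spectrum hirr hl hgm.measurable hg (ae_mem_pd_of_psd ?_)⟩
  have hfin : J.bergmanENorm ν F ^ 2 < ∞ := ENNReal.pow_lt_top h
  rw [bergmanENorm_sq J.isOpen_pd ν hF] at hfin
  have h1 : ∀ᵐ ξ, g ξ ≠ 0 → 0 + (4 * Real.pi) • ξ ∈ J.psd := by
    refine ae_mem_psd_of_lintegral (ν - (n : ℝ) / J.rank) 0 hgm.measurable ?_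
    refine lt_of_eq_of_lt (setLIntegral_congr_fun J.measurableSet_pd fun y hy => ?_) hfin
    simp only [gammaDensity, inner_zero_left, neg_zero, Real.exp_zero, _root_.one_mul]
    rw [hl.lintegral_slice_eq J.isOpen_pd hg hy]
  filter_upwards [h1] with ξ hξ hne
  have h3 := J.smul_mem_psd (hξ hne) (t := (4 * Real.pi)⁻¹) (by positivity)
  rwa [zero_add, smul_smul, inv_mul_cancel₀ (by positivity), one_smul] at h3

theorem hardyENorm_sq_of_eqOn (hirr : IsIrreducibleCone J.pd) {f : RSpace n → ℂ}
    (hf : J.IsLaplaceSq f) {F : tube J.pd → ℂ}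
    (hF : Set.EqOn (zeroExtend F) (J.laplaceExt f) (tube J.pd)) :
    hardyENorm F ^ 2 = ∫⁻ ξ in J.pd, ‖f ξ‖ₑ ^ 2 := by
  rw [hardyENorm_sq, ← iSup_sliceEnergy hf.measurable]
  refine iSup_congr fun y => ?_
  rw [← hf.lintegral_slice hirr y.2]
  exact lintegral_congr fun x => by rw [hF (complexPoint_mem_tube.2 y.2)]

theorem isHolomorphic_of_eqOn (hirr : IsIrreducibleCone J.pd) {f : RSpace n → ℂ}
    (hf : J.IsLaplaceSq f) {F : tube J.pd → ℂ}
    (hF : Set.EqOn (zeroExtend F) (J.laplaceExt f) (tube J.pd)) : IsHolomorphic F :=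
  (hf.isLaplaceAdmissible hirr).differentiableOn.congr hF

/-- Plancherel on each slice and Tonelli leave the gamma integral at `4πξ`, with exponent `-(s +
n/r) = -ν`. -/
theorem bergmanENorm_sq_of_eqOn (hirr : IsIrreducibleCone J.pd) {f : RSpace n → ℂ}
    (hf : J.IsLaplaceSq f) {F : tube J.pd → ℂ}
    (hF : Set.EqOn (zeroExtend F) (J.laplaceExt f) (tube J.pd)) (ν : ℝ) :
    J.bergmanENorm ν F ^ 2 =
      (∫⁻ y in J.pd, J.gammaDensity (ν - (n : ℝ) / J.rank) J.one y) *
      ∫⁻ ξ in J.pd, ENNReal.ofReal (J.det ((4 * Real.pi) • ξ) ^ (-ν)) * ‖f ξ‖ₑ ^ 2 := by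
  rw [bergmanENorm_sq J.isOpen_pd ν (isHolomorphic_of_eqOn hirr hf hF)]
  set s := ν - (n : ℝ) / J.rank
  have h1 := lintegral_gammaDensity_mul (J := J) s 0 hf.measurable (volume.restrict J.pd)
  calc _ = ∫⁻ y in J.pd, J.gammaDensity s 0 y * ∫⁻ ξ in J.pd,
        ENNReal.ofReal (Real.exp (-inner ℝ ((4 * Real.pi) • ξ) y)) * ‖f ξ‖ₑ ^ 2 := by
        refine setLIntegral_congr_fun J.measurableSet_pd fun y hy => ?_
        simp only [gammaDensity, inner_zero_left, neg_zero, Real.exp_zero, _root_.one_mul]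
        congr 1
        refine Eq.trans ?_ (hf.lintegral_slice hirr hy)
        exact lintegral_congr fun x => by rw [hF (complexPoint_mem_tube.2 hy)]
    _ = _ := by
        rw [h1, ← lintegral_const_mul]
        · refine setLIntegral_congr_fun J.measurableSet_pd fun ξ hξ => ?_
          have h2 := J.lintegral_gammaDensity hirr s
            (J.smul_mem_pd hξ (t := 4 * Real.pi) (by positivity))
          simp only [zero_add, h2]
          rw [show s + n / J.rank = ν by simp only [s, sub_add_cancel], _root_.mul_comm
            (ENNReal.ofReal _), _root_.mul_assoc]
        · refine Measurable.mul ?_ (hf.measurable.enorm.pow_const 2)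
          refine ENNReal.measurable_ofReal.comp (Measurable.pow_const ?_ _)
          exact (J.continuous_det.comp (by fun_prop : Continuous fun ξ : RSpace n =>
            (4 * Real.pi) • ξ)).measurable

theorem IsLaplaceSq.det_pow_mul {f : RSpace n → ℂ} (hf : J.IsLaplaceSq f) (m : ℕ) :
    J.IsLaplaceSq fun ξ => (J.det ((2 * Real.pi) • ξ) : ℂ) ^ m * f ξ := by
  obtain ⟨C, N, hC, hb⟩ := MvPolynomial.exists_eval_bound J.detPoly
  have hm : Measurable fun ξ : RSpace n => (J.det ((2 * Real.pi) • ξ) : ℂ) ^ m :=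
    ((Complex.continuous_ofReal.comp (J.continuous_det.comp (by fun_prop :
      Continuous fun ξ : RSpace n => (2 * Real.pi) • ξ))).pow m).measurable
  refine hf.mul_of_bound hm (C := (C * (1 + 2 * Real.pi) ^ N) ^ m) (N := N * m) (by positivity)
    fun ξ => ?_
  rw [norm_pow, Complex.norm_real, Real.norm_eq_abs, pow_mul, ← mul_pow, _root_.mul_assoc,
    ← mul_pow]
  refine pow_le_pow_left₀ (abs_nonneg _) ((hb _).trans ?_) m
  gcongr
  rw [norm_smul, Real.norm_of_nonneg (by positivity)]
  nlinarith [norm_nonneg ξ, Real.pi_pos]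

/-- The isometry constant. -/
theorem bergmanENorm_sq_of_det_pow (hirr : IsIrreducibleCone J.pd) {f : RSpace n → ℂ} (m : ℕ)
    (hf : J.IsLaplaceSq fun ξ => (J.det ((2 * Real.pi) • ξ) : ℂ) ^ m * f ξ) {F : tube J.pd → ℂ}
    (hF : Set.EqOn (zeroExtend F)
      (J.laplaceExt fun ξ => (J.det ((2 * Real.pi) • ξ) : ℂ) ^ m * f ξ) (tube J.pd)) :
    J.bergmanENorm (2 * m) F ^ 2 =
      (∫⁻ y in J.pd, J.gammaDensity (2 * m - (n : ℝ) / J.rank) J.one y) *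
        ENNReal.ofReal ((2 ^ (2 * m * J.rank))⁻¹) * ∫⁻ ξ in J.pd, ‖f ξ‖ₑ ^ 2 := by
  rw [bergmanENorm_sq_of_eqOn hirr hf hF, _root_.mul_assoc,
    ← lintegral_const_mul' _ _ ENNReal.ofReal_ne_top]
  congr 1
  refine setLIntegral_congr_fun J.measurableSet_pd fun ξ hξ => ?_
  have hd : 0 < J.det ((2 * Real.pi) • ξ) := J.det_pos (J.smul_mem_pd hξ (by positivity))
  set d := J.det ((2 * Real.pi) • ξ)
  -- Source of the constant: `Δ(4πξ) = 2^r Δ(2πξ)`, so `Δ(4πξ)^{-2m} Δ(2πξ)^{2m} = 2^{-2mr}`.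
  have h4 : J.det ((4 * Real.pi) • ξ) = 2 ^ J.rank * d := by
    rw [show (4 * Real.pi) • ξ = (2 : ℝ) • (2 * Real.pi) • ξ by rw [smul_smul]; congr 1; ring,
      J.det_smul two_ne_zero]
  simp only [h4, enorm_mul, mul_pow, enorm_pow]
  rw [← _root_.mul_assoc, ← ofReal_norm (d : ℂ), Complex.norm_real, Real.norm_of_nonneg hd.le,
    ← ENNReal.ofReal_pow hd.le, ← ENNReal.ofReal_pow (by positivity),
    ← ENNReal.ofReal_mul (by positivity)]
  congr 2
  rw [Real.rpow_neg (by positivity), show (2 * (m : ℝ)) = ((2 * m : ℕ) : ℝ) by push_cast; rfl,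
    Real.rpow_natCast, mul_pow, ← pow_mul, ← pow_mul]
  field_simp
  ring

end EuclideanJordanAlgebra

end HardyBergman

/-! ### The isomorphism given by powers of the box operator -/

section BoxIsomorphism

theorem eq_of_zeroExtend_eqOn {n : ℕ} {Ω : Set (RSpace n)} {F G : tube Ω → ℂ}
    (h : Set.EqOn (zeroExtend F) (zeroExtend G) (tube Ω)) : F = G := by
  funext z
  rw [← zeroExtend_coe F z, ← zeroExtend_coe G z, h z.2]

namespace EuclideanJordanAlgebra

variable {n : ℕ} {J : EuclideanJordanAlgebra n}

theorem bergmanENorm_box_iterate_sq (hirr : IsIrreducibleCone J.pd) (m : ℕ) {F : tube J.pd → ℂ}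
    (hF : IsHolomorphic F) (h : hardyENorm F < ∞) :
    IsHolomorphic (J.box^[m] F) ∧ J.bergmanENorm (2 * m) (J.box^[m] F) ^ 2 =
      (∫⁻ y in J.pd, J.gammaDensity (2 * m - (n : ℝ) / J.rank) J.one y) *
        ENNReal.ofReal ((2 ^ (2 * m * J.rank))⁻¹) * hardyENorm F ^ 2 := by
  obtain ⟨f, hf, he⟩ := exists_laplaceExt_of_hardy hirr hF h
  have hb := ((hf.isLaplaceAdmissible hirr).box_iterate he m).2
  rw [bergmanENorm_sq_of_det_pow hirr m (hf.det_pow_mul m) hb, hardyENorm_sq_of_eqOn hirr hf he]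
  exact ⟨isHolomorphic_of_eqOn hirr (hf.det_pow_mul m) hb, rfl⟩

/-- The partial derivatives take default values at points of nondifferentiability, so additivity is
read off on the spectral side, where `□ᵐ` is a multiplication. -/
theorem box_iterate_add (hirr : IsIrreducibleCone J.pd) (m : ℕ) {F G : tube J.pd → ℂ}
    (hF : IsHolomorphic F) (hF' : hardyENorm F < ∞) (hG : IsHolomorphic G)
    (hG' : hardyENorm G < ∞) : J.box^[m] (F + G) = J.box^[m] F + J.box^[m] G := by
  obtain ⟨f, hf, hfe⟩ := exists_laplaceExt_of_hardy hirr hF hF'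
  obtain ⟨g, hg, hge⟩ := exists_laplaceExt_of_hardy hirr hG hG'
  have hfa := hf.isLaplaceAdmissible hirr
  have hga := hg.isLaplaceAdmissible hirr
  have h1 : Set.EqOn (zeroExtend (F + G)) (J.laplaceExt fun ξ => f ξ + g ξ) (tube J.pd) :=
    fun z hz => by
      rw [zeroExtend_eqOn_add F G hz, laplaceExt_add hfa hga hz, Pi.add_apply, hfe hz, hge hz]
  refine eq_of_zeroExtend_eqOn fun z hz => ?_
  rw [((hfa.add hga).box_iterate h1 m).2 hz, zeroExtend_eqOn_add _ _ hz, Pi.add_apply,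
    (hfa.box_iterate hfe m).2 hz, (hga.box_iterate hge m).2 hz,
    ← laplaceExt_add (hfa.box_iterate hfe m).1 (hga.box_iterate hge m).1 hz]
  simp only [mul_add]

theorem box_iterate_smul (hirr : IsIrreducibleCone J.pd) (m : ℕ) (c : ℂ) {F : tube J.pd → ℂ}
    (hF : IsHolomorphic F) (hF' : hardyENorm F < ∞) :
    J.box^[m] (c • F) = c • J.box^[m] F := by
  obtain ⟨f, hf, hfe⟩ := exists_laplaceExt_of_hardy hirr hF hF'
  have hfa := hf.isLaplaceAdmissible hirr
  have h1 : Set.EqOn (zeroExtend (c • F)) (J.laplaceExt fun ξ => c * f ξ) (tube J.pd) :=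
    fun z hz => by
      rw [zeroExtend_eqOn_smul c F hz, laplaceExt_const_mul, Pi.smul_apply, hfe hz, smul_eq_mul]
  refine eq_of_zeroExtend_eqOn fun z hz => ?_
  rw [((hfa.const_mul c).box_iterate h1 m).2 hz, zeroExtend_eqOn_smul _ _ hz, Pi.smul_apply,
    (hfa.box_iterate hfe m).2 hz, smul_eq_mul, ← laplaceExt_const_mul]
  simp only [_root_.mul_left_comm]

theorem eq_zero_of_hardyENorm (hirr : IsIrreducibleCone J.pd) {F : tube J.pd → ℂ}
    (hF : IsHolomorphic F) (h : hardyENorm F = 0) : F = 0 := by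
  have hF' : hardyENorm F < ∞ := by rw [h]; exact ENNReal.zero_lt_top
  obtain ⟨f, hf, hfe⟩ := exists_laplaceExt_of_hardy hirr hF hF'
  have h1 := hardyENorm_sq_of_eqOn hirr hf hfe
  rw [h, zero_pow two_ne_zero, eq_comm, lintegral_eq_zero_iff (hf.measurable.enorm.pow_const 2)]
    at h1
  refine eq_of_zeroExtend_eqOn fun z hz => ?_
  rw [hfe hz, zeroExtend_coe 0 ⟨z, hz⟩, laplaceExt]
  refine integral_eq_zero_of_ae ?_
  filter_upwards [h1] with ξ hξ
  have h2 : f ξ = 0 := by simpa using hξ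
  simp [h2]

/-- Divide the spectrum of `G` by `Δ(2πξ)ᵐ`, which is nonzero on the cone, and take the
Fourier–Laplace transform. -/
theorem exists_box_iterate_eq (hirr : IsIrreducibleCone J.pd) (m : ℕ) {G : tube J.pd → ℂ}
    (hG : IsHolomorphic G) (h : J.bergmanENorm (2 * m) G < ∞) :
    ∃ F : tube J.pd → ℂ, IsHolomorphic F ∧ hardyENorm F < ∞ ∧ J.box^[m] F = G := by
  obtain ⟨g, hg, hge⟩ := exists_laplaceExt_of_bergman hirr hG h
  set f : RSpace n → ℂ := fun ξ => ((J.det ((2 * Real.pi) • ξ) : ℂ) ^ m)⁻¹ * g ξ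
  have hc : Continuous fun ξ : RSpace n => (J.det ((2 * Real.pi) • ξ) : ℂ) ^ m :=
    (Complex.continuous_ofReal.comp (J.continuous_det.comp (by fun_prop :
      Continuous fun ξ : RSpace n => (2 * Real.pi) • ξ))).pow m
  have hfm : Measurable f := hc.measurable.inv.mul hg.measurable
  have hfg : ∀ ξ ∈ J.pd, (J.det ((2 * Real.pi) • ξ) : ℂ) ^ m * f ξ = g ξ := fun ξ hξ => by
    have hd : (J.det ((2 * Real.pi) • ξ) : ℂ) ≠ 0 := Complex.ofReal_ne_zero.2
      (J.det_pos (J.smul_mem_pd hξ (by positivity))).ne'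
    rw [mul_inv_cancel_left₀ (pow_ne_zero m hd)]
  have hsq : J.IsLaplaceSq fun ξ => (J.det ((2 * Real.pi) • ξ) : ℂ) ^ m * f ξ := by
    refine ⟨hc.measurable.mul hfm, fun y hy => lt_of_eq_of_lt ?_ (hg.energy_lt_top y hy)⟩
    refine setLIntegral_congr_fun J.measurableSet_pd fun ξ hξ => ?_
    simp only [hfg ξ hξ]
  have hGe : Set.EqOn (zeroExtend G)
      (J.laplaceExt fun ξ => (J.det ((2 * Real.pi) • ξ) : ℂ) ^ m * f ξ) (tube J.pd) := by
    rwa [laplaceExt_congr hfg]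
  -- The norm identity needs regularity only of the product `Δ(2πξ)ᵐ f`, not of `f`; since its
  -- constant is nonzero, it shows that `f` is square integrable.
  have hN : ∫⁻ ξ in J.pd, ‖f ξ‖ₑ ^ 2 < ∞ := by
    have h1 := bergmanENorm_sq_of_det_pow hirr m hsq hGe
    have h2 : J.bergmanENorm (2 * m) G ^ 2 < ∞ := ENNReal.pow_lt_top h
    rw [h1] at h2
    by_contra h3
    rw [not_lt, top_le_iff] at h3
    have hpos := J.lintegral_gammaDensity_pos (2 * m - (n : ℝ) / J.rank) J.one J.isOpen_pd
      ⟨_, J.one_mem_pd⟩ subset_rfl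
    rw [h3, ENNReal.mul_top] at h2
    · exact lt_irrefl _ h2
    · refine mul_ne_zero hpos.ne' ?_
      rw [Ne, ENNReal.ofReal_eq_zero, not_le]
      positivity
  have hf : J.IsLaplaceSq f := ⟨hfm, fun y hy => lt_of_le_of_lt
    (le_iSup (fun y : J.pd => J.sliceEnergy f y) ⟨y, hy⟩) (by rwa [iSup_sliceEnergy hfm])⟩
  set F : tube J.pd → ℂ := fun z => J.laplaceExt f z
  have hFe : Set.EqOn (zeroExtend F) (J.laplaceExt f) (tube J.pd) := fun z hz =>
    zeroExtend_coe F ⟨z, hz⟩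
  refine ⟨F, isHolomorphic_of_eqOn hirr hf hFe, ?_, eq_of_zeroExtend_eqOn fun z hz => ?_⟩
  · rw [← hardyENorm_sq_of_eqOn hirr hf hFe] at hN
    exact (ENNReal.pow_lt_top_iff.1 hN).resolve_right two_ne_zero
  · rw [((hf.isLaplaceAdmissible hirr).box_iterate hFe m).2 hz, hGe hz]

variable (J) in
/-- The constant `2^{-2mr} Γ_Ω(2m)`. -/
noncomputable def boxConstant (m : ℕ) : ℝ := J.gammaCone (2 * m) / 2 ^ (2 * m * J.rank)

/-- The condition on `m` says that the exponent `2m - n/r` exceeds `-1`, the range where the gamma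
integral was shown to converge. -/
theorem boxConstant_pos {m : ℕ} (hm : (n : ℝ) / J.rank - 1 < 2 * m) : 0 < J.boxConstant m := by
  refine div_pos ?_ (by positivity)
  rw [J.gammaCone_eq]
  exact ENNReal.toReal_pos (J.lintegral_gammaDensity_pos _ J.one J.isOpen_pd ⟨_, J.one_mem_pd⟩
    subset_rfl).ne' (J.lintegral_gammaDensity_one_lt_top (by linarith)).ne

theorem bergmanENorm_box_iterate_lt_top (hirr : IsIrreducibleCone J.pd) {m : ℕ}
    (hm : (n : ℝ) / J.rank - 1 < 2 * m) {F : tube J.pd → ℂ}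
    (hF : IsHolomorphic F) (h : hardyENorm F < ∞) :
    J.bergmanENorm (2 * m) (J.box^[m] F) < ∞ := by
  have h1 : J.bergmanENorm (2 * m) (J.box^[m] F) ^ 2 < ∞ := by
    rw [(bergmanENorm_box_iterate_sq hirr m hF h).2]
    exact ENNReal.mul_lt_top (ENNReal.mul_lt_top
      (J.lintegral_gammaDensity_one_lt_top (by linarith)) ENNReal.ofReal_lt_top)
      (ENNReal.pow_lt_top h)
  exact (ENNReal.pow_lt_top_iff.1 h1).resolve_right two_ne_zero

/-- `□ᵐ` as a linear map from the Hardy space to the Bergman space. -/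
noncomputable def boxLinearMap (hirr : IsIrreducibleCone J.pd) {m : ℕ}
    (hm : (n : ℝ) / J.rank - 1 < 2 * m) : HardySpace J.pd →ₗ[ℂ] BergmanSpace J J.pd (2 * m) where
  toFun F := ⟨J.box^[m] F.toFun, (bergmanENorm_box_iterate_sq hirr m F.2.1 F.2.2).1,
    bergmanENorm_box_iterate_lt_top hirr hm F.2.1 F.2.2⟩
  map_add' F G := Subtype.ext (box_iterate_add hirr m F.2.1 F.2.2 G.2.1 G.2.2)
  map_smul' c F := Subtype.ext (box_iterate_smul hirr m c F.2.1 F.2.2)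

theorem norm_boxLinearMap_sq (hirr : IsIrreducibleCone J.pd) {m : ℕ}
    (hm : (n : ℝ) / J.rank - 1 < 2 * m) (F : HardySpace J.pd) :
    ‖boxLinearMap hirr hm F‖ ^ 2 = J.boxConstant m * ‖F‖ ^ 2 := by
  rw [BergmanSpace.norm_def, HardySpace.norm_def, ← ENNReal.toReal_pow, ← ENNReal.toReal_pow]
  change (J.bergmanENorm (2 * m) (J.box^[m] F.toFun) ^ 2).toReal = _
  have h := (bergmanENorm_box_iterate_sq hirr m (F := F.toFun) F.2.1 F.2.2).2
  rw [h, ENNReal.toReal_mul, ENNReal.toReal_mul,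
    ENNReal.toReal_ofReal (by positivity), boxConstant, J.gammaCone_eq]
  ring

theorem boxLinearMap_bijective (hirr : IsIrreducibleCone J.pd) {m : ℕ}
    (hm : (n : ℝ) / J.rank - 1 < 2 * m) : Function.Bijective (boxLinearMap hirr hm) := by
  refine ⟨(injective_iff_map_eq_zero _).2 fun F hF => ?_, fun G => ?_⟩
  · have h := norm_boxLinearMap_sq hirr hm F
    rw [hF, norm_zero, zero_pow two_ne_zero, eq_comm, mul_eq_zero] at h
    have h1 : ‖F‖ = 0 := by simpa using h.resolve_left (boxConstant_pos hm).ne'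
    rw [HardySpace.norm_def, ENNReal.toReal_eq_zero_iff] at h1
    exact Subtype.ext (eq_zero_of_hardyENorm hirr F.2.1 (h1.resolve_right F.2.2.ne))
  · obtain ⟨F, hF, hF', he⟩ := exists_box_iterate_eq hirr m G.2.1 G.2.2
    exact ⟨⟨F, hF, hF'⟩, Subtype.ext he⟩

theorem norm_boxLinearMap (hirr : IsIrreducibleCone J.pd) {m : ℕ}
    (hm : (n : ℝ) / J.rank - 1 < 2 * m) (F : HardySpace J.pd) :
    ‖boxLinearMap hirr hm F‖ = √(J.boxConstant m) * ‖F‖ := by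
  rw [← Real.sqrt_sq (norm_nonneg (boxLinearMap hirr hm F)), norm_boxLinearMap_sq,
    Real.sqrt_mul (boxConstant_pos hm).le, Real.sqrt_sq (norm_nonneg F)]

/-- `□ᵐ` as an isomorphism of the Hardy space onto the Bergman space. -/
noncomputable def boxEquiv (hirr : IsIrreducibleCone J.pd) {m : ℕ}
    (hm : (n : ℝ) / J.rank - 1 < 2 * m) : HardySpace J.pd ≃L[ℂ] BergmanSpace J J.pd (2 * m) :=
  (LinearEquiv.ofBijective (boxLinearMap hirr hm)
    (boxLinearMap_bijective hirr hm)).toContinuousLinearEquivOfBounds (√(J.boxConstant m))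
    (√(J.boxConstant m))⁻¹ (fun F => (norm_boxLinearMap hirr hm F).le) fun G => by
      obtain ⟨F, rfl⟩ := (boxLinearMap_bijective hirr hm).2 G
      have h : (LinearEquiv.ofBijective (boxLinearMap hirr hm)
          (boxLinearMap_bijective hirr hm)).symm (boxLinearMap hirr hm F) = F :=
        LinearEquiv.ofBijective_symm_apply_apply _ F
      rw [h, norm_boxLinearMap, inv_mul_cancel_left₀ (Real.sqrt_pos.2 (boxConstant_pos hm)).ne']

end EuclideanJordanAlgebra

end BoxIsomorphism

theorem mainTheorem2 {n : ℕ} (Ω : Set (RSpace n)) (hΩ : IsSymmetricCone Ω)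
    (hirr : IsIrreducibleCone Ω) (J : EuclideanJordanAlgebra n) (hJ : J.cone = Ω)
    (m : ℕ) (hm : (n : ℝ) / J.rank - 1 < 2 * m) :
    ∃ L : HardySpace Ω ≃L[ℂ] BergmanSpace J Ω (2 * m),
      (∀ F : HardySpace Ω, (L F).toFun = J.box^[m] F.toFun) ∧
      ∀ F : HardySpace Ω,
        ‖L F‖ ^ 2 = J.gammaCone (2 * m) / 2 ^ (2 * m * J.rank) * ‖F‖ ^ 2 := by
  obtain rfl : Ω = J.pd := hJ.symm.trans J.cone_eq
  exact ⟨EuclideanJordanAlgebra.boxEquiv hirr hm, fun F => rfl,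
    EuclideanJordanAlgebra.norm_boxLinearMap_sq hirr hm⟩
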